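/- **Timed automata.** Clock valuations over a finite set $X$ of clocks are maps $v:X\to\mathbb R_+$; $(v+\tau)(x)=v(x)+\tau$, and $[Y\leftarrow 0]v$ resets the clocks of $Y\subseteq X$. A guard is a finite conjunction of constraints $x\sim c$ with $x\in X$, $c\in\mathbb N$, $\sim\,\in\{<,\le,=,\ge,>\}$. Let $\mathcal A=(L,X,E,\mathcal I,\mathcal L)$ be a timed automaton over a finite set $\mathsf{AP}$ of atomic propositions: finite sets of locations, clocks and edges $e=(\ell\xrightarrow{g,Y}\ell')$ (parallel edges being allowed), invariants $\mathcal I(\ell)$ (guards) and labels $\mathcal L(\ell)\subseteq\mathsf{AP}$. A state is a pair $s=(\ell,v)$ with $v\models\mathcal I(\ell)$. There is a transition $(\ell,v)\xrightarrow{\tau,e}(\ell',v')$ with $e=(\ell\xrightarrow{g,Y}\ell')$ iff $v+\tau'\models\mathcal I(\ell)$ for all $0\le\tau'\le\tau$, $v+\tau\models g$, $v'=[Y\leftarrow0](v+\tau)$ and $v'\models\mathcal I(\ell')$. Put $I(s,e)=\{\tau\mid s\xrightarrow{\tau,e}s'\text{ for some }s'\}$ and $I(s)=\bigcup_eI(s,e)$.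 A run is an infinite sequence of consecutive transitions. Assume that $\mathcal A$ is non-blocking: $I(s)\ne\emptyset$ for every state $s$. **Probabilities.** $\mathcal A$ is equipped with positive edge weights $w_e$ and with probability measures $\mu_s$ on $\mathbb R_+$, depending measurably on $s$, such that for every state $s$: $\mu_s(I(s))=1$; $\mu_s$ is equivalent to Lebesgue measure on $I(s)$ if $I(s)$ has positive Lebesgue measure; otherwise $\mu_s$ is equivalent to the uniform distribution on the points of $I(s)$. Write $s+t$ for $(\ell,v+t)$ when $s=(\ell,v)$. Let $p_s(e)=w_e/\sum\{w_{e'}\mid e'\text{ enabled in }s\text{ without delay}\}$ if $e$ is enabled in $s$ without delay, and $p_s(e)=0$ otherwise. $\mathrm{Prob}_{\mathcal A}$ is the probability measure on the runs from $s$ (with the $\sigma$-algebra generated by the cylinders of finite edge sequences with Borel constraints on the delays) for which, from each state $s$, a delay $t$ is drawn from $\mu_s$ and then an edge from $p_{s+t}$. A set of runs is almost sure if it is measurable and has probability $1$. **Topology.** For a finite edge sequence $e_1\dots e_n$ and $C\subseteq\mathbb R_+^n$, let $\mathrm{Pol}(\pi_C(s,e_1\dots e_n))$ be the set of $(\tau_1,\dots,\tau_n)\in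 C$ for which $s\xrightarrow{\tau_1,e_1}\cdots\xrightarrow{\tau_n,e_n}$ is a finite run, and let $C_i$ be its projection to the first $i$ coordinates ($C_0$ being true). The constrained path $\pi_C(s,e_1\dots e_n)$ is thin if for some $1\le i\le n$ one has $\dim\mathrm{Pol}(\pi_{C_i}(s,e_1\dots e_i))<\dim\bigcup_e\mathrm{Pol}(\pi_{C_{i-1}}(s,e_1\dots e_{i-1}e))$, and thick otherwise; an infinite (unconstrained) symbolic path $\pi(s,e_1e_2\dots)$ is thick if all its finite prefixes are. The basic open sets of the set of runs from $s$ are $\emptyset$, the whole set, and the cylinders of thick $\pi_C(s,e_1\dots e_n)$ with $C$ Borel and $\mathrm{Pol}(\pi_C)$ open in $\mathrm{Pol}(\pi(s,e_1\dots e_n))$. A set of runs is large if its complement is meagre. **Regions and fairness.** Let $M$ be the maximal constant of $\mathcal A$. Valuations $v,v'$ are region equivalent if for each clock $x$ either $v(x),v'(x)>M$, or $\lfloor v(x)\rfloor=\lfloor v'(x)\rfloor$ and ($v(x)\in\mathbb N$ iff $v'(x)\in\mathbb N$); and, for all $x,y$ with $v(x),v(y)\le M$, the fractional parts satisfy $\{v(x)\}\le\{v(y)\}$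 iff $\{v'(x)\}\le\{v'(y)\}$. The timed region automaton $R(\mathcal A)$ has locations $(\ell,r)$ ($r$ a region) with invariant $\mathcal I(\ell)$, and an edge $(\ell,r)\xrightarrow{r'',e,Y}(\ell',r')$, with guard "the valuation lies in $r''$" and resetting $Y$, whenever $e=(\ell\xrightarrow{g,Y}\ell')\in E$ and there are $v\in r$, $\tau\ge0$ with $(\ell,v)\xrightarrow{\tau,e}(\ell',v')$, $v+\tau\in r''$, $v'\in r'$. Put $\iota(\ell,v)=((\ell,[v]),v)$. An edge $f$ of $R(\mathcal A)$ with source $q=(\ell,r)$ is thin if $\dim I((q,v),f)<\dim I(q,v)$ for some $v\in r$, and thick otherwise. A path $q_0\xrightarrow{f_1}q_1\xrightarrow{f_2}\cdots$ of $R(\mathcal A)$ is fair if every thick edge whose source is $q_i$ for infinitely many $i$ equals $f_i$ for infinitely many $i$. A run of $\mathcal A$ is fair if its image in $R(\mathcal A)$ follows a fair path. For a property $P$ of sequences of locations, $\mathbb S(\mathcal A,s,P)$ is the condition: every infinite thick and fair symbolic path from $\iota(s)$ in $R(\mathcal A)$ satisfies $P$ (for the $L$-components of its locations). **Specifications.**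 Let $\mathcal B=(\mathsf L,\mathsf i_0,\mathsf X,\mathsf{AP},\mathsf E,\mathcal F)$ be a specification Büchi or Muller timed automaton: finite sets of locations, clocks, and edges $\mathsf l\xrightarrow{\mathsf g,u,\mathsf Y}\mathsf l'$ with $u\subseteq\mathsf{AP}$; an input function $\mathsf i_0:2^{\mathsf{AP}}\to\mathsf L$; a Büchi condition $\mathcal F\subseteq\mathsf L$ (some location of $\mathcal F$ is visited infinitely often) or a Muller condition $\mathcal F\subseteq2^{\mathsf L}$ (the set of locations visited infinitely often belongs to $\mathcal F$). It is deterministic (distinct edges with the same source and label have disjoint guards) and complete (for all $\mathsf l$, $u$ and every valuation $\mathsf v$, some edge from $\mathsf l$ labelled $u$ has a guard satisfied by $\mathsf v$). A word $u_0\tau_1u_1\tau_2u_2\cdots$ belongs to $P_{\mathcal B}$ if the unique run of $\mathcal B$ from $(\mathsf i_0(u_0),\mathbf 0)$ that at its $i$-th step waits $\tau_i$ and takes an edge labelled $u_i$ is accepting. A run of $\mathcal A$ with states $s_0,s_1,\dots$ and delays $\tau_1,\tau_2,\dots$ satisfies $\mathcal B$ if $\mathcal L(s_0)\tau_1\mathcal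 L(s_1)\tau_2\cdots\in P_{\mathcal B}$. The product $\mathcal A\ltimes\mathcal B$ has locations $L\times\mathsf L$, clocks $X\sqcup\mathsf X$, invariants $\mathcal I(\ell)$ at $(\ell,\mathsf l)$, and for all $e=(\ell\xrightarrow{g,Y}\ell')\in E$ and $\mathsf e=(\mathsf l\xrightarrow{\mathsf g,\mathcal L(\ell'),\mathsf Y}\mathsf l')\in\mathsf E$ an edge $e_{\mathsf e}=((\ell,\mathsf l)\xrightarrow{g\wedge\mathsf g,\,Y\cup\mathsf Y}(\ell',\mathsf l'))$ of weight $w_e$; its delay distribution at $((\ell,\mathsf l),v\mathsf v)$ is $\mu_{(\ell,v)}$. For a state $s=(\ell,v)$ of $\mathcal A$ put $\mathsf{init}(s)=((\ell,\mathsf i_0(\mathcal L(\ell))),v\mathbf 0)$, and let $P_{\mathcal A\ltimes\mathcal B}$ be the property that the $\mathsf L$-components of the visited locations satisfy $\mathcal F$. **Theorem.** Let $s$ be a state of $\mathcal A$, and assume that $\mathcal A\ltimes\mathcal B$ is almost-surely fair from $\mathsf{init}(s)$, i.e. $\mathrm{Prob}_{\mathcal A\ltimes\mathcal B}(\mathsf{init}(s)\models\mathsf{fair})=1$.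 Then the following are equivalent: 1. $\mathcal A$ almost surely satisfies $\mathcal B$ from $s$ (the set of runs from $s$ that satisfy $\mathcal B$ is almost sure); 2. $\mathcal A$ largely satisfies $\mathcal B$ from $s$ (this set of runs is large); 3. $\mathbb S(\mathcal A\ltimes\mathcal B,\mathsf{init}(s),P_{\mathcal A\ltimes\mathcal B})$. -/

import Mathlib

open MeasureTheory ProbabilityTheory Filter Topology
open scoped NNReal ENNReal

namespace STA

/-! ### Clocks, guards, states -/

/-- Letting time elapse: `(v + τ)(x) = v(x) + τ`. -/
def elapse {X : Type*} (v : X → ℝ≥0) (τ : ℝ≥0) : X → ℝ≥0 := fun x => v x + τ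

open Classical in
/-- `[Y ← 0] v`. -/
noncomputable def resetClocks {X : Type*} (Y : Set X) (v : X → ℝ≥0) : X → ℝ≥0 :=
  fun x => if x ∈ Y then 0 else v x

/-- The comparison symbols `<, ≤, =, ≥, >` of guards. -/
inductive Cmp
  | lt | le | eq | ge | gt

def Cmp.Holds : Cmp → ℝ≥0 → ℝ≥0 → Prop
  | .lt, a, b => a < b
  | .le, a, b => a ≤ b
  | .eq, a, b => a = b
  | .ge, a, b => b ≤ a
  | .gt, a, b => b < a

/-- An atomic constraint `x ∼ c`, with `c` a natural number. -/
structure Atom (X : Type*) where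
  clock : X
  cmp : Cmp
  const : ℕ

/-- A guard is a finite conjunction of atomic constraints. -/
abbrev Guard (X : Type*) := List (Atom X)

/-- The set of valuations that satisfy a guard. -/
def Guard.sat {X : Type*} (g : Guard X) : Set (X → ℝ≥0) :=
  {v | ∀ a ∈ g, a.cmp.Holds (v a.clock) (a.const : ℝ≥0)}

/-- Renaming of the clocks of a guard. -/
def Guard.rename {X Y : Type*} (f : X → Y) (g : Guard X) : Guard Y :=
  g.map fun a => ⟨f a.clock, a.cmp, a.const⟩

/-- A pair (location, clock valuation). -/
@[ext]
structure State (L X : Type*) where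
  loc : L
  val : X → ℝ≥0

/-- Locations are discrete, valuations carry the Borel sigma-algebra. -/
instance {L X : Type*} : MeasurableSpace (State L X) :=
  MeasurableSpace.comap State.loc ⊤ ⊔ MeasurableSpace.comap State.val inferInstance

/-! ### Timed transition systems: runs, symbolic paths, thickness, topology

`TimedGraph` is a timed automaton whose guards and invariants are given semantically, as sets of
valuations.  Both timed automata and their timed region automata are instances. -/

structure TimedGraph (L X E : Type*) where
  src : E → L
  tgt : E → L
  guard : E → Set (X → ℝ≥0)
  reset : E → Set X
  inv : L → Set (X → ℝ≥0)

namespace TimedGraph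

variable {L X E : Type*} (G : TimedGraph L X E)

/-- The state reached from `s` by waiting `τ` and then taking the edge `e`. -/
noncomputable def post (s : State L X) (τ : ℝ≥0) (e : E) : State L X :=
  ⟨G.tgt e, resetClocks (G.reset e) (elapse s.val τ)⟩

/-- `I(s,e)`: the delays `τ` such that `s --τ,e--> s'` is a transition for some `s'`
(necessarily `s' = post s τ e`). -/
def I (s : State L X) (e : E) : Set ℝ≥0 :=
  {τ | G.src e = s.loc ∧ (∀ τ' ≤ τ, elapse s.val τ' ∈ G.inv s.loc) ∧
    elapse s.val τ ∈ G.guard e ∧ (G.post s τ e).val ∈ G.inv (G.tgt e)}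

/-- `I(s) = ⋃ₑ I(s,e)`. -/
def IAll (s : State L X) : Set ℝ≥0 := ⋃ e, G.I s e

/-- The state reached from `s` after the first `n` steps of a sequence of delays and edges. -/
noncomputable def stateAt (s : State L X) (τ : ℕ → ℝ≥0) (e : ℕ → E) : ℕ → State L X
  | 0 => s
  | n + 1 => G.post (stateAt s τ e n) (τ n) (e n)

/-- The infinite runs from `s`.  The states along a run are determined by its delays and edges;
`delay n` and `edge n` belong to the transition leading from the `n`-th state to the next. -/
@[ext]
structure Run (s : State L X) where
  delay : ℕ → ℝ≥0
  edge : ℕ → E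
  isRun : ∀ n, delay n ∈ G.I (G.stateAt s delay edge n) (edge n)

variable {G} in
/-- The `n`-th state of a run. -/
noncomputable def Run.state {s : State L X} (ρ : G.Run s) (n : ℕ) : State L X :=
  G.stateAt s ρ.delay ρ.edge n

/-- `Pol(π(s, e₁ … eₙ))`: the tuples of delays for which the sequence of edges can be taken. -/
def Pol : (n : ℕ) → State L X → (Fin n → E) → Set (Fin n → ℝ≥0)
  | 0, _, _ => Set.univ
  | n + 1, s, e => {τ | τ 0 ∈ G.I s (e 0) ∧ Fin.tail τ ∈ Pol n (G.post s (τ 0) (e 0)) (Fin.tail e)}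

/-- `Pol(π_C(s, e₁ … eₙ))` for a constraint `C` on the delays. -/
def PolC {n : ℕ} (s : State L X) (e : Fin n → E) (C : Set (Fin n → ℝ≥0)) : Set (Fin n → ℝ≥0) :=
  G.Pol n s e ∩ C

/-- The cylinder generated by the constrained symbolic path `π_C(s, e₁ … eₙ)`. -/
def Cyl {n : ℕ} (s : State L X) (e : Fin n → E) (C : Set (Fin n → ℝ≥0)) : Set (G.Run s) :=
  {ρ | (∀ i : Fin n, ρ.edge i = e i) ∧ (fun i : Fin n => ρ.delay i) ∈ C}

/-- The constraint `C_i` induced by the projection of `Pol(π_C)` on the first `i` coordinates;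
`C_0` is true by convention. -/
def projC {n : ℕ} (s : State L X) (e : Fin n → E) (C : Set (Fin n → ℝ≥0)) (i : ℕ) (hi : i ≤ n) :
    Set (Fin i → ℝ≥0) :=
  {σ | i = 0 ∨ ∃ τ ∈ G.PolC s e C, σ = fun j => τ (Fin.castLE hi j)}

/-- The constrained path `π_C(s, e₁ … eₙ)` is thin: for some `1 ≤ i + 1 ≤ n`,
`dim Pol(π_{C_{i+1}}(s, e₁ … e_i e_{i+1})) < dim ⋃ₑ Pol(π_{C_i}(s, e₁ … e_i e))`. -/
def Thin {n : ℕ} (s : State L X) (e : Fin n → E) (C : Set (Fin n → ℝ≥0)) : Prop :=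
  ∃ (i : ℕ) (hi : i + 1 ≤ n),
    dimH (G.PolC s (fun j : Fin (i + 1) => e (Fin.castLE hi j)) (G.projC s e C (i + 1) hi)) <
    dimH (⋃ e' : E, G.PolC s
      (Fin.snoc (fun j : Fin i => e (Fin.castLE (Nat.le_of_succ_le hi) j)) e' : Fin (i + 1) → E)
      {τ | Fin.init τ ∈ G.projC s e C i (Nat.le_of_succ_le hi)})

def Thick {n : ℕ} (s : State L X) (e : Fin n → E) (C : Set (Fin n → ℝ≥0)) : Prop :=
  ¬ G.Thin s e C

/-- The infinite symbolic path `π(s, e₁ e₂ …)` is thick: all its finite prefixes are. -/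
def ThickInf (s : State L X) (e : ℕ → E) : Prop :=
  ∀ n : ℕ, 1 ≤ n → G.Thick s (fun j : Fin n => e j) Set.univ

/-- The sigma-algebra on the runs from `s`: it is generated by the cylinders of constrained
symbolic paths with Borel constraints. -/
instance (s : State L X) : MeasurableSpace (G.Run s) :=
  MeasurableSpace.generateFrom
    {S | ∃ (n : ℕ) (e : Fin n → E) (C : Set (Fin n → ℝ≥0)), MeasurableSet C ∧ S = G.Cyl s e C}

/-- The topology on the runs from `s`: its basic open sets are the whole space, the empty set, and
the cylinders of thick constrained symbolic paths with a Borel constraint `C` such that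
`Pol(π_C)` is open in `Pol(π)`. -/
instance (s : State L X) : TopologicalSpace (G.Run s) :=
  TopologicalSpace.generateFrom
    {S | S = Set.univ ∨ S = ∅ ∨
      ∃ (n : ℕ) (e : Fin n → E) (C : Set (Fin n → ℝ≥0)),
        G.Thick s e C ∧ MeasurableSet C ∧
        (∃ U : Set (Fin n → ℝ≥0), IsOpen U ∧ G.PolC s e C = U ∩ G.Pol n s e) ∧
        S = G.Cyl s e C}

variable {G} in
/-- A set of runs is large if its complement is meagre. -/
def Large {s : State L X} (S : Set (G.Run s)) : Prop := IsMeagre Sᶜ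

end TimedGraph

/-! ### Timed automata and their timed region automata -/

structure TimedAutomaton (L X E : Type*) where
  src : E → L
  tgt : E → L
  guard : E → Guard X
  reset : E → Set X
  inv : L → Guard X

namespace TimedAutomaton

variable {L X E : Type*} (A : TimedAutomaton L X E)

def toGraph : TimedGraph L X E where
  src := A.src
  tgt := A.tgt
  guard e := (A.guard e).sat
  reset := A.reset
  inv l := (A.inv l).sat

/-- A pair `(ℓ, v)` is a state of `A` if `v` satisfies the invariant of `ℓ`. -/
def IsState (s : State L X) : Prop := s.val ∈ (A.inv s.loc).sat

def NonBlocking : Prop := ∀ s, A.IsState s → (A.toGraph.IAll s).Nonempty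

/-- The maximal constant of the guards and invariants of `A` (`0` if there is none). -/
noncomputable def maxConst : ℕ :=
  sSup {c | (∃ e, ∃ a ∈ A.guard e, a.const = c) ∨ ∃ l, ∃ a ∈ A.inv l, a.const = c}

end TimedAutomaton

/-- Region equivalence of clock valuations with respect to the maximal constant `M`. -/
def RegionEquiv {X : Type*} (M : ℕ) (v v' : X → ℝ≥0) : Prop :=
  (∀ x, ((M : ℝ≥0) < v x ∧ (M : ℝ≥0) < v' x) ∨
    (⌊v x⌋₊ = ⌊v' x⌋₊ ∧ (Int.fract (v x : ℝ) = 0 ↔ Int.fract (v' x : ℝ) = 0))) ∧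
  ∀ x y, v x ≤ M → v y ≤ M →
    (Int.fract (v x : ℝ) ≤ Int.fract (v y : ℝ) ↔ Int.fract (v' x : ℝ) ≤ Int.fract (v' y : ℝ))

theorem le_of_floor_fract {M : ℕ} {a b : ℝ≥0} (h : ⌊a⌋₊ = ⌊b⌋₊)
    (hf : Int.fract (a : ℝ) = 0 ↔ Int.fract (b : ℝ) = 0) (hb : b ≤ M) : a ≤ M := by
  rcases hb.lt_or_eq with hlt | rfl
  · have h1 : ⌊b⌋₊ < M := (Nat.floor_lt zero_le).2 hlt
    exact ((Nat.floor_lt zero_le).1 (h ▸ h1)).le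
  · have h0 : Int.fract (a : ℝ) = 0 := hf.2 (by simp)
    obtain ⟨z, hz⟩ := Int.fract_eq_zero_iff.1 h0
    lift z to ℕ using by exact_mod_cast (hz.symm ▸ a.2 : (0 : ℝ) ≤ z)
    have ha : a = (z : ℝ≥0) := by ext; simpa using hz.symm
    subst ha
    simp only [Nat.floor_natCast] at h
    rw [h]

theorem RegionEquiv.le_iff {X : Type*} {M : ℕ} {v v' : X → ℝ≥0} (h : RegionEquiv M v v') (x : X) :
    v x ≤ M ↔ v' x ≤ M := by
  rcases h.1 x with h | ⟨h, hf⟩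
  · exact ⟨fun h' => absurd h' h.1.not_ge, fun h' => absurd h' h.2.not_ge⟩
  · exact ⟨le_of_floor_fract h.symm hf.symm, le_of_floor_fract h hf⟩

theorem regionEquiv_equivalence {X : Type*} (M : ℕ) :
    Equivalence (RegionEquiv (X := X) M) where
  refl v := ⟨fun x => Or.inr ⟨rfl, Iff.rfl⟩, fun _ _ _ _ => Iff.rfl⟩
  symm {v v'} h := by
    refine ⟨fun x => (h.1 x).imp And.symm fun h' => ⟨h'.1.symm, h'.2.symm⟩, fun x y hx hy => ?_⟩
    exact (h.2 x y ((h.le_iff x).2 hx) ((h.le_iff y).2 hy)).symm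
  trans {u v w} h h' := by
    refine ⟨fun x => ?_, fun x y hx hy => ?_⟩
    · by_cases hx : u x ≤ M
      · have hv := (h.le_iff x).1 hx
        rcases h.1 x with h1 | h1
        · exact absurd hx h1.1.not_ge
        · rcases h'.1 x with h2 | h2
          · exact absurd hv h2.1.not_ge
          · exact Or.inr ⟨h1.1.trans h2.1, h1.2.trans h2.2⟩
      · have hv := fun h3 => hx ((h.le_iff x).2 h3)
        have hw := fun h3 => hv ((h'.le_iff x).2 h3)
        exact Or.inl ⟨not_le.1 hx, not_le.1 hw⟩
    · exact (h.2 x y hx hy).trans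
        (h'.2 x y ((h.le_iff x).1 hx) ((h.le_iff y).1 hy))

namespace TimedAutomaton

variable {L X E : Type*} (A : TimedAutomaton L X E)

def regionSetoid : Setoid (X → ℝ≥0) := ⟨RegionEquiv A.maxConst, regionEquiv_equivalence _⟩

/-- The regions of `A`. -/
def Region : Type _ := Quotient A.regionSetoid

/-- The region `[v]` of a valuation. -/
def regionOf (v : X → ℝ≥0) : A.Region := Quotient.mk A.regionSetoid v

/-- The edges `(ℓ, r) --guard(r''), e, Y--> (ℓ', r')` of the timed region automaton. -/
@[ext]
structure RegionEdge where
  src : L × A.Region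
  via : A.Region
  edge : E
  tgt : L × A.Region
  realizable : ∃ (v : X → ℝ≥0) (τ : ℝ≥0), A.regionOf v = src.2 ∧
    τ ∈ A.toGraph.I ⟨src.1, v⟩ edge ∧ A.regionOf (elapse v τ) = via ∧
    (A.toGraph.post ⟨src.1, v⟩ τ edge).loc = tgt.1 ∧
    A.regionOf (A.toGraph.post ⟨src.1, v⟩ τ edge).val = tgt.2

/-- The timed region automaton `R(A)`. -/
def regionAutomaton : TimedGraph (L × A.Region) X A.RegionEdge where
  src f := f.src
  tgt f := f.tgt
  guard f := {v | A.regionOf v = f.via}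
  reset f := A.reset f.edge
  inv q := (A.inv q.1).sat

/-- `ι(s) = ((ℓ, [v]), v)` for `s = (ℓ, v)`. -/
def iota (s : State L X) : State (L × A.Region) X := ⟨(s.loc, A.regionOf s.val), s.val⟩

variable {A} in
/-- An edge `e` of `R(A)` with source `q` is thin if `dim I(s,e) < dim I(s)` for some `s ∈ q`. -/
def RegionEdge.Thin (f : A.RegionEdge) : Prop :=
  ∃ v : X → ℝ≥0, A.regionOf v = f.src.2 ∧
    dimH (A.regionAutomaton.I ⟨f.src, v⟩ f) < dimH (A.regionAutomaton.IAll ⟨f.src, v⟩)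

variable {A} in
/-- The region path with edges `f 0, f 1, …` is fair: each thick edge that is enabled in infinitely
many of the visited states `q_i = source (f i)` is taken infinitely often. -/
def FairPath (f : ℕ → A.RegionEdge) : Prop :=
  ∀ g : A.RegionEdge, ¬ g.Thin →
    (∃ᶠ i in atTop, g.src = (f i).src) → ∃ᶠ i in atTop, f i = g

variable {A} in
/-- The sequence of edges of `R(A)` of the image `ι(ρ)` of a run `ρ` of `A`. -/
noncomputable def regionPath {s : State L X} (ρ : A.toGraph.Run s) (n : ℕ) : A.RegionEdge where
  src := (A.iota (ρ.state n)).loc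
  via := A.regionOf (elapse (ρ.state n).val (ρ.delay n))
  edge := ρ.edge n
  tgt := (A.iota (ρ.state (n + 1))).loc
  realizable := ⟨(ρ.state n).val, ρ.delay n, rfl, ρ.isRun n, rfl, rfl, rfl⟩

variable {A} in
/-- A run of `A` is fair if its image in `R(A)` is. -/
def FairRun {s : State L X} (ρ : A.toGraph.Run s) : Prop := FairPath (regionPath ρ)

/-- Condition `S(A, s, P)` for a property `P` of the sequence of visited locations: every infinite
thick and fair symbolic path from `ι(s)` in `R(A)` satisfies `P`, i.e. all its runs do. -/
def CondS (s : State L X) (P : Set (ℕ → L)) : Prop :=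
  ∀ f : ℕ → A.RegionEdge, A.regionAutomaton.ThickInf (A.iota s) f → FairPath f →
    ∀ ρ : A.regionAutomaton.Run (A.iota s), ρ.edge = f → (fun n => (ρ.state n).loc.1) ∈ P

end TimedAutomaton

/-! ### Stochastic timed automata -/

/-- Lebesgue measure on the nonnegative reals. -/
noncomputable def lebesgueNN : Measure ℝ≥0 := (volume : Measure ℝ).comap ((↑) : ℝ≥0 → ℝ)

/-- A timed automaton with a probability measure `μ s` on delays for every `s` (depending
measurably on `s`) and positive weights on the edges. -/
structure StochasticTA (L X E : Type*) extends TimedAutomaton L X E where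
  μ : Kernel (State L X) ℝ≥0
  markov : IsMarkovKernel μ
  weight : E → ℝ≥0
  weight_pos : ∀ e, 0 < weight e

/-- What happens after the delay: an edge is taken, or no edge is enabled. -/
inductive Outcome (E : Type*)
  | fire (e : E)
  | stuck

instance {E : Type*} : MeasurableSpace (Outcome E) := ⊤

namespace StochasticTA

variable {L X E : Type*} (A : StochasticTA L X E)

/-- The requirements `(⋆)` on the delay distributions: `μ_s(I(s)) = 1`; `μ_s` is equivalent to
Lebesgue measure on `I(s)` if `I(s)` has positive measure, and otherwise to the uniform
distribution over the points of `I(s)`, i.e. to the counting measure on `I(s)`. -/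
def Star : Prop :=
  ∀ s, A.IsState s →
    A.μ s (A.toGraph.IAll s) = 1 ∧
    (0 < lebesgueNN (A.toGraph.IAll s) →
      A.μ s ≪ lebesgueNN.restrict (A.toGraph.IAll s) ∧
      lebesgueNN.restrict (A.toGraph.IAll s) ≪ A.μ s) ∧
    (lebesgueNN (A.toGraph.IAll s) = 0 →
      A.μ s ≪ Measure.count.restrict (A.toGraph.IAll s) ∧
      Measure.count.restrict (A.toGraph.IAll s) ≪ A.μ s)

/-- The edge `e` is enabled in `s`, without delay. -/
def Enabled (s : State L X) (e : E) : Prop := 0 ∈ A.toGraph.I s e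

open Classical in
/-- The weight of `e` if `e` is enabled in `s`, and `0` otherwise. -/
noncomputable def enabledWeight (s : State L X) (e : E) : ℝ≥0∞ :=
  if A.Enabled s e then (A.weight e : ℝ≥0∞) else 0

/-- The sum of the weights of the edges enabled in `s`. -/
noncomputable def totalWeight (s : State L X) : ℝ≥0∞ := ∑' e, A.enabledWeight s e

/-- `p_s(e)`. -/
noncomputable def edgeProb (s : State L X) (e : E) : ℝ≥0∞ := A.enabledWeight s e / A.totalWeight s

open Classical in
/-- The distribution `p_s` over edges; it sits at `stuck` if no edge is enabled in `s`. -/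
noncomputable def edgeMeasure (s : State L X) : Measure (Outcome E) :=
  if A.totalWeight s = 0 then Measure.dirac .stuck
  else Measure.sum fun e => A.edgeProb s e • Measure.dirac (.fire e)

end StochasticTA

/-! ### The probability measure on runs -/

section Measurability

variable {L X E : Type*}

theorem measurable_loc (t : Set L) : MeasurableSet {s : State L X | s.loc ∈ t} :=
  le_sup_left (a := MeasurableSpace.comap State.loc ⊤) _ ⟨t, trivial, rfl⟩

theorem measurable_val : Measurable (State.val : State L X → X → ℝ≥0) :=
  (comap_measurable State.val).mono le_sup_right le_rfl

theorem measurable_state {α : Type*} [MeasurableSpace α] {f : α → State L X}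
    (h : ∀ t : Set L, MeasurableSet {a | (f a).loc ∈ t}) (h' : Measurable fun a => (f a).val) :
    Measurable f := by
  refine Measurable.of_le_map (sup_le ?_ ?_)
  · rintro _ ⟨t, -, rfl⟩
    exact h t
  · rintro _ ⟨t, ht, rfl⟩
    exact h' ht

theorem measurable_elapse {α : Type*} [MeasurableSpace α] {f : α → X → ℝ≥0} {g : α → ℝ≥0}
    (hf : Measurable f) (hg : Measurable g) : Measurable fun a => elapse (f a) (g a) :=
  measurable_pi_lambda _ fun x => ((measurable_pi_apply x).comp hf).add hg

theorem measurable_resetClocks (Y : Set X) : Measurable (resetClocks Y) := by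
  refine measurable_pi_lambda _ fun x => ?_
  by_cases h : x ∈ Y
  · simp [resetClocks, h]
  · simpa [resetClocks, h] using measurable_pi_apply x

theorem Guard.measurableSet_sat (g : Guard X) : MeasurableSet g.sat := by
  have : g.sat = ⋂ a ∈ {a | a ∈ g}, {v | a.cmp.Holds (v a.clock) (a.const : ℝ≥0)} := by
    ext v; simp [Guard.sat]
  rw [this]
  refine MeasurableSet.biInter (List.finite_toSet g).countable fun a _ => ?_
  have hm := measurable_pi_apply (X := fun _ : X => ℝ≥0) a.clock
  cases h : a.cmp <;> simp only [Cmp.Holds]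
  · exact measurableSet_lt hm measurable_const
  · exact measurableSet_le hm measurable_const
  · exact measurableSet_eq_fun hm measurable_const
  · exact measurableSet_le measurable_const hm
  · exact measurableSet_lt measurable_const hm

end Measurability

namespace StochasticTA

variable {L X E : Type*} (A : StochasticTA L X E)

theorem measurable_post (e : E) :
    Measurable fun p : State L X × ℝ≥0 => A.toGraph.post p.1 p.2 e := by
  refine measurable_state (fun t => ?_) ?_
  · exact MeasurableSet.const (A.tgt e ∈ t)
  · exact (measurable_resetClocks _).comp
      (measurable_elapse (measurable_val.comp measurable_fst) measurable_snd)

theorem measurableSet_enabled (e : E) : MeasurableSet {s | A.Enabled s e} := by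
  have : {s | A.Enabled s e} = {s | s.loc ∈ ({A.src e} : Set L)} ∩
      (State.val ⁻¹' (A.inv (A.src e)).sat ∩ (State.val ⁻¹' (A.guard e).sat ∩
      (fun s => (A.toGraph.post s 0 e).val) ⁻¹' (A.inv (A.tgt e)).sat)) := by
    ext s
    have h0 : elapse s.val 0 = s.val := by funext x; simp [elapse]
    constructor
    · rintro ⟨h1, h2, h3, h4⟩
      refine ⟨h1.symm, ?_, ?_, h4⟩
      · have := h2 0 le_rfl
        rw [h0, ← h1] at this
        exact this
      · rwa [h0] at h3
    · rintro ⟨h1, h2, h3, h4⟩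
      refine ⟨h1.symm, fun τ hτ => ?_, ?_, h4⟩
      · rw [nonpos_iff_eq_zero.1 hτ, h0, show s.loc = A.src e from h1]
        exact h2
      · rw [h0]
        exact h3
  rw [this]
  have hp : Measurable fun s : State L X => (A.toGraph.post s 0 e).val :=
    measurable_val.comp ((A.measurable_post e).comp (measurable_id.prodMk measurable_const))
  exact (measurable_loc _).inter ((measurable_val (Guard.measurableSet_sat _)).inter
    ((measurable_val (Guard.measurableSet_sat _)).inter (hp (Guard.measurableSet_sat _))))

theorem measurable_enabledWeight (e : E) : Measurable fun s => A.enabledWeight s e :=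
  Measurable.ite (A.measurableSet_enabled e) measurable_const measurable_const

/-- A finite history, continued arbitrarily. -/
def extend (n : ℕ) (x : (i : Finset.Iic n) → ℝ≥0 × Outcome E) (i : ℕ) : ℝ≥0 × Outcome E :=
  if h : i ∈ Finset.Iic n then x ⟨i, h⟩ else (0, .stuck)

theorem measurable_extend (n : ℕ) : Measurable (extend (E := E) n) := by
  refine measurable_pi_lambda _ fun i => ?_
  by_cases h : i ∈ Finset.Iic n
  · simpa only [extend, h, dite_true] using measurable_pi_apply _
  · simp only [extend, h, dite_false]
    exact measurable_const

/-- The state after one step (the state does not change at `stuck`). -/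
noncomputable def next (s : State L X) : ℝ≥0 × Outcome E → State L X
  | (τ, .fire e) => A.toGraph.post s τ e
  | (_, .stuck) => s

/-- The state reached from `s` after the first `n` steps. -/
noncomputable def stateAfter (s : State L X) (x : ℕ → ℝ≥0 × Outcome E) : ℕ → State L X
  | 0 => s
  | n + 1 => A.next (stateAfter s x n) (x n)

/-- The sequence of steps of a run. -/
def runSteps {s : State L X} (ρ : A.toGraph.Run s) (n : ℕ) : ℝ≥0 × Outcome E :=
  (ρ.delay n, .fire (ρ.edge n))

theorem mem_sat_of_le {X : Type*} (g : Guard X) {v : X → ℝ≥0} {τ τ' : ℝ≥0} (h : τ' ≤ τ)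
    (h0 : v ∈ g.sat) (h1 : elapse v τ ∈ g.sat) : elapse v τ' ∈ g.sat := by
  intro a ha
  have h2 := h0 a ha
  have h3 := h1 a ha
  have h4 : v a.clock ≤ v a.clock + τ' := le_self_add
  have h5 : v a.clock + τ' ≤ v a.clock + τ := by gcongr
  cases hc : a.cmp <;> simp only [hc, Cmp.Holds, elapse] at h2 h3 ⊢
  · exact h5.trans_lt h3
  · exact h5.trans h3
  · exact le_antisymm (h5.trans h3.le) (h2.symm.le.trans h4)
  · exact h2.trans h4
  · exact h2.trans_le h4

theorem measurableSet_I (e : E) :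
    MeasurableSet {p : State L X × ℝ≥0 | p.2 ∈ A.toGraph.I p.1 e} := by
  have : {p : State L X × ℝ≥0 | p.2 ∈ A.toGraph.I p.1 e} =
      {p | p.1.loc ∈ ({A.src e} : Set L)} ∩
      ((fun p => p.1.val) ⁻¹' (A.inv (A.src e)).sat ∩
      ((fun p => elapse p.1.val p.2) ⁻¹' ((A.inv (A.src e)).sat ∩ (A.guard e).sat) ∩
      (fun p => (A.toGraph.post p.1 p.2 e).val) ⁻¹' (A.inv (A.tgt e)).sat)) := by
    ext ⟨s, τ⟩
    have h0 : elapse s.val 0 = s.val := by funext x; simp [elapse]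
    constructor
    · rintro ⟨h1, h2, h3, h4⟩
      change A.src e = s.loc at h1
      refine ⟨h1.symm, ?_, ⟨?_, h3⟩, h4⟩
      · have := h2 0 zero_le
        rw [h0, ← h1] at this
        exact this
      · have := h2 τ le_rfl
        rw [← h1] at this
        exact this
    · rintro ⟨h1, h2, ⟨h3, h5⟩, h4⟩
      change s.loc = A.src e at h1
      refine ⟨h1.symm, fun τ' hτ => ?_, h5, h4⟩
      rw [h1]
      exact mem_sat_of_le _ hτ h2 h3
  rw [this]
  have hv : Measurable fun p : State L X × ℝ≥0 => p.1.val := measurable_val.comp measurable_fst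
  exact (measurable_fst (measurable_loc _)).inter ((hv (Guard.measurableSet_sat _)).inter
    (((measurable_elapse hv measurable_snd)
      ((Guard.measurableSet_sat _).inter (Guard.measurableSet_sat _))).inter
    ((measurable_val.comp (A.measurable_post e)) (Guard.measurableSet_sat _))))

theorem runSteps_injective (s : State L X) : Function.Injective (A.runSteps (s := s)) := by
  intro ρ ρ' h
  ext n
  · exact congrArg Subtype.val (congrArg Prod.fst (congrFun h n))
  · exact Outcome.fire.inj (congrArg Prod.snd (congrFun h n))

theorem stateAfter_runSteps {s : State L X} (x : ℕ → ℝ≥0 × Outcome E) (e : ℕ → E)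
    (h : ∀ n, (x n).2 = .fire (e n)) (n : ℕ) :
    A.stateAfter s x n = A.toGraph.stateAt s (fun n => (x n).1) e n := by
  induction n with
  | zero => rfl
  | succ n ih =>
    have : x n = ((x n).1, .fire (e n)) := Prod.ext rfl (h n)
    rw [stateAfter, TimedGraph.stateAt, ih, this]
    rfl

variable [Finite E]

theorem measurable_totalWeight : Measurable A.totalWeight :=
  Measurable.tsum fun e => A.measurable_enabledWeight e

theorem measurable_edgeMeasure : Measurable A.edgeMeasure := by
  refine Measurable.ite (A.measurable_totalWeight (measurableSet_singleton 0))
    measurable_const ?_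
  refine Measure.measurable_of_measurable_coe _ fun t ht => ?_
  simp only [Measure.sum_apply _ ht, Measure.smul_apply, smul_eq_mul]
  exact Measurable.tsum fun e =>
    ((A.measurable_enabledWeight e).div A.measurable_totalWeight).mul measurable_const

theorem totalWeight_ne_top (s : State L X) : A.totalWeight s ≠ ∞ := by
  have := Fintype.ofFinite E
  rw [totalWeight, tsum_fintype]
  refine ENNReal.sum_ne_top.2 fun e _ => ?_
  unfold enabledWeight
  split_ifs <;> simp

instance (s : State L X) : IsProbabilityMeasure (A.edgeMeasure s) := by
  unfold edgeMeasure
  split_ifs with h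
  · infer_instance
  · refine ⟨?_⟩
    simp only [Measure.sum_apply _ MeasurableSet.univ, Measure.smul_apply, measure_univ,
      smul_eq_mul, mul_one, edgeProb, div_eq_mul_inv]
    rw [ENNReal.tsum_mul_right]
    exact ENNReal.mul_inv_cancel h (A.totalWeight_ne_top s)

/-- The distribution `p_s` over edges, as a Markov kernel. -/
noncomputable def edgeKernel : Kernel (State L X) (Outcome E) :=
  ⟨A.edgeMeasure, A.measurable_edgeMeasure⟩

instance : IsMarkovKernel A.edgeKernel :=
  ⟨fun s => inferInstanceAs (IsProbabilityMeasure (A.edgeMeasure s))⟩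

theorem measurable_wait :
    Measurable fun p : State L X × ℝ≥0 => (⟨p.1.loc, elapse p.1.val p.2⟩ : State L X) :=
  measurable_state (fun t => measurable_fst (measurable_loc t))
    (measurable_elapse (measurable_val.comp measurable_fst) measurable_snd)

/-- One step from `s`: choose a delay `t` according to `μ_s`, then an edge according to
`p_{s+t}`. -/
noncomputable def stepKernel : Kernel (State L X) (ℝ≥0 × Outcome E) :=
  A.μ ⊗ₖ A.edgeKernel.comap _ measurable_wait

instance : IsMarkovKernel A.stepKernel := by
  have := A.markov
  unfold stepKernel
  infer_instance

theorem countable_outcome : Countable (Outcome E) := by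
  have h : Function.Surjective fun o : Option E =>
      (match o with | some e => Outcome.fire e | none => Outcome.stuck : Outcome E) := by
    rintro (e | _)
    · exact ⟨some e, rfl⟩
    · exact ⟨none, rfl⟩
  exact h.countable

theorem measurable_next :
    Measurable fun p : State L X × (ℝ≥0 × Outcome E) => A.next p.1 p.2 := by
  have := countable_outcome (E := E)
  have h : Measurable fun p : (State L X × ℝ≥0) × Outcome E => A.next p.1.1 (p.1.2, p.2) := by
    refine measurable_from_prod_countable_left fun o => ?_
    cases o with
    | fire e => exact A.measurable_post e
    | stuck => exact measurable_fst
  exact h.comp (((measurable_fst).prodMk (measurable_fst.comp measurable_snd)).prodMk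
    (measurable_snd.comp measurable_snd))

theorem measurable_stateAfter (s : State L X) (n : ℕ) :
    Measurable fun x : ℕ → ℝ≥0 × Outcome E => A.stateAfter s x n := by
  induction n with
  | zero => exact measurable_const
  | succ n ih => exact A.measurable_next.comp (ih.prodMk (measurable_pi_apply n))

/-- The distribution of the next step, given the steps `0, …, n` taken from `s`. -/
noncomputable def historyKernel (s : State L X) (n : ℕ) :
    Kernel ((i : Finset.Iic n) → ℝ≥0 × Outcome E) (ℝ≥0 × Outcome E) :=
  A.stepKernel.comap (fun x => A.stateAfter s (extend n x) (n + 1))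
    ((A.measurable_stateAfter s (n + 1)).comp (measurable_extend n))

instance (s : State L X) (n : ℕ) : IsMarkovKernel (A.historyKernel s n) := by
  unfold historyKernel
  infer_instance

/-- The distribution of the sequence of steps from `s`. -/
noncomputable def stepsMeasure (s : State L X) : Measure (ℕ → ℝ≥0 × Outcome E) :=
  Kernel.trajMeasure (X := fun _ => ℝ≥0 × Outcome E) (A.stepKernel s) (A.historyKernel s)

theorem range_runSteps (s : State L X) : Set.range (A.runSteps (s := s)) =
    ⋂ n, ⋃ e, {x | (x n).2 = .fire e ∧ (x n).1 ∈ A.toGraph.I (A.stateAfter s x n) e} := by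
  ext x
  simp only [Set.mem_range, Set.mem_iInter, Set.mem_iUnion, Set.mem_ofPred_eq]
  constructor
  · rintro ⟨ρ, rfl⟩ n
    refine ⟨ρ.edge n, rfl, ?_⟩
    rw [A.stateAfter_runSteps _ ρ.edge fun _ => rfl]
    exact ρ.isRun n
  · intro h
    choose e he hI using h
    refine ⟨⟨fun n => (x n).1, e, fun n => ?_⟩, funext fun n => Prod.ext rfl (he n).symm⟩
    rw [← A.stateAfter_runSteps x e he]
    exact hI n

theorem measurableSet_range_runSteps (s : State L X) :
    MeasurableSet (Set.range (A.runSteps (s := s))) := by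
  rw [range_runSteps]
  refine MeasurableSet.iInter fun n => MeasurableSet.iUnion fun e => ?_
  have hx := measurable_pi_apply (X := fun _ : ℕ => ℝ≥0 × Outcome E) n
  have h1 : MeasurableSet {x : ℕ → ℝ≥0 × Outcome E | (x n).2 = .fire e} :=
    (measurable_snd.comp hx) (show MeasurableSet {o : Outcome E | o = .fire e} from trivial)
  exact h1.inter (((A.measurable_stateAfter s n).prodMk (measurable_fst.comp hx))
    (A.measurableSet_I e))

theorem measurableSet_image_runSteps (s : State L X) {S : Set (A.toGraph.Run s)}
    (hS : MeasurableSet S) : MeasurableSet (A.runSteps '' S) := by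
  induction S, hS using MeasurableSpace.generateFrom_induction with
  | hC S hS _ =>
    obtain ⟨n, e, C, hC, rfl⟩ := hS
    have : A.runSteps '' A.toGraph.Cyl s e C = Set.range (A.runSteps (s := s)) ∩
        ((⋂ i : Fin n, {x | (x i).2 = .fire (e i)}) ∩
          (fun (x : ℕ → ℝ≥0 × Outcome E) (i : Fin n) => (x i).1) ⁻¹' C) := by
      ext x
      constructor
      · rintro ⟨ρ, ⟨h1, h2⟩, rfl⟩
        exact ⟨⟨ρ, rfl⟩, Set.mem_iInter.2 fun i => congrArg Outcome.fire (h1 i), h2⟩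
      · rintro ⟨⟨ρ, rfl⟩, h1, h2⟩
        exact ⟨ρ, ⟨fun i => Outcome.fire.inj (Set.mem_iInter.1 h1 i), h2⟩, rfl⟩
    rw [this]
    refine (A.measurableSet_range_runSteps s).inter ((MeasurableSet.iInter fun i => ?_).inter ?_)
    · exact (measurable_snd.comp (measurable_pi_apply (i : ℕ)))
        (show MeasurableSet {o : Outcome E | o = .fire (e i)} from trivial)
    · exact (measurable_pi_lambda _ fun i : Fin n =>
        measurable_fst.comp (measurable_pi_apply (i : ℕ))) hC
  | empty => simp
  | compl S _ ih =>
    rw [Set.image_compl_eq_range_sdiff_image (A.runSteps_injective s)]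
    exact (A.measurableSet_range_runSteps s).diff ih
  | iUnion S _ ih =>
    rw [Set.image_iUnion]
    exact MeasurableSet.iUnion ih

/-- The probability measure on the runs from `s`. -/
noncomputable def prob (s : State L X) : Measure (A.toGraph.Run s) :=
  (A.stepsMeasure s).comap A.runSteps

theorem prob_apply (s : State L X) {S : Set (A.toGraph.Run s)} (hS : MeasurableSet S) :
    A.prob s S = A.stepsMeasure s (A.runSteps '' S) :=
  Measure.comap_apply _ (A.runSteps_injective s)
    (fun _ h => A.measurableSet_image_runSteps s h) _ hS

/-- Almost-sure satisfaction, from `s`, of a property given by the set of runs satisfying it: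
the set is measurable and has probability one. -/
def AlmostSurely {s : State L X} (S : Set (A.toGraph.Run s)) : Prop :=
  MeasurableSet S ∧ A.prob s S = 1

end StochasticTA

/-! ### Specification timed automata -/

/-- Büchi and Muller acceptance conditions on sequences of locations. -/
inductive Acceptance (L : Type*)
  | buchi (F : Set L)
  | muller (F : Set (Set L))

/-- Büchi: some location of `F` is visited infinitely often.
Muller: the set of locations visited infinitely often belongs to `F`. -/
def Acceptance.Accepts {L : Type*} : Acceptance L → (ℕ → L) → Prop
  | .buchi F, l => ∃ᶠ i in atTop, l i ∈ F
  | .muller F, l => {a | ∃ᶠ i in atTop, l i = a} ∈ F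

/-- A (deterministic, complete) specification Büchi or Muller timed automaton over `AP`. -/
structure SpecTA (AP L X E : Type*) where
  init : Set AP → L
  src : E → L
  guard : E → Guard X
  label : E → Set AP
  reset : E → Set X
  tgt : E → L
  acc : Acceptance L
  deterministic : ∀ e e', src e = src e' → label e = label e' → e ≠ e' →
    (guard e).sat ∩ (guard e').sat = ∅
  complete : ∀ (l : L) (u : Set AP) (v : X → ℝ≥0) (τ : ℝ≥0),
    ∃ e, src e = l ∧ label e = u ∧ elapse v τ ∈ (guard e).sat

/-- An infinite timed word `u₀ τ₁ u₁ τ₂ u₂ …`; `delay n` stands between `letter n` and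
`letter (n + 1)`. -/
structure TimedWord (AP : Type*) where
  letter : ℕ → Set AP
  delay : ℕ → ℝ≥0

namespace SpecTA

variable {AP L X E : Type*} (B : SpecTA AP L X E)

/-- `κ` is the sequence of states of the run of `B` on the timed word `w`. -/
def IsRunOn (w : TimedWord AP) (κ : ℕ → State L X) : Prop :=
  κ 0 = ⟨B.init (w.letter 0), fun _ => 0⟩ ∧
  ∀ n, ∃ e, B.src e = (κ n).loc ∧ B.label e = w.letter (n + 1) ∧
    elapse (κ n).val (w.delay n) ∈ (B.guard e).sat ∧
    κ (n + 1) = ⟨B.tgt e, resetClocks (B.reset e) (elapse (κ n).val (w.delay n))⟩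

/-- The timed property `P_B`: the unique run of `B` on the word is accepting. -/
def language : Set (TimedWord AP) :=
  {w | ∃ κ, B.IsRunOn w κ ∧ B.acc.Accepts fun n => (κ n).loc}

end SpecTA

/-- The timed word read along a run of a timed automaton with labelling function `lab`. -/
noncomputable def runWord {AP L X E : Type*} {G : TimedGraph L X E} (lab : L → Set AP)
    {s : State L X} (ρ : G.Run s) : TimedWord AP :=
  ⟨fun n => lab (ρ.state n).loc, ρ.delay⟩

/-- The set of runs from `s` that satisfy the timed property `P`. -/
def runsSat {AP L X E : Type*} (G : TimedGraph L X E) (lab : L → Set AP) (s : State L X)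
    (P : Set (TimedWord AP)) : Set (G.Run s) := {ρ | runWord lab ρ ∈ P}

/-! ### The product -/

section Product

variable {AP L X E L' X' E' : Type*}

/-- The edges `e_{e'}` of the product: the edge `e'` of the specification reads the label of the
location that is entered by `e`; it may start at any location of the specification. -/
abbrev ProdEdge (A : TimedAutomaton L X E) (lab : L → Set AP) (B : SpecTA AP L' X' E') :=
  {p : E × E' // B.label p.2 = lab (A.tgt p.1)}

/-- The timed automaton `A ⋉ B`. -/
def TimedAutomaton.product (A : TimedAutomaton L X E) (lab : L → Set AP)
    (B : SpecTA AP L' X' E') : TimedAutomaton (L × L') (X ⊕ X') (ProdEdge A lab B) where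
  src p := (A.src p.1.1, B.src p.1.2)
  tgt p := (A.tgt p.1.1, B.tgt p.1.2)
  guard p := (A.guard p.1.1).rename Sum.inl ++ (B.guard p.1.2).rename Sum.inr
  reset p := Sum.inl '' A.reset p.1.1 ∪ Sum.inr '' B.reset p.1.2
  inv l := (A.inv l.1).rename Sum.inl

/-- The projection of the states of `A ⋉ B` to those of `A`. -/
def State.left (s : State (L × L') (X ⊕ X')) : State L X := ⟨s.loc.1, fun x => s.val (Sum.inl x)⟩

theorem measurable_left : Measurable (State.left : State (L × L') (X ⊕ X') → State L X) :=
  measurable_state (fun t => measurable_loc (Prod.fst ⁻¹' t))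
    (measurable_pi_lambda _ fun x => (measurable_pi_apply (Sum.inl x)).comp measurable_val)

/-- The stochastic timed automaton `A ⋉ B`: delays and weights are those of `A`. -/
noncomputable def StochasticTA.product (A : StochasticTA L X E) (lab : L → Set AP)
    (B : SpecTA AP L' X' E') :
    StochasticTA (L × L') (X ⊕ X') (ProdEdge A.toTimedAutomaton lab B) where
  toTimedAutomaton := A.toTimedAutomaton.product lab B
  μ := A.μ.comap State.left measurable_left
  markov := have := A.markov; inferInstance
  weight p := A.weight p.1.1
  weight_pos p := A.weight_pos p.1.1

/-- The initial state of `A ⋉ B` for the state `s` of `A`. -/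
def SpecTA.prodInit (lab : L → Set AP) (B : SpecTA AP L' X' E') (s : State L X) :
    State (L × L') (X ⊕ X') :=
  ⟨(s.loc, B.init (lab s.loc)), Sum.elim s.val fun _ => 0⟩

/-- The lifting of the acceptance condition of `B` to `A ⋉ B`, as a property of sequences of
locations. -/
def SpecTA.prodProperty (L : Type*) (B : SpecTA AP L' X' E') : Set (ℕ → L × L') :=
  {l | B.acc.Accepts fun n => (l n).2}

end Product

end STA

/-! Everything is read off one finite graph, the region automaton R of the product `A ⋉ B`. Since B
is deterministic and complete, a run of A extends in exactly one way to a run of the product; since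
the regions partition the valuations, a run of the product follows exactly one path of R. So every
run of A has a path in R (`regionRun`), and it satisfies B if and only if this path is accepting
(`mem_runsSat_iff`). The structure `Lifts` isolates this unique extension; it is closed under
composition, so that A can be compared with R directly.

The equivalences then come from a zero-one law, `null_not_accepts_iff`, stated for an abstract ideal
of null sets of runs. It asks that (a) outside a null set the paths are fair and have no thin edge,
and (b) the runs that start along a given prefix of a path without thin edges never form a null set.
A fair path without thin edges visits infinitely often exactly the vertices of a bottom strongly
connected component of the graph of thick edges. Hence, if one such path visits a vertex infinitely
often and another one meets that vertex, both visit the same vertices infinitely often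
(`frequently_src_iff`) and are accepted or rejected together. Suppose now that some fair path
without thin edges is rejected. The runs that follow it up to a vertex that it visits infinitely
often are not null by (b), and by (a) they are all rejected up to a null set. The law is applied
twice: to the meagre sets, and to the sets whose preimage among the runs of the product has
probability zero.

Meagre sets. The delays along a path of R form a locally closed cell. A punctual edge forces its
delay, any other edge leaves an interval of them, so each nonempty relatively open part of a cell
has as dimension the number of non-punctual edges (`dimH_of_relOpen`). Thickness of a constrained
path of A inside one cell therefore says that no edge of the path in R is thin
(`thick_iff_forall_not_thin`). The sets of delays of A are convex, which makes thickness pass to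
smaller relatively open constraints (`thick_of_subset`); together with the finite cover by cells,
this puts into each nonempty open set a thick cylinder inside one cell (`exists_goodCyl`). Such
cylinders can be prolonged along every thick edge, which yields (a); a Baire argument with compact
sets of delays yields (b) (`ThickCyl.not_isMeagre`).

Probability. By `Star`, an edge of R is taken from its source with probability zero if and only if
it is thin (`stepKernel_steps_eq_zero_iff`). This gives (b) and the absence of thin edges in (a);
fairness is the hypothesis. Probabilities in A are computed in the product, because the one-step
distributions correspond and determine the law of the whole sequence (`prob_product`). -/

namespace STA

/-! ### Finite runs and their prolongations -/

namespace TimedGraph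

variable {L X E : Type*} (G : TimedGraph L X E)

/-- The state reached from `s` after a finite sequence of delays and edges. -/
noncomputable def endState : (n : ℕ) → State L X → (Fin n → ℝ≥0) → (Fin n → E) → State L X
  | 0, s, _, _ => s
  | n + 1, s, τ, e =>
    G.post (endState n s (Fin.init τ) (Fin.init e)) (τ (Fin.last n)) (e (Fin.last n))

theorem endState_succ (n : ℕ) (s : State L X) (τ : Fin (n + 1) → ℝ≥0) (e : Fin (n + 1) → E) :
    G.endState (n + 1) s τ e =
      G.post (G.endState n s (Fin.init τ) (Fin.init e)) (τ (Fin.last n)) (e (Fin.last n)) := rfl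

theorem endState_succ_tail (n : ℕ) (s : State L X) (τ : Fin (n + 1) → ℝ≥0) (e : Fin (n + 1) → E) :
    G.endState (n + 1) s τ e =
      G.endState n (G.post s (τ 0) (e 0)) (Fin.tail τ) (Fin.tail e) := by
  induction n with
  | zero => rfl
  | succ n ih =>
    rw [endState_succ, ih, endState_succ]
    rfl

/-- `Pol` recurses on the first step, whereas the inductions below prolong paths at their end; this
is the recursion they need. -/
theorem mem_Pol_succ {n : ℕ} {s : State L X} {τ : Fin (n + 1) → ℝ≥0} {e : Fin (n + 1) → E} :
    τ ∈ G.Pol (n + 1) s e ↔ Fin.init τ ∈ G.Pol n s (Fin.init e) ∧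
      τ (Fin.last n) ∈ G.I (G.endState n s (Fin.init τ) (Fin.init e)) (e (Fin.last n)) := by
  induction n generalizing s with
  | zero => exact and_comm
  | succ n ih =>
    change _ ∧ Fin.tail τ ∈ G.Pol (n + 1) _ _ ↔ (_ ∧ Fin.tail (Fin.init τ) ∈ G.Pol n _ _) ∧ _
    rw [ih, endState_succ_tail]
    exact and_assoc.symm

theorem endState_restrict (s : State L X) (τ : ℕ → ℝ≥0) (e : ℕ → E) (n : ℕ) :
    G.endState n s (fun i => τ i) (fun i => e i) = G.stateAt s τ e n := by
  induction n with
  | zero => rfl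
  | succ n ih =>
    rw [endState_succ, stateAt, ← ih]
    rfl

theorem restrict_mem_Pol {s : State L X} {τ : ℕ → ℝ≥0} {e : ℕ → E} {n : ℕ} :
    (fun i : Fin n => τ i) ∈ G.Pol n s (fun i => e i) ↔
      ∀ i < n, τ i ∈ G.I (G.stateAt s τ e i) (e i) := by
  induction n with
  | zero => simp [Pol]
  | succ n ih =>
    rw [mem_Pol_succ, Nat.forall_lt_succ_right, ← ih, ← endState_restrict]
    exact Iff.rfl

theorem Run.mem_Pol {G : TimedGraph L X E} {s : State L X} (ρ : G.Run s) (n : ℕ) :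
    (fun i : Fin n => ρ.delay i) ∈ G.Pol n s (fun i => ρ.edge i) :=
  G.restrict_mem_Pol.2 fun i _ => ρ.isRun i

theorem Run.endState_eq {G : TimedGraph L X E} {s : State L X} (ρ : G.Run s) (n : ℕ) :
    G.endState n s (fun i => ρ.delay i) (fun i => ρ.edge i) = ρ.state n :=
  G.endState_restrict s _ _ n

theorem take_mem_Pol {n : ℕ} {s : State L X} {τ : Fin n → ℝ≥0} {e : Fin n → E}
    (h : τ ∈ G.Pol n s e) (i : ℕ) (hi : i ≤ n) :
    Fin.take i hi τ ∈ G.Pol i s (Fin.take i hi e) := by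
  induction n with
  | zero => obtain rfl := Nat.le_zero.1 hi; exact h
  | succ n ih =>
    rcases Nat.lt_or_eq_of_le hi with hlt | rfl
    · exact ih (G.mem_Pol_succ.1 h).1 (Nat.le_of_lt_succ hlt)
    · simpa using h

/-- The location after a step is the target of the edge, whatever the delay. In a region automaton
the location carries the region, so this controls the region reached as well. -/
theorem endState_loc (n : ℕ) (s s' : State L X) (h : s.loc = s'.loc) (τ τ' : Fin n → ℝ≥0)
    (e : Fin n → E) : (G.endState n s τ e).loc = (G.endState n s' τ' e).loc := by
  cases n with
  | zero => exact h
  | succ n => rfl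

/-- States that satisfy the invariant of their location. -/
def Valid (s : State L X) : Prop := s.val ∈ G.inv s.loc

theorem Valid.post {G : TimedGraph L X E} {s : State L X} {τ : ℝ≥0} {e : E} (h : τ ∈ G.I s e) :
    G.Valid (G.post s τ e) := h.2.2.2

/-- A finite run can be prolonged to an infinite one if valid states are never blocked. -/
theorem exists_run (hb : ∀ s, G.Valid s → (G.IAll s).Nonempty) {s : State L X} (hs : G.Valid s)
    {n : ℕ} {τ : Fin n → ℝ≥0} {e : Fin n → E} (h : τ ∈ G.Pol n s e) :
    ∃ ρ : G.Run s, (∀ i : Fin n, ρ.delay i = τ i) ∧ ∀ i : Fin n, ρ.edge i = e i := by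
  have hne : ∀ s : {s // G.Valid s}, ∃ p : ℝ≥0 × E, p.1 ∈ G.I s p.2 := fun s => by
    obtain ⟨t, ht⟩ := hb s s.2
    obtain ⟨e, he⟩ := Set.mem_iUnion.1 ht
    exact ⟨(t, e), he⟩
  choose c hc using hne
  obtain ⟨d0, e0⟩ := c ⟨s, hs⟩
  induction n generalizing s with
  | zero =>
    let st : ℕ → {s // G.Valid s} := fun k =>
      (fun s : {s // G.Valid s} => (⟨G.post s (c s).1 (c s).2, Valid.post (hc s)⟩ :
        {s // G.Valid s}))^[k] ⟨s, hs⟩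
    have hst : ∀ k, (st k : State L X) =
        G.stateAt s (fun k => (c (st k)).1) (fun k => (c (st k)).2) k := fun k => by
      induction k with
      | zero => rfl
      | succ k ih =>
        simp only [st] at ih ⊢
        rw [stateAt, ← ih, Function.iterate_succ_apply']
    exact ⟨⟨fun k => (c (st k)).1, fun k => (c (st k)).2, fun k => hst k ▸ hc (st k)⟩,
      fun i => i.elim0, fun i => i.elim0⟩
  | succ n ih =>
    obtain ⟨ρ, h1, h2⟩ := ih (Valid.post h.1) h.2
    have hst : ∀ k, G.stateAt (G.post s (τ 0) (e 0)) ρ.delay ρ.edge k =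
        G.stateAt s (fun k => Nat.casesOn k (τ 0) fun k => ρ.delay k)
          (fun k => Nat.casesOn k (e 0) fun k => ρ.edge k) (k + 1) := fun k => by
      induction k with
      | zero => rfl
      | succ k ih => rw [stateAt, ih]; rfl
    refine ⟨⟨fun k => Nat.casesOn k (τ 0) fun k => ρ.delay k,
      fun k => Nat.casesOn k (e 0) fun k => ρ.edge k,
      fun k => ?_⟩, fun i => ?_, fun i => ?_⟩
    · cases k with
      | zero => exact h.1
      | succ k => exact hst k ▸ ρ.isRun k
    · refine Fin.cases rfl (fun i => ?_) i
      exact h1 i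
    · refine Fin.cases rfl (fun i => ?_) i
      exact h2 i

end TimedGraph

/-! ### Deterministic liftings between timed graphs -/

section Lifts

variable {L X E L' X' E' L'' X'' E'' : Type*}

/-- The runs of `G` lift in a unique way to runs of `G'` along the maps `p` of states and `h` of
edges, as long as these start in `K`. -/
structure Lifts (G : TimedGraph L X E) (G' : TimedGraph L' X' E')
    (p : State L' X' → State L X) (h : E' → E) (K : Set (State L' X')) : Prop where
  step : ∀ s ∈ K, ∀ f, ∀ t ∈ G'.I s f, t ∈ G.I (p s) (h f) ∧ G'.post s t f ∈ K
  post : ∀ s t f, p (G'.post s t f) = G.post (p s) t (h f)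
  exists_lift : ∀ s ∈ K, ∀ e, ∀ t ∈ G.I (p s) e, ∃ f, h f = e ∧ t ∈ G'.I s f
  unique : ∀ s ∈ K, ∀ f f', ∀ t, t ∈ G'.I s f → t ∈ G'.I s f' → h f = h f' → f = f'

namespace Lifts

variable {G : TimedGraph L X E} {G' : TimedGraph L' X' E'} {p : State L' X' → State L X}
  {h : E' → E} {K : Set (State L' X')}

theorem comp {G'' : TimedGraph L'' X'' E''} {p' : State L'' X'' → State L' X'} {h' : E'' → E'}
    {K' : Set (State L'' X'')} (H : Lifts G G' p h K) (H' : Lifts G' G'' p' h' K')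
    (hK : ∀ s ∈ K', p' s ∈ K) : Lifts G G'' (p ∘ p') (h ∘ h') K' where
  step s hs f t ht := ⟨(H.step _ (hK s hs) _ _ (H'.step s hs f t ht).1).1,
    (H'.step s hs f t ht).2⟩
  post s t f := by simp only [Function.comp, H'.post, H.post]
  exists_lift s hs e t ht := by
    obtain ⟨f, rfl, hf⟩ := H.exists_lift _ (hK s hs) e t ht
    obtain ⟨f', rfl, hf'⟩ := H'.exists_lift s hs f t hf
    exact ⟨f', rfl, hf'⟩
  unique s hs f f' t ht ht' hff := H'.unique s hs f f' t ht ht'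
    (H.unique _ (hK s hs) _ _ t (H'.step s hs f t ht).1 (H'.step s hs f' t ht').1 hff)

theorem map_endState (H : Lifts G G' p h K) (s : State L' X') (n : ℕ) (τ : Fin n → ℝ≥0)
    (f : Fin n → E') : p (G'.endState n s τ f) = G.endState n (p s) τ (h ∘ f) := by
  induction n with
  | zero => rfl
  | succ n ih =>
    rw [TimedGraph.endState_succ, TimedGraph.endState_succ, H.post, ih]
    rfl

theorem map_stateAt (H : Lifts G G' p h K) (s : State L' X') (n : ℕ) (τ : ℕ → ℝ≥0)
    (f : ℕ → E') : p (G'.stateAt s τ f n) = G.stateAt (p s) τ (h ∘ f) n := by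
  induction n with
  | zero => rfl
  | succ n ih => rw [TimedGraph.stateAt, TimedGraph.stateAt, H.post, ih]; rfl

theorem mem_of_Pol (H : Lifts G G' p h K) {s : State L' X'} (hs : s ∈ K) {n : ℕ}
    {τ : Fin n → ℝ≥0} {f : Fin n → E'} (hτ : τ ∈ G'.Pol n s f) :
    τ ∈ G.Pol n (p s) (h ∘ f) ∧ G'.endState n s τ f ∈ K := by
  induction n with
  | zero => exact ⟨trivial, hs⟩
  | succ n ih =>
    obtain ⟨h1, h2⟩ := G'.mem_Pol_succ.1 hτ
    obtain ⟨h3, h4⟩ := ih h1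
    obtain ⟨h5, h6⟩ := H.step _ h4 _ _ h2
    refine ⟨G.mem_Pol_succ.2 ⟨h3, ?_⟩, h6⟩
    rw [H.map_endState] at h5
    exact h5

theorem Pol_subset (H : Lifts G G' p h K) {s : State L' X'} (hs : s ∈ K) {n : ℕ}
    (f : Fin n → E') : G'.Pol n s f ⊆ G.Pol n (p s) (h ∘ f) := fun _ hτ => (H.mem_of_Pol hs hτ).1

theorem exists_Pol (H : Lifts G G' p h K) {s : State L' X'} (hs : s ∈ K) {n : ℕ}
    {τ : Fin n → ℝ≥0} {e : Fin n → E} (hτ : τ ∈ G.Pol n (p s) e) :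
    ∃ f, h ∘ f = e ∧ τ ∈ G'.Pol n s f := by
  induction n with
  | zero => exact ⟨fun i => i.elim0, funext fun i => i.elim0, trivial⟩
  | succ n ih =>
    obtain ⟨h1, h2⟩ := G.mem_Pol_succ.1 hτ
    obtain ⟨f, hf, h3⟩ := ih h1
    rw [← hf, ← H.map_endState] at h2
    obtain ⟨g, hg, h4⟩ := H.exists_lift _ (H.mem_of_Pol hs h3).2 _ _ h2
    refine ⟨Fin.snoc f g, ?_, G'.mem_Pol_succ.2 ⟨by simpa using h3, by simpa using h4⟩⟩
    funext i
    refine Fin.lastCases (by simpa using hg) (fun i => ?_) i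
    simpa [Fin.init] using congrFun hf i

theorem Pol_unique (H : Lifts G G' p h K) {s : State L' X'} (hs : s ∈ K) {n : ℕ}
    {τ : Fin n → ℝ≥0} {f f' : Fin n → E'} (hτ : τ ∈ G'.Pol n s f) (hτ' : τ ∈ G'.Pol n s f')
    (hff : h ∘ f = h ∘ f') : f = f' := by
  induction n with
  | zero => exact funext fun i => i.elim0
  | succ n ih =>
    obtain ⟨h1, h2⟩ := G'.mem_Pol_succ.1 hτ
    obtain ⟨h3, h4⟩ := G'.mem_Pol_succ.1 hτ'
    have h5 : Fin.init f = Fin.init f' :=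
      ih h1 h3 (funext fun i => congrFun hff i.castSucc)
    rw [h5] at h1 h2
    have h6 := H.unique _ (H.mem_of_Pol hs h1).2 _ _ _ h2 h4 (congrFun hff (Fin.last n))
    rw [← Fin.snoc_init_self f, ← Fin.snoc_init_self f', h5, h6]

/-- The lifts of the finite prefixes are unique, hence compatible, and glue to an infinite run. -/
theorem exists_lift_edges (H : Lifts G G' p h K) {s : State L' X'} (hs : s ∈ K)
    {s₀ : State L X} (hp : p s = s₀) (ρ : G.Run s₀) :
    ∃ ρ' : G'.Run s, ρ'.delay = ρ.delay ∧ ∀ n, h (ρ'.edge n) = ρ.edge n := by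
  subst hp
  have hne : ∀ n, ∃ f : Fin n → E', (h ∘ f = fun i : Fin n => ρ.edge i) ∧
      (fun i : Fin n => ρ.delay i) ∈ G'.Pol n s f := fun n => H.exists_Pol hs (ρ.mem_Pol n)
  choose f hf hP using hne
  have hinit : ∀ n, Fin.init (f (n + 1)) = f n := fun n =>
    H.Pol_unique hs (G'.mem_Pol_succ.1 (hP (n + 1))).1 (hP n)
      ((funext fun i => congrFun (hf (n + 1)) i.castSucc :
        h ∘ Fin.init (f (n + 1)) = fun i : Fin n => ρ.edge i).trans (hf n).symm)
  have hres : ∀ n, f n = fun i : Fin n => f (i + 1) (Fin.last i) := fun n => by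
    induction n with
    | zero => exact funext fun i => i.elim0
    | succ n ih =>
      funext i
      refine Fin.lastCases rfl (fun i => ?_) i
      exact (congrFun (hinit n) i).trans (congrFun ih i)
  refine ⟨⟨ρ.delay, fun n => f (n + 1) (Fin.last n), fun n => ?_⟩, rfl,
    fun n => congrFun (hf (n + 1)) (Fin.last n)⟩
  have := hP (n + 1)
  rw [hres (n + 1)] at this
  exact (G'.restrict_mem_Pol (e := fun n => f (n + 1) (Fin.last n))).1 this n n.lt_succ_self

/-- The lift of a run. -/
noncomputable def run (H : Lifts G G' p h K) {s : State L' X'} (hs : s ∈ K)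
    {s₀ : State L X} (hp : p s = s₀) (ρ : G.Run s₀) : G'.Run s :=
  (H.exists_lift_edges hs hp ρ).choose

section run

variable (H : Lifts G G' p h K) {s : State L' X'} (hs : s ∈ K) {s₀ : State L X} (hp : p s = s₀)

theorem run_delay (ρ : G.Run s₀) : (H.run hs hp ρ).delay = ρ.delay :=
  (H.exists_lift_edges hs hp ρ).choose_spec.1

theorem run_edge (ρ : G.Run s₀) (n : ℕ) : h ((H.run hs hp ρ).edge n) = ρ.edge n :=
  (H.exists_lift_edges hs hp ρ).choose_spec.2 n

theorem eq_of_delay_edge (H : Lifts G G' p h K) {s : State L' X'} (hs : s ∈ K)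
    {ρ ρ' : G'.Run s} (hd : ρ.delay = ρ'.delay)
    (he : ∀ n, h (ρ.edge n) = h (ρ'.edge n)) : ρ = ρ' := by
  have : ρ.edge = ρ'.edge := funext fun n =>
    congrFun (H.Pol_unique hs (ρ.mem_Pol (n + 1)) (hd ▸ ρ'.mem_Pol (n + 1))
      (funext fun i => he i)) (Fin.last n)
  exact TimedGraph.Run.ext hd this

/-- The projection of a run. -/
def proj (ρ : G'.Run s) : G.Run s₀ where
  delay := ρ.delay
  edge n := h (ρ.edge n)
  isRun n := by
    have h1 := (H.mem_of_Pol hs (ρ.mem_Pol (n + 1))).1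
    rw [hp] at h1
    exact (G.restrict_mem_Pol (e := h ∘ ρ.edge)).1 h1 n n.lt_succ_self

theorem proj_run (ρ : G.Run s₀) : H.proj hs hp (H.run hs hp ρ) = ρ :=
  TimedGraph.Run.ext (H.run_delay hs hp ρ) (funext fun n => H.run_edge hs hp ρ n)

theorem proj_state (ρ : G'.Run s) (n : ℕ) : (H.proj hs hp ρ).state n = p (ρ.state n) := by
  subst hp
  exact (H.map_stateAt s n ρ.delay ρ.edge).symm

theorem run_state_mem (H : Lifts G G' p h K) {s : State L' X'} (hs : s ∈ K)
    (ρ : G'.Run s) (n : ℕ) : ρ.state n ∈ K := by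
  rw [← ρ.endState_eq]
  exact (H.mem_of_Pol hs (ρ.mem_Pol n)).2

/-- The runs whose lift starts with given edges form a cylinder. -/
theorem run_edge_eq_iff {n : ℕ} (f : Fin n → E') (ρ : G.Run s₀) :
    (∀ i : Fin n, (H.run hs hp ρ).edge i = f i) ↔ ρ ∈ G.Cyl s₀ (h ∘ f) (G'.Pol n s f) := by
  have hP := (H.run hs hp ρ).mem_Pol n
  rw [H.run_delay] at hP
  constructor
  · intro h1
    refine ⟨fun i => by rw [← H.run_edge hs hp, h1 i]; rfl, ?_⟩
    rwa [show (fun i : Fin n => (H.run hs hp ρ).edge i) = f from funext h1] at hP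
  · rintro ⟨h1, h2⟩ i
    refine congrFun (H.Pol_unique hs hP h2 (funext fun i => ?_)) i
    rw [← h1 i, ← H.run_edge hs hp]
    rfl

/-- The first `n + 1` edges of the lift determine a cylinder downstairs, and there are only finitely
many choices of them. -/
theorem measurable_run_edge [Finite E'] (hm : ∀ n f, MeasurableSet (G'.Pol n s f)) (n : ℕ)
    (T : Set E') : MeasurableSet {ρ : G.Run s₀ | (H.run hs hp ρ).edge n ∈ T} := by
  have : {ρ : G.Run s₀ | (H.run hs hp ρ).edge n ∈ T} =
      ⋃ f : {f : Fin (n + 1) → E' // f (Fin.last n) ∈ T},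
        G.Cyl s₀ (h ∘ f) (G'.Pol (n + 1) s f.1) := by
    ext ρ
    simp only [Set.mem_iUnion, ← H.run_edge_eq_iff hs hp, Set.mem_ofPred_eq]
    constructor
    · exact fun hT => ⟨⟨fun i => (H.run hs hp ρ).edge i, hT⟩, fun _ => rfl⟩
    · rintro ⟨⟨f, hf⟩, hρ⟩
      have := hρ (Fin.last n)
      simp only [Fin.val_last] at this
      rwa [this]
  rw [this]
  exact MeasurableSet.iUnion fun f =>
    MeasurableSpace.measurableSet_generateFrom ⟨_, _, _, hm _ _, rfl⟩

end run

end Lifts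

end Lifts

/-! ### Regions in terms of diagonal constraints -/

section Regions

variable {X : Type*} {M : ℕ} {v v' w w' : X → ℝ≥0}

/-- The same comparisons of the clocks with the constants up to `M`. -/
def SameComp (M : ℕ) (v v' : X → ℝ≥0) : Prop :=
  ∀ x, ∀ c : ℕ, c ≤ M →
    ((v x ≤ c ↔ v' x ≤ c) ∧ ((c : ℝ≥0) ≤ v x ↔ (c : ℝ≥0) ≤ v' x))

/-- The same comparisons of the differences of bounded clocks with integers. -/
def SameDiff (M : ℕ) (v v' : X → ℝ≥0) : Prop :=
  ∀ x y, v x ≤ M → v y ≤ M → ∀ k : ℤ, ((v x : ℝ) - v y ≤ k ↔ (v' x : ℝ) - v' y ≤ k)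

theorem coe_eq_floor_add_fract (a : ℝ≥0) : (a : ℝ) = ⌊a⌋₊ + Int.fract (a : ℝ) := by
  have h := natCast_floor_eq_intCast_floor (R := ℝ) (a := (a : ℝ)) a.2
  rw [show ⌊(a : ℝ)⌋₊ = ⌊a⌋₊ from rfl] at h
  rw [h]
  exact (Int.floor_add_fract _).symm

theorem fract_eq_zero_iff_le_floor (a : ℝ≥0) : Int.fract (a : ℝ) = 0 ↔ a ≤ (⌊a⌋₊ : ℝ≥0) := by
  have h := coe_eq_floor_add_fract a
  have h0 := Int.fract_nonneg (a : ℝ)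
  rw [← NNReal.coe_le_coe, NNReal.coe_natCast]
  constructor <;> intro h1 <;> linarith

theorem le_natCast_iff (a : ℝ≥0) (c : ℕ) :
    a ≤ c ↔ ⌊a⌋₊ < c ∨ (⌊a⌋₊ = c ∧ Int.fract (a : ℝ) = 0) := by
  constructor
  · intro h
    have h1 : ⌊a⌋₊ ≤ c := Nat.floor_le_of_le h
    rcases h1.lt_or_eq with h2 | h2
    · exact Or.inl h2
    · refine Or.inr ⟨h2, (fract_eq_zero_iff_le_floor a).2 ?_⟩
      rwa [h2]
  · rintro (h | ⟨rfl, h⟩)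
    · exact ((Nat.floor_lt zero_le).1 h).le
    · exact (fract_eq_zero_iff_le_floor a).1 h

theorem sub_le_intCast_iff {f g : ℝ} (hf : 0 ≤ f) (hf1 : f < 1) (hg : 0 ≤ g) (hg1 : g < 1)
    (j : ℤ) : f - g ≤ j ↔ 1 ≤ j ∨ (j = 0 ∧ f ≤ g) := by
  constructor
  · intro h
    have h1 : (-1 : ℝ) < j := by linarith
    have h2 : -1 < j := by exact_mod_cast h1
    rcases (show 1 ≤ j ∨ j = 0 by omega) with h3 | h3
    · exact Or.inl h3
    · subst h3
      exact Or.inr ⟨rfl, by simpa using h⟩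
  · rintro (h | ⟨rfl, h⟩)
    · have : (1 : ℝ) ≤ j := by exact_mod_cast h
      linarith
    · simpa using h

theorem sub_le_intCast_iff_floor (a b : ℝ≥0) (k : ℤ) : (a : ℝ) - b ≤ k ↔
    1 ≤ k - ⌊a⌋₊ + ⌊b⌋₊ ∨ (k - ⌊a⌋₊ + ⌊b⌋₊ = 0 ∧ Int.fract (a : ℝ) ≤ Int.fract (b : ℝ)) := by
  have ha := coe_eq_floor_add_fract a
  have hb := coe_eq_floor_add_fract b
  rw [← sub_le_intCast_iff (Int.fract_nonneg _) (Int.fract_lt_one _) (Int.fract_nonneg _)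
    (Int.fract_lt_one _)]
  push_cast
  constructor <;> intro h <;> linarith

/-- Splitting clocks into integral and fractional parts turns the order of the fractional parts into
bounds on differences. This form is convenient because differences of clocks do not change when time
elapses. -/
theorem regionEquiv_iff : RegionEquiv M v v' ↔ SameComp M v v' ∧ SameDiff M v v' := by
  constructor
  · intro h
    have hfl : ∀ x, v x ≤ M → ⌊v x⌋₊ = ⌊v' x⌋₊ := fun x hx => by
      rcases h.1 x with h1 | h1
      · exact absurd hx h1.1.not_ge
      · exact h1.1
    refine ⟨fun x c hc => ?_, fun x y hx hy k => ?_⟩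
    · rcases h.1 x with ⟨h1, h2⟩ | ⟨h1, h2⟩
      · have hc' : (c : ℝ≥0) ≤ M := by exact_mod_cast hc
        exact ⟨iff_of_false (hc'.trans_lt h1).not_ge (hc'.trans_lt h2).not_ge,
          iff_of_true (hc'.trans h1.le) (hc'.trans h2.le)⟩
      · rw [le_natCast_iff, le_natCast_iff, h1, h2, ← Nat.le_floor_iff zero_le,
          ← Nat.le_floor_iff zero_le, h1]
        exact ⟨Iff.rfl, Iff.rfl⟩
    · rw [sub_le_intCast_iff_floor, sub_le_intCast_iff_floor, hfl x hx, hfl y hy, h.2 x y hx hy]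
  · rintro ⟨hc, hd⟩
    have hle : ∀ x, v x ≤ M ↔ v' x ≤ M := fun x => (hc x M le_rfl).1
    have hfl : ∀ x, v x ≤ M → ⌊v x⌋₊ = ⌊v' x⌋₊ := fun x hx => by
      have h1 : ⌊v x⌋₊ ≤ M := Nat.floor_le_of_le hx
      have h2 : ⌊v' x⌋₊ ≤ M := Nat.floor_le_of_le ((hle x).1 hx)
      refine le_antisymm ?_ ?_
      · exact Nat.le_floor ((hc x _ h1).2.1 (Nat.floor_le zero_le))
      · exact Nat.le_floor ((hc x _ h2).2.2 (Nat.floor_le zero_le))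
    refine ⟨fun x => ?_, fun x y hx hy => ?_⟩
    · by_cases hx : v x ≤ M
      · refine Or.inr ⟨hfl x hx, ?_⟩
        rw [fract_eq_zero_iff_le_floor, fract_eq_zero_iff_le_floor, ← hfl x hx]
        exact (hc x _ (Nat.floor_le_of_le hx)).1
      · exact Or.inl ⟨not_le.1 hx, not_le.1 fun h => hx ((hle x).2 h)⟩
    · have h := hd x y hx hy ((⌊v x⌋₊ : ℤ) - ⌊v y⌋₊)
      rw [sub_le_intCast_iff_floor, sub_le_intCast_iff_floor, ← hfl x hx, ← hfl y hy] at h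
      simpa using h

theorem RegionEquiv.sameComp (h : RegionEquiv M v v') : SameComp M v v' := (regionEquiv_iff.1 h).1

theorem SameComp.eq_iff (h : SameComp M v v') (x : X) {c : ℕ} (hc : c ≤ M) :
    v x = c ↔ v' x = c := by
  rw [le_antisymm_iff, le_antisymm_iff, (h x c hc).1, (h x c hc).2]

theorem SameComp.sat_iff (h : SameComp M v v') {g : Guard X} (hg : ∀ a ∈ g, a.const ≤ M) :
    v ∈ g.sat ↔ v' ∈ g.sat := by
  refine forall₂_congr fun a ha => ?_
  have h1 := h a.clock a.const (hg a ha)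
  cases a.cmp <;> simp only [Cmp.Holds]
  · rw [← not_le, ← not_le, h1.2]
  · exact h1.1
  · exact h.eq_iff _ (hg a ha)
  · exact h1.2
  · rw [← not_le, ← not_le, h1.1]

theorem RegionEquiv.resetClocks (h : RegionEquiv M v v') (Y : Set X) :
    RegionEquiv M (resetClocks Y v) (resetClocks Y v') := by
  obtain ⟨hc, hd⟩ := regionEquiv_iff.1 h
  -- Resetting one of two clocks turns their difference into plus or minus the other clock, which
  -- must then be compared with arbitrary integers. Those outside `0, …, M` are decided by the
  -- bounds on the clock.
  have hint : ∀ x, v x ≤ M → ∀ k : ℤ, (((v x : ℝ) ≤ k ↔ (v' x : ℝ) ≤ k) ∧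
      ((k : ℝ) ≤ v x ↔ (k : ℝ) ≤ v' x)) := fun x hx k => by
    have hx' := (h.le_iff x).1 hx
    rcases lt_or_ge k 0 with hk | hk
    · have hk' : (k : ℝ) < 0 := by exact_mod_cast hk
      exact ⟨iff_of_false (hk'.trans_le (v x).2).not_ge (hk'.trans_le (v' x).2).not_ge,
        iff_of_true (hk'.le.trans (v x).2) (hk'.le.trans (v' x).2)⟩
    · lift k to ℕ using hk
      by_cases hkM : k ≤ M
      · have := hc x k hkM
        simpa only [← NNReal.coe_le_coe, NNReal.coe_natCast, Int.cast_natCast] using this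
      · have hkM' : (M : ℝ) < k := by exact_mod_cast not_le.1 hkM
        rw [← NNReal.coe_le_coe, NNReal.coe_natCast] at hx hx'
        rw [Int.cast_natCast]
        exact ⟨iff_of_true (by linarith) (by linarith), iff_of_false (by linarith) (by linarith)⟩
  refine regionEquiv_iff.2 ⟨fun x c hcM => ?_, fun x y hx hy k => ?_⟩
  · by_cases hx : x ∈ Y
    · simp [STA.resetClocks, hx]
    · simpa [STA.resetClocks, hx] using hc x c hcM
  · by_cases hxY : x ∈ Y <;> by_cases hyY : y ∈ Y <;>
      simp only [STA.resetClocks, hxY, hyY, if_true, if_false] at hx hy ⊢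
    · have := (hint y hy (-k)).2
      push_cast at this
      rw [NNReal.coe_zero, zero_sub, zero_sub, neg_le (a := (v y : ℝ)),
        neg_le (a := (v' y : ℝ))]
      exact this
    · simpa using (hint x hx k).1
    · exact hd x y hx hy k

/-- After a delay, only the comparisons with constants have to be checked. -/
theorem RegionEquiv.elapse (h : RegionEquiv M v v') {t t' : ℝ≥0}
    (hc : SameComp M (elapse v t) (elapse v' t')) : RegionEquiv M (elapse v t) (elapse v' t') := by
  refine regionEquiv_iff.2 ⟨hc, fun x y hx hy k => ?_⟩
  have h1 := (regionEquiv_iff.1 h).2 x y (le_self_add.trans hx) (le_self_add.trans hy) k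
  simpa [STA.elapse] using h1

/-- If `t` is some `a j`, its counterpart is `a' j`; otherwise it is any point separating the images
of the points below `t` from those of the points above. -/
theorem exists_same_position {ι : Type*} [Finite ι] {a a' : ι → ℝ}
    (h : ∀ i j, a i ≤ a j ↔ a' i ≤ a' j) (t : ℝ) :
    ∃ t', ∀ i, (a i ≤ t ↔ a' i ≤ t') ∧ (t ≤ a i ↔ t' ≤ a' i) := by
  by_cases ht : ∃ i, a i = t
  · obtain ⟨j, rfl⟩ := ht
    exact ⟨a' j, fun i => ⟨h i j, h j i⟩⟩
  · push Not at ht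
    have := Fintype.ofFinite ι
    classical
    obtain ⟨t', h1, h2⟩ := Order.exists_between_finsets
      ((Finset.univ.filter fun i => a i < t).image a')
      ((Finset.univ.filter fun i => t < a i).image a')
      (by
        simp only [Finset.mem_image, Finset.mem_filter, Finset.mem_univ, true_and]
        rintro _ ⟨i, hi, rfl⟩ _ ⟨j, hj, rfl⟩
        rw [← not_le, ← h, not_le]
        exact hi.trans hj)
    simp only [Finset.mem_image, Finset.mem_filter, Finset.mem_univ, true_and,
      forall_exists_index, and_imp, forall_apply_eq_imp_iff₂] at h1 h2
    refine ⟨t', fun i => ?_⟩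
    rcases lt_or_gt_of_ne (ht i) with hi | hi
    · have h3 := h1 i hi
      exact ⟨iff_of_true hi.le h3.le, iff_of_false hi.not_ge h3.not_ge⟩
    · have h3 := h2 i hi
      exact ⟨iff_of_false hi.not_ge h3.not_ge, iff_of_true hi.le h3.le⟩

/-- Region equivalence is a time-abstract bisimulation. -/
theorem RegionEquiv.exists_elapse [Finite X] (h : RegionEquiv M v v') (t : ℝ≥0) :
    ∃ t', RegionEquiv M (STA.elapse v t) (STA.elapse v' t') := by
  obtain ⟨hc, hd⟩ := regionEquiv_iff.1 h
  -- The critical times: `c - v x`, when the bounded clock `x` reaches `c`, and in addition time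
  -- `0`, so that the matching delay is nonnegative.
  let a : (X → ℝ≥0) → Option ({x // v x ≤ M} × Fin (M + 1)) → ℝ := fun v o =>
    o.elim 0 fun p => (p.2 : ℕ) - (v p.1 : ℝ)
  have hmono : ∀ i j, a v i ≤ a v j ↔ a v' i ≤ a v' j := by
    rintro (_ | ⟨x, c⟩) (_ | ⟨y, d⟩)
    · exact iff_of_true le_rfl le_rfl
    · have := (hc y d (Nat.lt_succ_iff.1 d.2)).1
      rw [← NNReal.coe_le_coe, ← NNReal.coe_le_coe] at this
      simpa [a] using this
    · have := (hc x c (Nat.lt_succ_iff.1 c.2)).2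
      rw [← NNReal.coe_le_coe, ← NNReal.coe_le_coe] at this
      simpa [a] using this
    · have := hd y x y.2 x.2 ((d : ℕ) - (c : ℕ))
      push_cast at this
      have e : ∀ v : X → ℝ≥0, a v (some (x, c)) ≤ a v (some (y, d)) ↔
          (v y : ℝ) - v x ≤ ((d : ℕ) : ℝ) - (c : ℕ) := fun v => by
        simp only [a, Option.elim]
        constructor <;> intro h <;> linarith
      rw [e, e]
      exact this
  obtain ⟨t', ht⟩ := exists_same_position hmono t
  have h0 : 0 ≤ t' := (ht none).1.1 t.2
  lift t' to ℝ≥0 using h0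
  refine ⟨t', h.elapse fun x c hcM => ?_⟩
  by_cases hx : v x ≤ M
  · have h1 := ht (some (⟨x, hx⟩, ⟨c, Nat.lt_succ_iff.2 hcM⟩))
    simp only [a, Option.elim] at h1
    simp only [STA.elapse, ← NNReal.coe_le_coe, NNReal.coe_add, NNReal.coe_natCast]
    rw [← le_sub_iff_add_le', ← le_sub_iff_add_le', ← sub_le_iff_le_add', ← sub_le_iff_le_add']
    exact ⟨h1.2, h1.1⟩
  · have hcM' : (c : ℝ≥0) ≤ M := by exact_mod_cast hcM
    have h1 : (c : ℝ≥0) < STA.elapse v t x :=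
      hcM'.trans_lt ((not_le.1 hx).trans_le le_self_add)
    have h2 : (c : ℝ≥0) < STA.elapse v' t' x :=
      hcM'.trans_lt ((not_le.1 fun h' => hx ((h.le_iff x).2 h')).trans_le le_self_add)
    exact ⟨iff_of_false h1.not_ge h2.not_ge, iff_of_true h1.le h2.le⟩

/-- Strict comparisons persist in a neighbourhood. -/
theorem eventually_comp_of_ne [Finite X] (M : ℕ) (w : X → ℝ≥0) :
    ∀ᶠ w' : X → ℝ≥0 in 𝓝 w, ∀ x, ∀ c : ℕ, c ≤ M → w x ≠ c →
      ((w x ≤ c ↔ w' x ≤ c) ∧ ((c : ℝ≥0) ≤ w x ↔ (c : ℝ≥0) ≤ w' x)) := by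
  refine eventually_all.2 fun x => ?_
  have : ∀ c ∈ Finset.range (M + 1), ∀ᶠ w' : X → ℝ≥0 in 𝓝 w, w x ≠ c →
      ((w x ≤ c ↔ w' x ≤ c) ∧ ((c : ℝ≥0) ≤ w x ↔ (c : ℝ≥0) ≤ w' x)) := fun c _ => by
    have hcont : Tendsto (fun w' : X → ℝ≥0 => w' x) (𝓝 w) (𝓝 (w x)) :=
      (continuous_apply x).tendsto w
    rcases lt_trichotomy (w x) c with h | h | h
    · filter_upwards [hcont.eventually_lt_const h] with w' hw' _
      exact ⟨iff_of_true h.le hw'.le, iff_of_false h.not_ge hw'.not_ge⟩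
    · exact Eventually.of_forall fun _ hne => absurd h hne
    · filter_upwards [hcont.eventually_const_lt h] with w' hw' _
      exact ⟨iff_of_false h.not_ge hw'.not_ge, iff_of_true h.le hw'.le⟩
  filter_upwards [(Finset.eventually_all _).2 this] with w' hw' c hc
  exact hw' c (Finset.mem_range.2 (Nat.lt_succ_iff.2 hc))

theorem IsLocallyClosed.iInter_of_finite {Y ι : Type*} [TopologicalSpace Y] [Finite ι]
    {S : ι → Set Y} (h : ∀ i, IsLocallyClosed (S i)) : IsLocallyClosed (⋂ i, S i) := by
  choose U Z hU hZ hUZ using h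
  refine ⟨⋂ i, U i, ⋂ i, Z i, isOpen_iInter_of_finite hU, isClosed_iInter hZ, ?_⟩
  rw [← Set.iInter_inter_distrib]
  exact Set.iInter_congr hUZ

theorem _root_.IsClosed.isLocallyClosed_iff {Y : Type*} [TopologicalSpace Y] {S : Set Y}
    (h : IsClosed S) (P : Prop) : IsLocallyClosed {y | P ↔ y ∈ S} := by
  by_cases hP : P
  · simpa [hP] using h.isLocallyClosed
  · have : {y | P ↔ y ∈ S} = Sᶜ := by ext y; simp [hP]
    rw [this]
    exact h.isOpen_compl.isLocallyClosed

theorem _root_.IsLocallyClosed.measurableSet {Y : Type*} [TopologicalSpace Y] [MeasurableSpace Y]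
    [OpensMeasurableSpace Y] {S : Set Y} (h : IsLocallyClosed S) : MeasurableSet S := by
  obtain ⟨U, Z, hU, hZ, rfl⟩ := h
  exact hU.measurableSet.inter hZ.measurableSet

/-- The finitely many constraints that define a region. -/
theorem regionEquiv_iff_finite : RegionEquiv M v v' ↔
    (∀ p : X × Fin (M + 1), ((v p.1 ≤ (p.2 : ℕ) ↔ v' p.1 ≤ (p.2 : ℕ)) ∧
      (((p.2 : ℕ) : ℝ≥0) ≤ v p.1 ↔ ((p.2 : ℕ) : ℝ≥0) ≤ v' p.1))) ∧
    ∀ p : (X × X) × Set.Icc (-M : ℤ) M, (v p.1.1 ≤ M ∧ v p.1.2 ≤ M →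
      ((v p.1.1 : ℝ) ≤ p.2 + v p.1.2 ↔ (v' p.1.1 : ℝ) ≤ p.2 + v' p.1.2)) := by
  rw [regionEquiv_iff]
  have hiff : SameComp M v v' ↔ ∀ p : X × Fin (M + 1), ((v p.1 ≤ (p.2 : ℕ) ↔ v' p.1 ≤ (p.2 : ℕ)) ∧
      (((p.2 : ℕ) : ℝ≥0) ≤ v p.1 ↔ ((p.2 : ℕ) : ℝ≥0) ≤ v' p.1)) :=
    ⟨fun h p => h p.1 p.2 (Nat.lt_succ_iff.1 p.2.2),
      fun h x c hc => h (x, ⟨c, Nat.lt_succ_iff.2 hc⟩)⟩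
  rw [← hiff]
  refine and_congr_right fun hc => ⟨fun h p hp => ?_, fun h x y hx hy k => ?_⟩
  · rw [← sub_le_iff_le_add, ← sub_le_iff_le_add]
    exact h _ _ hp.1 hp.2 _
  · have hx' := ((hc x M le_rfl).1).1 hx
    have hy' := ((hc y M le_rfl).1).1 hy
    rw [← NNReal.coe_le_coe, NNReal.coe_natCast] at hx' hy'
    have hxr : (v x : ℝ) ≤ M := by exact_mod_cast hx
    have hyr : (v y : ℝ) ≤ M := by exact_mod_cast hy
    have hx0 := (v x).2
    have hy0 := (v y).2
    have hx0' := (v' x).2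
    have hy0' := (v' y).2
    by_cases h1 : k < -M
    · have : (k : ℝ) < -M := by exact_mod_cast h1
      exact iff_of_false (by linarith) (by linarith)
    by_cases h2 : (M : ℤ) < k
    · have : (M : ℝ) < k := by exact_mod_cast h2
      exact iff_of_true (by linarith) (by linarith)
    · have := h ((x, y), ⟨k, not_lt.1 h1, not_lt.1 h2⟩) ⟨hx, hy⟩
      rwa [sub_le_iff_le_add, sub_le_iff_le_add]

theorem isLocallyClosed_region [Finite X] (M : ℕ) (v : X → ℝ≥0) :
    IsLocallyClosed {v' | RegionEquiv M v v'} := by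
  have : {v' | RegionEquiv M v v'} =
      (⋂ p : X × Fin (M + 1), ({v' | v p.1 ≤ (p.2 : ℕ) ↔ v' ∈ {v' : X → ℝ≥0 | v' p.1 ≤ (p.2 : ℕ)}} ∩
        {v' | ((p.2 : ℕ) : ℝ≥0) ≤ v p.1 ↔ v' ∈ {v' : X → ℝ≥0 | ((p.2 : ℕ) : ℝ≥0) ≤ v' p.1}})) ∩
      ⋂ p : {p : (X × X) × Set.Icc (-M : ℤ) M // v p.1.1 ≤ M ∧ v p.1.2 ≤ M},
        {v' | (v p.1.1.1 : ℝ) ≤ p.1.2 + v p.1.1.2 ↔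
          v' ∈ {v' : X → ℝ≥0 | (v' p.1.1.1 : ℝ) ≤ p.1.2 + v' p.1.1.2}} := by
    ext v'
    rw [Set.mem_ofPred_eq, regionEquiv_iff_finite, Set.mem_inter_iff, Set.mem_iInter,
      Set.mem_iInter]
    exact and_congr Iff.rfl ⟨fun h i => h i.1 i.2, fun h p hp => h ⟨p, hp⟩⟩
  rw [this]
  refine .inter (IsLocallyClosed.iInter_of_finite fun p => .inter ?_ ?_)
    (IsLocallyClosed.iInter_of_finite fun p => ?_)
  · exact (isClosed_le (continuous_apply _) continuous_const).isLocallyClosed_iff _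
  · exact (isClosed_le continuous_const (continuous_apply _)).isLocallyClosed_iff _
  · refine (isClosed_le ?_ ?_).isLocallyClosed_iff _ <;> fun_prop

end Regions

/-! ### Finiteness of the set of regions; guards and invariants as unions of regions -/

namespace TimedAutomaton

variable {L X E : Type*} (A : TimedAutomaton L X E)

theorem regionOf_eq_iff {v v' : X → ℝ≥0} :
    A.regionOf v = A.regionOf v' ↔ RegionEquiv A.maxConst v v' := Quotient.eq (r := A.regionSetoid)

theorem exists_regionOf (r : A.Region) : ∃ v, A.regionOf v = r := Quotient.exists_rep r

instance [Finite X] : Finite A.Region := by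
  -- Truth values of finitely many constraints. Differences of unbounded clocks are recorded as
  -- well, which only refines the partition and does not affect injectivity on representatives.
  let F : (X → ℝ≥0) → (X × Fin (A.maxConst + 1) → Prop × Prop) ×
      ((X × X) × Set.Icc (-A.maxConst : ℤ) A.maxConst → Prop) := fun v =>
    (fun p => (v p.1 ≤ (p.2 : ℕ), ((p.2 : ℕ) : ℝ≥0) ≤ v p.1),
      fun p => (v p.1.1 : ℝ) ≤ p.2 + v p.1.2)
  refine Finite.of_injective (fun r => F (A.exists_regionOf r).choose) fun r r' h => ?_
  rw [← (A.exists_regionOf r).choose_spec, ← (A.exists_regionOf r').choose_spec]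
  refine A.regionOf_eq_iff.2 (regionEquiv_iff_finite.2 ⟨fun p => ?_, fun p _ => ?_⟩)
  · have := congrFun (congrArg Prod.fst h) p
    exact ⟨iff_of_eq (congrArg Prod.fst this), iff_of_eq (congrArg Prod.snd this)⟩
  · exact iff_of_eq (congrFun (congrArg Prod.snd h) p)

instance [Finite L] [Finite X] [Finite E] : Finite A.RegionEdge :=
  Finite.of_injective (fun f : A.RegionEdge => (f.src, f.via, f.edge, f.tgt)) fun f f' h => by
    simp only [Prod.mk.injEq] at h
    exact RegionEdge.ext h.1 h.2.1 h.2.2.1 h.2.2.2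

theorem regionOf_reset {v v' : X → ℝ≥0} (h : A.regionOf v = A.regionOf v') (Y : Set X) :
    A.regionOf (resetClocks Y v) = A.regionOf (resetClocks Y v') :=
  A.regionOf_eq_iff.2 ((A.regionOf_eq_iff.1 h).resetClocks Y)

variable [Finite L] [Finite E]

/-- `maxConst` is a supremum in `ℕ`, which bounds the constants only if their set is bounded. -/
theorem bddAbove_const : BddAbove
    {c | (∃ e, ∃ a ∈ A.guard e, a.const = c) ∨ ∃ l, ∃ a ∈ A.inv l, a.const = c} := by
  have : {c | (∃ e, ∃ a ∈ A.guard e, a.const = c) ∨ ∃ l, ∃ a ∈ A.inv l, a.const = c} =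
      (⋃ e, Atom.const '' {a | a ∈ A.guard e}) ∪ ⋃ l, Atom.const '' {a | a ∈ A.inv l} := by
    ext c; simp
  rw [this]
  refine Set.Finite.bddAbove (.union (Set.finite_iUnion fun e => ?_)
    (Set.finite_iUnion fun l => ?_))
  · exact (List.finite_toSet _).image _
  · exact (List.finite_toSet _).image _

theorem mem_guard_iff {v v' : X → ℝ≥0} (h : A.regionOf v = A.regionOf v') (e : E) :
    v ∈ (A.guard e).sat ↔ v' ∈ (A.guard e).sat :=
  (A.regionOf_eq_iff.1 h).sameComp.sat_iff fun a ha =>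
    le_csSup A.bddAbove_const (Or.inl ⟨e, a, ha, rfl⟩)

theorem mem_inv_iff {v v' : X → ℝ≥0} (h : A.regionOf v = A.regionOf v') (l : L) :
    v ∈ (A.inv l).sat ↔ v' ∈ (A.inv l).sat :=
  (A.regionOf_eq_iff.1 h).sameComp.sat_iff fun a ha =>
    le_csSup A.bddAbove_const (Or.inr ⟨l, a, ha, rfl⟩)

end TimedAutomaton

/-! ### The product as a lifting -/

section Product

theorem Guard.mem_rename {X Y : Type*} (f : X → Y) (g : Guard X) (v : Y → ℝ≥0) :
    v ∈ (g.rename f).sat ↔ v ∘ f ∈ g.sat := by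
  simp [Guard.rename, Guard.sat]

theorem Guard.mem_append {X : Type*} (g g' : Guard X) (v : X → ℝ≥0) :
    v ∈ Guard.sat (g ++ g') ↔ v ∈ g.sat ∧ v ∈ g'.sat := by
  simp [Guard.sat, or_imp, forall_and]

variable {AP L X E L' X' E' : Type*} (A : TimedAutomaton L X E) (lab : L → Set AP)
  (B : SpecTA AP L' X' E')

theorem left_post (s : State (L × L') (X ⊕ X')) (t : ℝ≥0) (p : ProdEdge A lab B) :
    ((A.product lab B).toGraph.post s t p).left = A.toGraph.post s.left t p.1.1 := by
  refine State.ext rfl (funext fun x => ?_)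
  have h : (Sum.inl x : X ⊕ X') ∈ (Sum.inl '' A.reset p.1.1 ∪ Sum.inr '' B.reset p.1.2 :
      Set (X ⊕ X')) ↔ x ∈ A.reset p.1.1 := by simp
  classical
  exact if_congr h rfl rfl

theorem mem_product_I {s : State (L × L') (X ⊕ X')} {t : ℝ≥0} {p : ProdEdge A lab B} :
    t ∈ (A.product lab B).toGraph.I s p ↔ t ∈ A.toGraph.I s.left p.1.1 ∧
      B.src p.1.2 = s.loc.2 ∧ elapse (fun x => s.val (Sum.inr x)) t ∈ (B.guard p.1.2).sat := by
  have h1 : (A.src p.1.1, B.src p.1.2) = s.loc ↔ A.src p.1.1 = s.loc.1 ∧ B.src p.1.2 = s.loc.2 :=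
    Prod.ext_iff
  have h2 : ∀ τ l, elapse s.val τ ∈ ((A.inv l).rename Sum.inl : Guard (X ⊕ X')).sat ↔
      elapse s.left.val τ ∈ (A.inv l).sat := fun τ l => Guard.mem_rename _ _ _
  have h3 : elapse s.val t ∈ Guard.sat ((A.guard p.1.1).rename Sum.inl ++
      (B.guard p.1.2).rename Sum.inr) ↔ elapse s.left.val t ∈ (A.guard p.1.1).sat ∧
      elapse (fun x => s.val (Sum.inr x)) t ∈ (B.guard p.1.2).sat := by
    rw [Guard.mem_append, Guard.mem_rename, Guard.mem_rename]
    rfl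
  have h4 : ((A.product lab B).toGraph.post s t p).val ∈
      ((A.inv (A.tgt p.1.1)).rename Sum.inl : Guard (X ⊕ X')).sat ↔
      (A.toGraph.post s.left t p.1.1).val ∈ (A.inv (A.tgt p.1.1)).sat := by
    rw [Guard.mem_rename, ← left_post]
    rfl
  change (A.src p.1.1, B.src p.1.2) = s.loc ∧ (∀ τ' ≤ t, elapse s.val τ' ∈
    ((A.inv s.loc.1).rename Sum.inl : Guard (X ⊕ X')).sat) ∧ elapse s.val t ∈
    Guard.sat ((A.guard p.1.1).rename Sum.inl ++ (B.guard p.1.2).rename Sum.inr) ∧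
    ((A.product lab B).toGraph.post s t p).val ∈
      ((A.inv (A.tgt p.1.1)).rename Sum.inl : Guard (X ⊕ X')).sat ↔
    (A.src p.1.1 = s.loc.1 ∧ (∀ τ' ≤ t, elapse s.left.val τ' ∈ (A.inv s.loc.1).sat) ∧
      elapse s.left.val t ∈ (A.guard p.1.1).sat ∧
      (A.toGraph.post s.left t p.1.1).val ∈ (A.inv (A.tgt p.1.1)).sat) ∧ _
  rw [h1, h3, h4]
  simp only [h2]
  tauto

/-- Existence of the lifted edge is completeness of `B`, uniqueness is determinism. The invariants
of the product involve the clocks of `A` only, so all states are admitted. -/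
theorem lifts_product : Lifts A.toGraph (A.product lab B).toGraph State.left
    (fun p => p.1.1) Set.univ where
  step s _ p t ht := ⟨((mem_product_I A lab B).1 ht).1, trivial⟩
  post := left_post A lab B
  exists_lift s _ e t ht := by
    obtain ⟨e', h1, h2, h3⟩ := B.complete s.loc.2 (lab (A.tgt e)) (fun x => s.val (Sum.inr x)) t
    exact ⟨⟨(e, e'), h2⟩, rfl, (mem_product_I A lab B).2 ⟨ht, h1, h3⟩⟩
  unique s _ p p' t ht ht' hpp := by
    obtain ⟨-, h1, h2⟩ := (mem_product_I A lab B).1 ht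
    obtain ⟨-, h3, h4⟩ := (mem_product_I A lab B).1 ht'
    refine Subtype.ext (Prod.ext hpp ?_)
    by_contra hne
    have := B.deterministic p.1.2 p'.1.2 (h1.trans h3.symm)
      (p.2.trans ((congrArg (fun e => lab (A.tgt e)) hpp).trans p'.2.symm)) hne
    have h5 := Set.mem_inter h2 h4
    rwa [this] at h5

end Product

/-! ### Steps of the timed region automaton -/

namespace TimedAutomaton

variable {L X E : Type*} (D : TimedAutomaton L X E)

/-- The states of the region automaton whose location carries the region of the valuation. -/
def Consistent : Set (State (L × D.Region) X) := {σ | σ.loc.2 = D.regionOf σ.val}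

/-- Forgetting the region. -/
def forget (σ : State (L × D.Region) X) : State L X := ⟨σ.loc.1, σ.val⟩

theorem iota_mem (s : State L X) : D.iota s ∈ D.Consistent := rfl

theorem region_post_mem {σ : State (L × D.Region) X} {g : D.RegionEdge} {t : ℝ≥0}
    (hv : D.regionOf (elapse σ.val t) = g.via) :
    D.regionAutomaton.post σ t g ∈ D.Consistent := by
  obtain ⟨v, τ, -, -, h3, -, h5⟩ := g.realizable
  exact h5.symm.trans (D.regionOf_reset (h3.trans hv.symm) _)

theorem RegionEdge.tgt_eq {D : TimedAutomaton L X E} {g : D.RegionEdge} {v : X → ℝ≥0}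
    (hv : D.regionOf v = g.via) :
    g.tgt = (D.tgt g.edge, D.regionOf (resetClocks (D.reset g.edge) v)) := by
  obtain ⟨v', τ, -, -, h3, h4, h5⟩ := g.realizable
  exact Prod.ext h4.symm (h5.symm.trans (D.regionOf_reset (h3.trans hv.symm) _))

/-- An edge of the region automaton is realizable from one valuation of its source region, and
time-abstract bisimulation carries this to all the others. -/
theorem exists_region_step [Finite X] {σ : State (L × D.Region) X} (hσ : σ ∈ D.Consistent)
    {g : D.RegionEdge} (hg : g.src = σ.loc) : ∃ t, D.regionOf (elapse σ.val t) = g.via := by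
  obtain ⟨v, τ, h1, -, h3, -, -⟩ := g.realizable
  rw [hg, hσ] at h1
  obtain ⟨t, ht⟩ := (D.regionOf_eq_iff.1 h1).exists_elapse τ
  exact ⟨t, (D.regionOf_eq_iff.2 ht).symm.trans h3⟩

section Finite

variable [Finite L] [Finite E]

/-- Guards and invariants are unions of regions, so their truth can be copied from the valuation
that realizes `g`. At intermediate times the invariant follows from its truth at both ends of the
delay. -/
theorem mem_region_step {σ : State (L × D.Region) X} (hσ : σ ∈ D.Consistent) {g : D.RegionEdge}
    (hg : g.src = σ.loc) {t : ℝ≥0} (ht : D.regionOf (elapse σ.val t) = g.via) :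
    t ∈ D.toGraph.I (D.forget σ) g.edge := by
  obtain ⟨v, τ, h1, ⟨h6, h7, h8, h9⟩, h3, h4, h5⟩ := g.realizable
  rw [hg] at h6 h7
  rw [hg, hσ] at h1
  have h0 : ∀ v : X → ℝ≥0, elapse v 0 = v := fun v => funext fun x => add_zero _
  have h10 := (D.mem_inv_iff h1 σ.loc.1).1 (h0 v ▸ h7 0 zero_le)
  have h11 := (D.mem_inv_iff (h3.trans ht.symm) σ.loc.1).1 (h7 τ le_rfl)
  refine ⟨h6, fun τ' hτ' => StochasticTA.mem_sat_of_le _ hτ' h10 h11,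
    (D.mem_guard_iff (h3.trans ht.symm) _).1 h8, ?_⟩
  exact (D.mem_inv_iff (D.regionOf_reset (h3.trans ht.symm) _) _).1 h9

theorem mem_region_I {σ : State (L × D.Region) X} (hσ : σ ∈ D.Consistent) {g : D.RegionEdge}
    {t : ℝ≥0} : t ∈ D.regionAutomaton.I σ g ↔
      g.src = σ.loc ∧ D.regionOf (elapse σ.val t) = g.via := by
  refine ⟨fun h => ⟨h.1, h.2.2.1⟩, fun ⟨hg, ht⟩ => ?_⟩
  obtain ⟨h1, h2, h3, h4⟩ := D.mem_region_step hσ hg ht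
  refine ⟨hg, h2, ht, ?_⟩
  have h5 := RegionEdge.tgt_eq ht
  change _ ∈ (D.inv g.tgt.1).sat
  rw [h5]
  exact h4

/-- Source, region before the reset and underlying edge determine an edge of the region automaton:
its target is the region after the reset. The delay fixes the first two. -/
theorem lifts_region : Lifts D.toGraph D.regionAutomaton D.forget RegionEdge.edge
    D.Consistent where
  step σ hσ g t ht := by
    obtain ⟨h1, h2⟩ := (D.mem_region_I hσ).1 ht
    exact ⟨D.mem_region_step hσ h1 h2, D.region_post_mem h2⟩
  post σ t g := by
    obtain ⟨v, τ, -, -, -, h4, -⟩ := g.realizable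
    exact State.ext h4.symm rfl
  exists_lift σ hσ e t ht := by
    let g : D.RegionEdge := ⟨σ.loc, D.regionOf (elapse σ.val t), e,
      (D.tgt e, D.regionOf (D.toGraph.post (D.forget σ) t e).val),
      σ.val, t, hσ.symm, ht, rfl, rfl, rfl⟩
    exact ⟨g, rfl, (D.mem_region_I hσ).2 ⟨rfl, rfl⟩⟩
  unique σ hσ f f' t ht ht' hff := by
    obtain ⟨h1, h2⟩ := (D.mem_region_I hσ).1 ht
    obtain ⟨h3, h4⟩ := (D.mem_region_I hσ).1 ht'
    refine RegionEdge.ext (h1.trans h3.symm) (h2.symm.trans h4) hff ?_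
    rw [RegionEdge.tgt_eq h2, RegionEdge.tgt_eq h4, hff]

end Finite

/-! ### Punctual and thin edges -/

namespace RegionEdge

variable {D}

/-- In the region of the guard, some clock has an integral value up to the maximal constant. -/
def Punctual (g : D.RegionEdge) : Prop :=
  ∃ x, ∃ c : ℕ, c ≤ D.maxConst ∧ ∀ w, D.regionOf w = g.via → w x = c

theorem Punctual.of_eq {g : D.RegionEdge} {w : X → ℝ≥0} (hw : D.regionOf w = g.via) {x : X} {c : ℕ}
    (hc : c ≤ D.maxConst) (h : w x = c) : g.Punctual :=
  ⟨x, c, hc, fun _ hw' => ((D.regionOf_eq_iff.1 (hw.trans hw'.symm)).sameComp.eq_iff x hc).1 h⟩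

/-- No clock equals a constant up to the maximal one, so all comparisons are strict and survive
small changes; the differences of clocks are controlled by the region before the delay. -/
theorem eventually_of_not_punctual [Finite X] {g : D.RegionEdge} (hg : ¬ g.Punctual) {v : X → ℝ≥0}
    {t : ℝ≥0} (h : D.regionOf (elapse v t) = g.via) :
    ∀ᶠ w in 𝓝 (elapse v t), ∀ v' t', D.regionOf v' = D.regionOf v → elapse v' t' = w →
      D.regionOf w = g.via := by
  filter_upwards [eventually_comp_of_ne D.maxConst (elapse v t)] with w hw v' t' hv' hw'
  subst hw'
  rw [← h, eq_comm]
  exact D.regionOf_eq_iff.2 ((D.regionOf_eq_iff.1 hv'.symm).elapse fun x c hc =>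
    hw x c hc fun h' => hg (Punctual.of_eq h hc h'))

/-- If all edges with the source of `g` are punctual, then a step close to a step along `g` is one
along `g`. -/
theorem eventually_of_punctual [Finite X] {g : D.RegionEdge}
    (hall : ∀ g' : D.RegionEdge, g'.src = g.src → g'.Punctual) {v : X → ℝ≥0}
    {t : ℝ≥0} (h : D.regionOf (elapse v t) = g.via) :
    ∀ᶠ w in 𝓝 (elapse v t), ∀ v' t' (g' : D.RegionEdge), D.regionOf v' = D.regionOf v →
      elapse v' t' = w → g'.src = g.src → D.regionOf w = g'.via → D.regionOf w = g.via := by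
  filter_upwards [eventually_comp_of_ne D.maxConst (elapse v t)] with w hw v' t' g' hv' hw' hg' hvia
  subst hw'
  obtain ⟨x, c, hc, hx⟩ := hall g' hg'
  have h1 := hx _ hvia
  -- Otherwise `x` would compare strictly with `c` at `elapse v t`, hence also at the nearby `w`,
  -- where it equals `c`.
  have h2 : elapse v t x = c := by
    by_contra hne
    have := hw x c hc hne
    exact hne (le_antisymm (this.1.2 h1.le) (this.2.2 h1.ge))
  -- The bisimulating delay also brings `x` to `c`, and only one delay does that, so it is `t'`.
  obtain ⟨t'', ht''⟩ := (D.regionOf_eq_iff.1 hv'.symm).exists_elapse t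
  have h3 := (ht''.sameComp.eq_iff x hc).1 h2
  have h4 : t' = t'' := add_left_cancel (h1.trans h3.symm)
  rw [h4, ← h, eq_comm]
  exact D.regionOf_eq_iff.2 ht''

theorem continuous_elapse (v : X → ℝ≥0) : Continuous (elapse v) :=
  continuous_pi fun x => by unfold elapse; fun_prop

theorem isOpen_delays [Finite X] {g : D.RegionEdge} (hg : ¬ g.Punctual) (v : X → ℝ≥0) :
    IsOpen {t | D.regionOf (elapse v t) = g.via} := by
  refine isOpen_iff_mem_nhds.2 fun t ht => ?_
  filter_upwards [(continuous_elapse v).continuousAt.eventually (eventually_of_not_punctual hg ht)]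
    with t' h
  exact h v t' rfl rfl

theorem Punctual.subsingleton {g : D.RegionEdge} (hg : g.Punctual) (v : X → ℝ≥0) :
    {t | D.regionOf (elapse v t) = g.via}.Subsingleton := by
  obtain ⟨x, c, -, h⟩ := hg
  exact fun t ht t' ht' => add_left_cancel ((h _ ht).trans (h _ ht').symm)

theorem dimH_nnreal_le (S : Set ℝ≥0) : dimH S ≤ 1 := by
  have h : Isometry ((↑) : ℝ≥0 → ℝ) := isometry_subtype_coe
  rw [← h.dimH_image, ← Real.dimH_univ]
  exact dimH_mono (Set.subset_univ _)

theorem interior_image_coe_nonempty {S : Set ℝ≥0} (hS : IsOpen S) (hne : S.Nonempty) :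
    (interior ((↑) '' S : Set ℝ)).Nonempty := by
  obtain ⟨t, ht⟩ := hne
  obtain ⟨ε, hε, hball⟩ := Metric.isOpen_iff.1 hS t ht
  -- The interval lies to the right of `t`, because `t` may be `0`.
  refine ⟨t + ε / 2, mem_interior.2 ⟨Set.Ioo (t : ℝ) (t + ε), fun r hr => ?_, isOpen_Ioo,
    by constructor <;> linarith⟩⟩
  obtain ⟨q, rfl⟩ : ∃ q : ℝ≥0, (q : ℝ) = r := ⟨⟨r, t.2.trans hr.1.le⟩, rfl⟩
  refine ⟨q, hball ?_, rfl⟩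
  rw [Metric.mem_ball, NNReal.dist_eq, abs_lt]
  constructor <;> linarith [hr.1, hr.2]

theorem dimH_of_isOpen_nnreal {S : Set ℝ≥0} (hS : IsOpen S) (hne : S.Nonempty) : dimH S = 1 := by
  have h : Isometry ((↑) : ℝ≥0 → ℝ) := isometry_subtype_coe
  rw [← h.dimH_image, Real.dimH_of_nonempty_interior (interior_image_coe_nonempty hS hne)]
  simp

variable [Finite L] [Finite E]

theorem region_I_eq {v : X → ℝ≥0} {f g : D.RegionEdge} (hv : D.regionOf v = f.src.2)
    (hg : g.src = f.src) :
    D.regionAutomaton.I ⟨f.src, v⟩ g = {t | D.regionOf (elapse v t) = g.via} := by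
  ext t
  exact (D.mem_region_I (σ := ⟨f.src, v⟩) hv.symm).trans (and_iff_right hg)

theorem dimH_region_I_of_punctual {v : X → ℝ≥0} {f g : D.RegionEdge}
    (hv : D.regionOf v = f.src.2) (hg : g.src = f.src) (hp : g.Punctual) :
    dimH (D.regionAutomaton.I ⟨f.src, v⟩ g) = 0 := by
  rw [region_I_eq hv hg]
  exact dimH_subsingleton (hp.subsingleton v)

variable [Finite X]

theorem dimH_region_I_of_not_punctual {v : X → ℝ≥0} {f g : D.RegionEdge}
    (hv : D.regionOf v = f.src.2) (hg : g.src = f.src) (hp : ¬ g.Punctual) :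
    dimH (D.regionAutomaton.I ⟨f.src, v⟩ g) = 1 := by
  rw [region_I_eq hv hg]
  exact dimH_of_isOpen_nnreal (isOpen_delays hp v)
    (D.exists_region_step (σ := ⟨f.src, v⟩) hv.symm hg)

/-- An edge is thin if and only if it is punctual and competes with an edge that is not. -/
theorem thin_iff {f : D.RegionEdge} :
    f.Thin ↔ f.Punctual ∧ ∃ g : D.RegionEdge, g.src = f.src ∧ ¬ g.Punctual := by
  constructor
  · rintro ⟨v, hv, hlt⟩
    refine ⟨?_, ?_⟩
    · by_contra hp
      rw [dimH_region_I_of_not_punctual hv rfl hp] at hlt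
      exact hlt.not_ge (dimH_nnreal_le _)
    · by_contra hall
      push Not at hall
      have : dimH (D.regionAutomaton.IAll ⟨f.src, v⟩) ≤ 0 := by
        rw [TimedGraph.IAll, dimH_iUnion]
        refine iSup_le fun g => ?_
        by_cases hg : g.src = f.src
        · exact (dimH_region_I_of_punctual hv hg (hall g hg)).le
        · have : D.regionAutomaton.I ⟨f.src, v⟩ g = ∅ :=
            Set.eq_empty_of_forall_notMem fun t ht => hg ht.1
          rw [this, dimH_empty]
      exact not_lt_zero (hlt.trans_le this)
  · rintro ⟨hp, g, hg, hgp⟩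
    obtain ⟨v, τ, hv, -⟩ := f.realizable
    refine ⟨v, hv, ?_⟩
    rw [dimH_region_I_of_punctual hv rfl hp]
    refine zero_lt_one.trans_le ?_
    rw [← dimH_region_I_of_not_punctual hv hg hgp]
    exact dimH_mono (Set.subset_iUnion _ g)

end RegionEdge

end TimedAutomaton

/-! ### Lipschitz maps -/

section Lipschitz

/-- Being Lipschitz for some constant. -/
def IsLip {Y Z : Type*} [PseudoEMetricSpace Y] [PseudoEMetricSpace Z] (φ : Y → Z) : Prop :=
  ∃ K, LipschitzWith K φ

variable {Y Z W : Type*} [PseudoEMetricSpace Y] [PseudoEMetricSpace Z] [PseudoEMetricSpace W]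

theorem IsLip.const (z : Z) : IsLip fun _ : Y => z := ⟨0, LipschitzWith.const z⟩

theorem IsLip.comp {φ : Z → W} {ψ : Y → Z} (hφ : IsLip φ) (hψ : IsLip ψ) : IsLip (φ ∘ ψ) := by
  obtain ⟨K, hK⟩ := hφ
  obtain ⟨K', hK'⟩ := hψ
  exact ⟨_, hK.comp hK'⟩

theorem IsLip.pi {ι : Type*} [Fintype ι] {φ : Y → ι → Z} (h : ∀ i, IsLip fun y => φ y i) :
    IsLip φ := by
  choose K hK using h
  refine ⟨∑ i, K i, fun y y' => ?_⟩
  rw [edist_pi_le_iff]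
  intro i
  refine (hK i y y').trans ?_
  gcongr
  exact Finset.single_le_sum (fun _ _ => zero_le) (Finset.mem_univ i)

theorem IsLip.eval {ι : Type*} [Fintype ι] (i : ι) : IsLip fun φ : ι → Z => φ i :=
  ⟨1, LipschitzWith.eval i⟩

theorem IsLip.init {n : ℕ} : IsLip (Fin.init : (Fin (n + 1) → Z) → (Fin n → Z)) :=
  IsLip.pi fun i => IsLip.eval i.castSucc

theorem IsLip.snoc {n : ℕ} {φ : Y → Fin n → Z} {ψ : Y → Z} (hφ : IsLip φ) (hψ : IsLip ψ) :
    IsLip fun y => (Fin.snoc (φ y) (ψ y) : Fin (n + 1) → Z) := by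
  refine IsLip.pi fun i => Fin.lastCases ?_ (fun i => ?_) i
  · simpa using hψ
  · simp only [Fin.snoc_castSucc]
    exact (IsLip.eval i).comp hφ

theorem IsLip.add {φ ψ : Y → ℝ≥0} (hφ : IsLip φ) (hψ : IsLip ψ) : IsLip fun y => φ y + ψ y := by
  obtain ⟨K, hK⟩ := hφ
  obtain ⟨K', hK'⟩ := hψ
  refine ⟨K + K', fun y y' => ?_⟩
  have h1 : edist (φ y + ψ y) (φ y' + ψ y') ≤ edist (φ y) (φ y') + edist (ψ y) (ψ y') := by
    simp only [edist_dist, NNReal.dist_eq]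
    rw [← ENNReal.ofReal_add (abs_nonneg _) (abs_nonneg _)]
    refine ENNReal.ofReal_le_ofReal ?_
    push_cast
    rw [add_sub_add_comm]
    exact abs_add_le _ _
  refine h1.trans ((add_le_add (hK y y') (hK' y y')).trans ?_)
  rw [ENNReal.coe_add, add_mul]

theorem IsLip.const_sub (c : ℝ≥0) : IsLip fun a : ℝ≥0 => c - a := by
  refine ⟨1, LipschitzWith.of_dist_le_mul fun a b => ?_⟩
  simp only [NNReal.dist_eq, NNReal.coe_one, one_mul, NNReal.coe_sub_def]
  refine (abs_max_sub_max_le_abs _ _ _).trans ?_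
  rw [sub_sub_sub_cancel_left, abs_sub_comm]

theorem isLip_toNNReal : IsLip Real.toNNReal := ⟨1, LipschitzWith.of_dist_le_mul fun a b => by
  simp only [NNReal.dist_eq, NNReal.coe_one, one_mul, Real.coe_toNNReal']
  exact abs_max_sub_max_le_abs _ _ _⟩

theorem isLip_coe_nnreal : IsLip (fun a : ℝ≥0 => (a : ℝ)) := 
  ⟨1, (show Isometry ((↑) : ℝ≥0 → ℝ) from isometry_subtype_coe).lipschitz⟩

end Lipschitz

/-! ### Dependence of the states on the delays -/

namespace TimedGraph

variable {L X E : Type*} (G : TimedGraph L X E)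

/-- A clock is the sum of the delays since its last reset, plus its initial value if it was never
reset. -/
theorem isLip_endState (n : ℕ) (s : State L X) (e : Fin n → E) (x : X) :
    IsLip fun τ : Fin n → ℝ≥0 => (G.endState n s τ e).val x := by
  induction n with
  | zero => exact IsLip.const (s.val x)
  | succ n ih =>
    by_cases hx : x ∈ G.reset (e (Fin.last n))
    · have : (fun τ : Fin (n + 1) → ℝ≥0 => (G.endState (n + 1) s τ e).val x) = fun _ => 0 :=
        funext fun τ => if_pos hx
      rw [this]
      exact IsLip.const _
    · have : (fun τ : Fin (n + 1) → ℝ≥0 => (G.endState (n + 1) s τ e).val x) =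
          fun τ => (G.endState n s (Fin.init τ) (Fin.init e)).val x + τ (Fin.last n) :=
        funext fun τ => if_neg hx
      rw [this]
      exact ((ih (Fin.init e)).comp IsLip.init).add (IsLip.eval _)

theorem continuous_endState (n : ℕ) (s : State L X) (e : Fin n → E) :
    Continuous fun τ : Fin n → ℝ≥0 => (G.endState n s τ e).val :=
  continuous_pi fun x => (G.isLip_endState n s e x).choose_spec.continuous

theorem continuous_init {n : ℕ} {Z : Type*} [TopologicalSpace Z] :
    Continuous (Fin.init : (Fin (n + 1) → Z) → (Fin n → Z)) :=
  continuous_pi fun i => continuous_apply i.castSucc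

theorem continuous_snoc {n : ℕ} {Z : Type*} [TopologicalSpace Z] :
    Continuous fun q : (Fin n → Z) × Z => (Fin.snoc q.1 q.2 : Fin (n + 1) → Z) :=
  continuous_pi fun i => Fin.lastCases (by simpa using continuous_snd)
    (fun i => by
      simp only [Fin.snoc_castSucc]
      exact (continuous_apply i).comp continuous_fst) i

/-- The valuation just before the last edge is taken. -/
noncomputable def lastVal {n : ℕ} (s : State L X) (e : Fin n → E) (τ : Fin (n + 1) → ℝ≥0) :
    X → ℝ≥0 := elapse (G.endState n s (Fin.init τ) e).val (τ (Fin.last n))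

theorem continuous_lastVal {n : ℕ} (s : State L X) (e : Fin n → E) :
    Continuous (G.lastVal s e) :=
  continuous_pi fun x => ((continuous_apply x).comp
    ((G.continuous_endState n s e).comp continuous_init)).add (continuous_apply _)

/-! ### Thickness in terms of projections -/

theorem PolC_univ {n : ℕ} (s : State L X) (e : Fin n → E) : G.PolC s e Set.univ = G.Pol n s e :=
  Set.inter_univ _

theorem mem_Pol_snoc {n : ℕ} {s : State L X} {τ : Fin (n + 1) → ℝ≥0} {e : Fin n → E} {e' : E} :
    τ ∈ G.Pol (n + 1) s (Fin.snoc e e') ↔ Fin.init τ ∈ G.Pol n s e ∧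
      τ (Fin.last n) ∈ G.I (G.endState n s (Fin.init τ) e) e' := by
  rw [mem_Pol_succ, Fin.init_snoc, Fin.snoc_last]

/-- One more step is taken after a finite run with delays in `S`. -/
def Succ {n : ℕ} (s : State L X) (e : Fin n → E) (S : Set (Fin n → ℝ≥0)) :
    Set (Fin (n + 1) → ℝ≥0) :=
  {τ | Fin.init τ ∈ S ∧ τ (Fin.last n) ∈ G.IAll (G.endState n s (Fin.init τ) e)}

/-- Replaces the unions over edges and the convention on `C₀` by plain projections. Nonemptiness is
needed for that convention: the projection of an empty set to zero coordinates is empty, not true.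
-/
theorem thick_iff {n : ℕ} {s : State L X} {e : Fin n → E} {C : Set (Fin n → ℝ≥0)}
    (hne : (G.PolC s e C).Nonempty) : G.Thick s e C ↔ ∀ (i : ℕ) (hi : i + 1 ≤ n),
      dimH (G.Succ s (Fin.take i (Nat.le_of_succ_le hi) e)
        (Fin.take i (Nat.le_of_succ_le hi) '' G.PolC s e C)) ≤
      dimH (Fin.take (i + 1) hi '' G.PolC s e C) := by
  have hproj : ∀ i (hi : i ≤ n), G.projC s e C i hi = Fin.take i hi '' G.PolC s e C := by
    intro i hi
    ext σ
    constructor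
    · rintro (rfl | ⟨τ, hτ, rfl⟩)
      · obtain ⟨τ, hτ⟩ := hne
        exact ⟨τ, hτ, funext fun i => i.elim0⟩
      · exact ⟨τ, hτ, rfl⟩
    · rintro ⟨τ, hτ, rfl⟩
      exact Or.inr ⟨τ, hτ, rfl⟩
  rw [Thick, Thin]
  push Not
  refine forall₂_congr fun i hi => ?_
  have h1 : G.PolC s (fun j : Fin (i + 1) => e (Fin.castLE hi j)) (G.projC s e C (i + 1) hi) =
      Fin.take (i + 1) hi '' G.PolC s e C := by
    rw [hproj]
    refine Set.inter_eq_right.2 ?_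
    rintro _ ⟨τ, hτ, rfl⟩
    exact G.take_mem_Pol hτ.1 _ _
  have h2 : (⋃ e' : E, G.PolC s
      (Fin.snoc (fun j : Fin i => e (Fin.castLE (Nat.le_of_succ_le hi) j)) e' : Fin (i + 1) → E)
      {τ | Fin.init τ ∈ G.projC s e C i (Nat.le_of_succ_le hi)}) =
      G.Succ s (Fin.take i (Nat.le_of_succ_le hi) e)
        (Fin.take i (Nat.le_of_succ_le hi) '' G.PolC s e C) := by
    rw [hproj]
    ext τ
    simp only [Set.mem_iUnion, PolC, Set.mem_inter_iff, mem_Pol_snoc]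
    constructor
    · rintro ⟨e', ⟨-, h4⟩, h5⟩
      exact ⟨h5, Set.mem_iUnion.2 ⟨e', h4⟩⟩
    · rintro ⟨h5, h4⟩
      obtain ⟨e', h4⟩ := Set.mem_iUnion.1 h4
      refine ⟨e', ⟨?_, h4⟩, h5⟩
      obtain ⟨τ', hτ', h6⟩ := h5
      rw [← h6]
      exact G.take_mem_Pol hτ'.1 _ _
  rw [h1, h2]

end TimedGraph

/-! ### Relatively open sets -/

/-- `S` is a relatively open subset of `T`. -/
def RelOpen {Y : Type*} [TopologicalSpace Y] (S T : Set Y) : Prop := S ⊆ T ∧ ∀ p ∈ S, S ∈ 𝓝[T] p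

theorem RelOpen.self {Y : Type*} [TopologicalSpace Y] (T : Set Y) : RelOpen T T :=
  ⟨subset_rfl, fun _ _ => self_mem_nhdsWithin⟩

theorem RelOpen.inter_isOpen {Y : Type*} [TopologicalSpace Y] {S T U : Set Y} (h : RelOpen S T)
    (hU : IsOpen U) : RelOpen (S ∩ U) T :=
  ⟨Set.inter_subset_left.trans h.1, fun p hp =>
    inter_mem (h.2 p hp.1) (mem_nhdsWithin_of_mem_nhds (hU.mem_nhds hp.2))⟩

theorem RelOpen.mono {Y : Type*} [TopologicalSpace Y] {S T T' : Set Y} (h : RelOpen S T)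
    (hS : S ⊆ T') (hT : T' ⊆ T) : RelOpen S T' :=
  ⟨hS, fun p hp => nhdsWithin_mono p hT (h.2 p hp)⟩

theorem RelOpen.exists_isOpen {Y : Type*} [TopologicalSpace Y] {S T : Set Y} (h : RelOpen S T) :
    ∃ U, IsOpen U ∧ S = U ∩ T := by
  refine ⟨⋃₀ {U | IsOpen U ∧ U ∩ T ⊆ S}, isOpen_sUnion fun U hU => hU.1, ?_⟩
  ext p
  constructor
  · intro hp
    obtain ⟨U, hU, hpU, hUS⟩ := mem_nhdsWithin.1 (h.2 p hp)
    exact ⟨⟨U, ⟨hU, hUS⟩, hpU⟩, h.1 hp⟩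
  · rintro ⟨⟨U, ⟨-, hUS⟩, hpU⟩, hpT⟩
    exact hUS ⟨hpU, hpT⟩

theorem IsOpen.relOpen {Y : Type*} [TopologicalSpace Y] {U : Set Y} (hU : IsOpen U) (T : Set Y) :
    RelOpen (U ∩ T) T :=
  ⟨Set.inter_subset_right, fun _ hp =>
    inter_mem (mem_nhdsWithin_of_mem_nhds (hU.mem_nhds hp.1)) self_mem_nhdsWithin⟩

/-! ### Cells: the delays along a path of the region automaton -/

namespace TimedAutomaton

variable {L X E : Type*} (D : TimedAutomaton L X E)

open Classical in
/-- The number of edges of a path that are not punctual. -/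
noncomputable def cellDim : (n : ℕ) → (Fin n → D.RegionEdge) → ℕ
  | 0, _ => 0
  | n + 1, f => cellDim n (Fin.init f) + if (f (Fin.last n)).Punctual then 0 else 1

open Classical in
theorem cellDim_snoc {n : ℕ} (f : Fin n → D.RegionEdge) (g : D.RegionEdge) :
    D.cellDim (n + 1) (Fin.snoc f g) = D.cellDim n f + if g.Punctual then 0 else 1 := by
  rw [cellDim, Fin.init_snoc, Fin.snoc_last]

variable {D} [Finite L] [Finite E] {σ₀ : State (L × D.Region) X}

theorem consistent_endState (hσ : σ₀ ∈ D.Consistent) {n : ℕ} {f : Fin n → D.RegionEdge}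
    {τ : Fin n → ℝ≥0} (hτ : τ ∈ D.regionAutomaton.Pol n σ₀ f) :
    D.regionAutomaton.endState n σ₀ τ f ∈ D.Consistent := (D.lifts_region.mem_of_Pol hσ hτ).2

theorem mem_cell_succ (hσ : σ₀ ∈ D.Consistent) {n : ℕ} {f : Fin (n + 1) → D.RegionEdge}
    {τ : Fin (n + 1) → ℝ≥0} : τ ∈ D.regionAutomaton.Pol (n + 1) σ₀ f ↔
      Fin.init τ ∈ D.regionAutomaton.Pol n σ₀ (Fin.init f) ∧
      (f (Fin.last n)).src = (D.regionAutomaton.endState n σ₀ (Fin.init τ) (Fin.init f)).loc ∧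
      D.regionOf (D.regionAutomaton.lastVal σ₀ (Fin.init f) τ) = (f (Fin.last n)).via := by
  rw [TimedGraph.mem_Pol_succ]
  exact and_congr_right fun h => D.mem_region_I (consistent_endState hσ h)

theorem region_endState_eq (hσ : σ₀ ∈ D.Consistent) {n : ℕ} {f : Fin n → D.RegionEdge}
    {τ τ' : Fin n → ℝ≥0} (hτ : τ ∈ D.regionAutomaton.Pol n σ₀ f)
    (hτ' : τ' ∈ D.regionAutomaton.Pol n σ₀ f) :
    D.regionOf (D.regionAutomaton.endState n σ₀ τ f).val =
      D.regionOf (D.regionAutomaton.endState n σ₀ τ' f).val :=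
  (consistent_endState hσ hτ).symm.trans ((congrArg Prod.snd
    (D.regionAutomaton.endState_loc n σ₀ σ₀ rfl τ τ' f)).trans (consistent_endState hσ hτ'))

/-- Upper bound for the dimension. At a punctual edge some clock `x` must equal `c`, so the delay is
`c` minus the previous value of `x`, a Lipschitz function of the earlier delays; every other edge
contributes one free parameter. -/
theorem exists_parametrization (hσ : σ₀ ∈ D.Consistent) (n : ℕ) (f : Fin n → D.RegionEdge) :
    ∃ ψ : (Fin (D.cellDim n f) → ℝ) → (Fin n → ℝ≥0), IsLip ψ ∧
      D.regionAutomaton.Pol n σ₀ f ⊆ Set.range ψ := by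
  induction n with
  | zero => exact ⟨fun _ i => i.elim0, IsLip.const _, fun τ _ => ⟨0, funext fun i => i.elim0⟩⟩
  | succ n ih =>
    obtain ⟨ψ, hψ, hsub⟩ := ih (Fin.init f)
    by_cases hf : (f (Fin.last n)).Punctual
    · have hd : D.cellDim (n + 1) f = D.cellDim n (Fin.init f) := by simp [cellDim, hf]
      rw [hd]
      obtain ⟨x, c, -, hx⟩ := hf
      refine ⟨fun u => Fin.snoc (ψ u)
        (c - (D.regionAutomaton.endState n σ₀ (ψ u) (Fin.init f)).val x),
        hψ.snoc ((IsLip.const_sub c).comp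
          ((D.regionAutomaton.isLip_endState n σ₀ (Fin.init f) x).comp hψ)), fun τ hτ => ?_⟩
      obtain ⟨h1, -, h3⟩ := (mem_cell_succ hσ).1 hτ
      obtain ⟨u, hu⟩ := hsub h1
      refine ⟨u, ?_⟩
      have h4 : (c : ℝ≥0) - (D.regionAutomaton.endState n σ₀ (ψ u) (Fin.init f)).val x =
          τ (Fin.last n) := by
        rw [← hx _ h3, hu]
        exact add_tsub_cancel_left _ _
      change Fin.snoc (ψ u) (_ - _) = τ
      rw [h4, hu, Fin.snoc_init_self]
    · have hd : D.cellDim (n + 1) f = D.cellDim n (Fin.init f) + 1 := by simp [cellDim, hf]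
      rw [hd]
      refine ⟨fun u => Fin.snoc (ψ (Fin.init u)) (u (Fin.last _)).toNNReal,
        (hψ.comp IsLip.init).snoc (isLip_toNNReal.comp (IsLip.eval _)), fun τ hτ => ?_⟩
      obtain ⟨u, hu⟩ := hsub ((mem_cell_succ hσ).1 hτ).1
      refine ⟨Fin.snoc u (τ (Fin.last n) : ℝ), ?_⟩
      simp [hu]

variable [Finite X]

/-- Over the cell of the shorter path, the last step only requires that the valuation before the
reset lie in one region, and regions are locally closed. -/
theorem isLocallyClosed_cell (hσ : σ₀ ∈ D.Consistent) (n : ℕ) (f : Fin n → D.RegionEdge) :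
    IsLocallyClosed (D.regionAutomaton.Pol n σ₀ f) := by
  induction n with
  | zero => exact isOpen_univ.isLocallyClosed
  | succ n ih =>
    by_cases hne : (D.regionAutomaton.Pol (n + 1) σ₀ f).Nonempty
    · obtain ⟨p, hp⟩ := hne
      have : D.regionAutomaton.Pol (n + 1) σ₀ f =
          Fin.init ⁻¹' D.regionAutomaton.Pol n σ₀ (Fin.init f) ∩
          D.regionAutomaton.lastVal σ₀ (Fin.init f) ⁻¹' {w | RegionEquiv D.maxConst
            (D.regionAutomaton.lastVal σ₀ (Fin.init f) p) w} := by
        rw [mem_cell_succ hσ] at hp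
        ext τ
        rw [mem_cell_succ hσ]
        refine and_congr_right fun _ => ⟨fun h => D.regionOf_eq_iff.1 (hp.2.2.trans h.2.symm),
          fun h => ⟨hp.2.1.trans (D.regionAutomaton.endState_loc n σ₀ σ₀ rfl _ _ _),
            (D.regionOf_eq_iff.2 h).symm.trans hp.2.2⟩⟩
      rw [this]
      exact ((ih _).preimage TimedGraph.continuous_init).inter
        ((isLocallyClosed_region _ _).preimage (TimedGraph.continuous_lastVal _ _ _))
    · rw [Set.not_nonempty_iff_eq_empty.1 hne]
      exact isOpen_empty.isLocallyClosed

theorem eventually_mem_cell_of_not_punctual (hσ : σ₀ ∈ D.Consistent) {n : ℕ}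
    {f : Fin (n + 1) → D.RegionEdge} {p : Fin (n + 1) → ℝ≥0}
    (hp : p ∈ D.regionAutomaton.Pol (n + 1) σ₀ f) (hf : ¬ (f (Fin.last n)).Punctual) :
    ∀ᶠ τ : Fin (n + 1) → ℝ≥0 in 𝓝 p, Fin.init τ ∈ D.regionAutomaton.Pol n σ₀ (Fin.init f) →
      τ ∈ D.regionAutomaton.Pol (n + 1) σ₀ f := by
  have hp' := (mem_cell_succ hσ).1 hp
  filter_upwards [(D.regionAutomaton.continuous_lastVal σ₀ (Fin.init f)).continuousAt.eventually
    (RegionEdge.eventually_of_not_punctual hf hp'.2.2)] with τ hτ hinit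
  exact (mem_cell_succ hσ).2 ⟨hinit, hp'.2.1.trans
    (D.regionAutomaton.endState_loc n σ₀ σ₀ rfl _ _ _),
    hτ _ _ (region_endState_eq hσ hinit hp'.1) rfl⟩

theorem exists_mem_cell_snoc (hσ : σ₀ ∈ D.Consistent) {n : ℕ} {f : Fin n → D.RegionEdge}
    {g : D.RegionEdge} {τ : Fin n → ℝ≥0} (hτ : τ ∈ D.regionAutomaton.Pol n σ₀ f)
    (hg : g.src = (D.regionAutomaton.endState n σ₀ τ f).loc) :
    ∃ t, (Fin.snoc τ t : Fin (n + 1) → ℝ≥0) ∈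
      D.regionAutomaton.Pol (n + 1) σ₀ (Fin.snoc f g) := by
  obtain ⟨t, ht⟩ := D.exists_region_step (consistent_endState hσ hτ) hg
  refine ⟨t, D.regionAutomaton.mem_Pol_snoc.2 ⟨by simpa using hτ, ?_⟩⟩
  rw [Fin.init_snoc, Fin.snoc_last]
  exact (D.mem_region_I (consistent_endState hσ hτ)).2 ⟨hg, ht⟩

/-- The projection from a cell to the cell of the shorter path is open. -/
theorem eventually_exists_snoc (hσ : σ₀ ∈ D.Consistent) {n : ℕ} {f : Fin (n + 1) → D.RegionEdge}
    {p : Fin (n + 1) → ℝ≥0} (hp : p ∈ D.regionAutomaton.Pol (n + 1) σ₀ f)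
    {U : Set (Fin (n + 1) → ℝ≥0)} (hU : U ∈ 𝓝 p) :
    ∀ᶠ τ in 𝓝 (Fin.init p), τ ∈ D.regionAutomaton.Pol n σ₀ (Fin.init f) →
      ∃ t, (Fin.snoc τ t : Fin (n + 1) → ℝ≥0) ∈ U ∩ D.regionAutomaton.Pol (n + 1) σ₀ f := by
  obtain ⟨hp1, hp2, hp3⟩ := (mem_cell_succ hσ).1 hp
  by_cases hf : (f (Fin.last n)).Punctual
  · obtain ⟨x, c, -, hx⟩ := hf
    -- The only delay that a punctual last edge can have; it varies continuously with the earlier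
    -- ones.
    let a : (Fin n → ℝ≥0) → ℝ≥0 := fun τ =>
      c - (D.regionAutomaton.endState n σ₀ τ (Fin.init f)).val x
    have hs : Continuous a := Continuous.sub continuous_const
      ((continuous_apply x).comp (D.regionAutomaton.continuous_endState n σ₀ (Fin.init f)))
    have ha : Continuous fun τ => (Fin.snoc τ (a τ) : Fin (n + 1) → ℝ≥0) :=
      TimedGraph.continuous_snoc.comp (continuous_id.prodMk hs)
    have hpa : Fin.snoc (Fin.init p) (a (Fin.init p)) = p := by
      have h1 : a (Fin.init p) = p (Fin.last n) := by
        simp only [a]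
        rw [← hx _ hp3]
        exact add_tsub_cancel_left _ _
      rw [h1, Fin.snoc_init_self]
    have hev : ∀ᶠ τ in 𝓝 (Fin.init p), Fin.snoc τ (a τ) ∈ U := by
      have := ha.tendsto (Fin.init p)
      rw [hpa] at this
      exact this.eventually hU
    filter_upwards [hev] with τ hτU hτ
    refine ⟨a τ, hτU, ?_⟩
    obtain ⟨t, ht⟩ := exists_mem_cell_snoc hσ (g := f (Fin.last n)) hτ
      (hp2.trans (D.regionAutomaton.endState_loc n σ₀ σ₀ rfl _ _ _))
    rw [Fin.snoc_init_self] at ht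
    have h2 := hx _ ((mem_cell_succ hσ).1 ht).2.2
    have h3 : a τ = t := by
      simp only [a]
      rw [← h2]
      simp [TimedGraph.lastVal, elapse]
    rwa [h3]
  -- If the last edge is not punctual, the last delay of `p` can be kept.
  · have hc : Continuous fun τ => (Fin.snoc τ (p (Fin.last n)) : Fin (n + 1) → ℝ≥0) :=
      TimedGraph.continuous_snoc.comp (continuous_id.prodMk continuous_const)
    have := (eventually_mem_cell_of_not_punctual hσ hp hf).and hU
    rw [← Fin.snoc_init_self p] at this
    filter_upwards [hc.continuousAt.eventually this] with τ hτ hτc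
    refine ⟨p (Fin.last n), ?_, ?_⟩
    · exact hτ.2
    · exact hτ.1 (by rwa [Fin.init_snoc])

/-- Lower bound for the dimension: the coordinates of the non-punctual edges can be varied
independently near each point of the cell, so keeping just these maps neighbourhoods onto sets with
interior. -/
theorem exists_projection (hσ : σ₀ ∈ D.Consistent) (n : ℕ) (f : Fin n → D.RegionEdge) :
    ∃ π : (Fin n → ℝ≥0) → (Fin (D.cellDim n f) → ℝ), IsLip π ∧
      ∀ p ∈ D.regionAutomaton.Pol n σ₀ f, ∀ U ∈ 𝓝 p,
        (interior (π '' (U ∩ D.regionAutomaton.Pol n σ₀ f))).Nonempty := by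
  induction n with
  | zero =>
    refine ⟨fun _ => 0, IsLip.const _, fun p hp U hU => ⟨0, ?_⟩⟩
    have : (fun _ => 0 : (Fin 0 → ℝ≥0) → Fin (D.cellDim 0 f) → ℝ) ''
        (U ∩ D.regionAutomaton.Pol 0 σ₀ f) = Set.univ :=
      Set.eq_univ_of_forall fun y => ⟨p, ⟨mem_of_mem_nhds hU, hp⟩, funext fun i => i.elim0⟩
    rw [this, interior_univ]
    trivial
  | succ n ih =>
    obtain ⟨π, hπ, hint⟩ := ih (Fin.init f)
    by_cases hf : (f (Fin.last n)).Punctual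
    · have hd : D.cellDim (n + 1) f = D.cellDim n (Fin.init f) := by simp [cellDim, hf]
      rw [hd]
      refine ⟨fun τ => π (Fin.init τ), hπ.comp IsLip.init, fun p hp U hU => ?_⟩
      refine (hint _ ((mem_cell_succ hσ).1 hp).1 _ (eventually_exists_snoc hσ hp hU)).mono
        (interior_mono ?_)
      rintro _ ⟨τ, ⟨h1, h2⟩, rfl⟩
      obtain ⟨t, ht⟩ := h1 h2
      exact ⟨_, ht, by simp only [Fin.init_snoc]⟩
    · have hd : D.cellDim (n + 1) f = D.cellDim n (Fin.init f) + 1 := by simp [cellDim, hf]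
      rw [hd]
      refine ⟨fun τ => Fin.snoc (π (Fin.init τ)) (τ (Fin.last n) : ℝ),
        (hπ.comp IsLip.init).snoc (isLip_coe_nnreal.comp (IsLip.eval _)), fun p hp U hU => ?_⟩
      have hev := (eventually_mem_cell_of_not_punctual hσ hp hf).and hU
      rw [← Fin.snoc_init_self p] at hev
      have hev2 := ((TimedGraph.continuous_snoc (n := n) (Z := ℝ≥0)).continuousAt
        (x := (Fin.init p, p (Fin.last n)))).eventually hev
      rw [nhds_prod_eq] at hev2
      obtain ⟨P, hP, Q, hQ, hPQ⟩ := eventually_prod_iff.1 hev2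
      obtain ⟨y, hy⟩ := hint _ ((mem_cell_succ hσ).1 hp).1 _ hP
      obtain ⟨ε, hε, hball⟩ := Metric.mem_nhds_iff.1 hQ
      set t := p (Fin.last n)
      refine ⟨Fin.snoc y ((t : ℝ) + ε / 2), mem_interior.2
        ⟨{u | Fin.init u ∈ interior (π '' ({τ | P τ} ∩ D.regionAutomaton.Pol n σ₀ (Fin.init f))) ∧
          u (Fin.last _) ∈ Set.Ioo (t : ℝ) (t + ε)}, ?_, ?_, ?_⟩⟩
      · rintro u ⟨hu1, hu2⟩
        obtain ⟨τ, ⟨h1, h2⟩, h3⟩ := interior_subset hu1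
        obtain ⟨q, hq⟩ : ∃ q : ℝ≥0, (q : ℝ) = u (Fin.last _) :=
          ⟨⟨u (Fin.last _), t.2.trans hu2.1.le⟩, rfl⟩
        have hqQ : Q q := by
          refine hball ?_
          rw [Metric.mem_ball, NNReal.dist_eq, abs_lt, hq]
          constructor <;> linarith [hu2.1, hu2.2]
        have h4 := hPQ h1 hqQ
        refine ⟨Fin.snoc τ q, ⟨h4.2, h4.1 (by rwa [Fin.init_snoc])⟩, ?_⟩
        simp only [Fin.init_snoc, Fin.snoc_last, h3, hq, Fin.snoc_init_self]
      · exact (isOpen_interior.preimage TimedGraph.continuous_init).inter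
          (isOpen_Ioo.preimage (continuous_apply _))
      · simp only [Set.mem_ofPred_eq, Fin.init_snoc, Fin.snoc_last]
        exact ⟨hy, by constructor <;> linarith⟩

/-- The dimension of a nonempty relatively open part of a cell. -/
theorem dimH_of_relOpen (hσ : σ₀ ∈ D.Consistent) {n : ℕ} {f : Fin n → D.RegionEdge}
    {S : Set (Fin n → ℝ≥0)} (hS : RelOpen S (D.regionAutomaton.Pol n σ₀ f)) (hne : S.Nonempty) :
    dimH S = D.cellDim n f := by
  refine le_antisymm ?_ ?_
  · obtain ⟨ψ, ⟨K, hψ⟩, hsub⟩ := exists_parametrization hσ n f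
    refine (dimH_mono (hS.1.trans hsub)).trans (hψ.dimH_range_le.trans ?_)
    rw [Real.dimH_univ_pi_fin]
  · obtain ⟨π, ⟨K, hπ⟩, hint⟩ := exists_projection hσ n f
    obtain ⟨p, hp⟩ := hne
    obtain ⟨U, hU, hUS⟩ := mem_nhdsWithin_iff_exists_mem_nhds_inter.1 (hS.2 p hp)
    have h := Real.dimH_of_nonempty_interior (hint p (hS.1 hp) U hU)
    rw [Module.finrank_fin_fun] at h
    rw [← h]
    exact (hπ.dimH_image_le _).trans (dimH_mono hUS)

theorem relOpen_image_init (hσ : σ₀ ∈ D.Consistent) {n : ℕ} {f : Fin (n + 1) → D.RegionEdge}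
    {S : Set (Fin (n + 1) → ℝ≥0)} (hS : RelOpen S (D.regionAutomaton.Pol (n + 1) σ₀ f)) :
    RelOpen (Fin.init '' S) (D.regionAutomaton.Pol n σ₀ (Fin.init f)) := by
  refine ⟨?_, ?_⟩
  · rintro _ ⟨τ, hτ, rfl⟩
    exact (D.regionAutomaton.mem_Pol_succ.1 (hS.1 hτ)).1
  · rintro _ ⟨p, hp, rfl⟩
    obtain ⟨U, hU, hUS⟩ := mem_nhdsWithin_iff_exists_mem_nhds_inter.1 (hS.2 p hp)
    refine mem_nhdsWithin_iff_exists_mem_nhds_inter.2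
      ⟨_, eventually_exists_snoc hσ (hS.1 hp) hU, ?_⟩
    rintro τ ⟨h1, h2⟩
    obtain ⟨t, ht⟩ := h1 h2
    exact ⟨_, hUS ht, Fin.init_snoc _ _⟩

theorem relOpen_image_take (hσ : σ₀ ∈ D.Consistent) {n : ℕ} {f : Fin n → D.RegionEdge}
    {S : Set (Fin n → ℝ≥0)} (hS : RelOpen S (D.regionAutomaton.Pol n σ₀ f)) (i : ℕ) (hi : i ≤ n) :
    RelOpen (Fin.take i hi '' S) (D.regionAutomaton.Pol i σ₀ (Fin.take i hi f)) := by
  induction n with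
  | zero =>
    obtain rfl := Nat.le_zero.1 hi
    have : Fin.take 0 hi '' S = S := by
      ext τ
      constructor
      · rintro ⟨τ', h, rfl⟩
        exact h
      · exact fun h => ⟨τ, h, rfl⟩
    rw [this]
    exact hS
  | succ n ih =>
    rcases Nat.lt_or_eq_of_le hi with hlt | rfl
    · have := ih (relOpen_image_init hσ hS) (Nat.le_of_lt_succ hlt)
      rwa [Set.image_image] at this
    · simpa using hS

/-- The dimension condition in the definition of thickness says that no edge of the path is
thin. -/
theorem dimH_succ_le_iff (hσ : σ₀ ∈ D.Consistent) {n : ℕ} {f : Fin n → D.RegionEdge}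
    {S : Set (Fin n → ℝ≥0)} (hS : RelOpen S (D.regionAutomaton.Pol n σ₀ f)) (hne : S.Nonempty)
    (i : ℕ) (hi : i + 1 ≤ n) :
    dimH (D.regionAutomaton.Succ σ₀ (Fin.take i (Nat.le_of_succ_le hi) f)
      (Fin.take i (Nat.le_of_succ_le hi) '' S)) ≤ dimH (Fin.take (i + 1) hi '' S) ↔
    ¬ (f ⟨i, hi⟩).Thin := by
  set fi := Fin.take i (Nat.le_of_succ_le hi) f with hfi
  set Si := Fin.take i (Nat.le_of_succ_le hi) '' S with hSi
  have hSi' : RelOpen Si (D.regionAutomaton.Pol i σ₀ fi) := relOpen_image_take hσ hS _ _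
  have hS' := relOpen_image_take hσ hS (i + 1) hi
  obtain ⟨p, hp⟩ := hne
  have hp1 := hS'.1 ⟨p, hp, rfl⟩
  have hp2 := (mem_cell_succ hσ).1 hp1
  have hpi : Fin.take i (Nat.le_of_succ_le hi) p ∈ Si := ⟨p, hp, rfl⟩
  have hdim : dimH (Fin.take (i + 1) hi '' S) = D.cellDim (i + 1) (Fin.take (i + 1) hi f) :=
    dimH_of_relOpen hσ hS' ⟨_, p, hp, rfl⟩
  have hQ : ∀ g : D.RegionEdge,
      RelOpen {τ : Fin (i + 1) → ℝ≥0 | Fin.init τ ∈ Si ∧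
        τ ∈ D.regionAutomaton.Pol (i + 1) σ₀ (Fin.snoc fi g)}
        (D.regionAutomaton.Pol (i + 1) σ₀ (Fin.snoc fi g)) := fun g => by
    obtain ⟨U, hU, hUS⟩ := hSi'.exists_isOpen
    convert IsOpen.relOpen (hU.preimage TimedGraph.continuous_init)
      (D.regionAutomaton.Pol (i + 1) σ₀ (Fin.snoc fi g)) using 1
    ext τ
    rw [hUS]
    exact and_congr_left fun h' => and_iff_left (D.regionAutomaton.mem_Pol_snoc.1 h').1
  -- The one-step prolongations split into relatively open parts of cells of paths `Fin.snoc fi g`.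
  -- Their dimension exceeds that of the common prefix by `0` or `1`, so the inequality fails only
  -- if the chosen edge is punctual and some competitor `g` is not.
  have hunion : D.regionAutomaton.Succ σ₀ fi Si = ⋃ g,
      {τ : Fin (i + 1) → ℝ≥0 | Fin.init τ ∈ Si ∧
        τ ∈ D.regionAutomaton.Pol (i + 1) σ₀ (Fin.snoc fi g)} := by
    ext τ
    simp only [TimedGraph.Succ, TimedGraph.IAll, Set.mem_iUnion, Set.mem_ofPred_eq,
      TimedGraph.mem_Pol_snoc]
    constructor
    · rintro ⟨h1, g, h2⟩
      exact ⟨g, h1, hSi'.1 h1, h2⟩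
    · rintro ⟨g, h1, -, h2⟩
      exact ⟨h1, g, h2⟩
  rw [hunion, dimH_iUnion, hdim, iSup_le_iff, RegionEdge.thin_iff]
  rw [show Fin.take (i + 1) hi f = Fin.snoc fi (f ⟨i, hi⟩) from Fin.take_succ_eq_snoc i hi f,
    cellDim_snoc]
  constructor
  · rintro h ⟨h1, g, h2, h3⟩
    obtain ⟨t, ht⟩ := exists_mem_cell_snoc hσ (g := g) (hSi'.1 hpi) (h2.trans hp2.2.1)
    have h4 := h g
    rw [dimH_of_relOpen hσ (hQ g) ⟨_, by rw [Fin.init_snoc]; exact hpi, ht⟩] at h4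
    have h5 := Nat.cast_le.1 h4
    rw [cellDim_snoc, if_pos h1, if_neg h3] at h5
    omega
  · intro h g
    rcases Set.eq_empty_or_nonempty
      {τ : Fin (i + 1) → ℝ≥0 | Fin.init τ ∈ Si ∧
        τ ∈ D.regionAutomaton.Pol (i + 1) σ₀ (Fin.snoc fi g)} with h0 | h0
    · rw [h0, dimH_empty]
      exact zero_le
    · rw [dimH_of_relOpen hσ (hQ g) h0]
      obtain ⟨τ, hτ1, hτ2⟩ := h0
      have h1 := (mem_cell_succ hσ).1 hτ2
      simp only [Fin.init_snoc, Fin.snoc_last] at h1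
      have h2 : g.src = (f ⟨i, hi⟩).src := h1.2.1.trans
        ((D.regionAutomaton.endState_loc i σ₀ σ₀ rfl _ _ _).trans hp2.2.1.symm)
      refine Nat.cast_le.2 ?_
      rw [cellDim_snoc]
      refine Nat.add_le_add_left ?_ _
      by_cases hp : (f ⟨i, hi⟩).Punctual
      · have : g.Punctual := by
          by_contra hg
          exact h ⟨hp, g, h2, hg⟩
        simp [this]
      · rw [if_neg hp]
        split_ifs <;> omega

end TimedAutomaton

/-! ### Convexity of the sets of delays -/

section Convexity

variable {L X E : Type*} {a b : ℝ≥0}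

theorem Guard.sat_convex (hab : a + b = 1) {g : Guard X} {v w : X → ℝ≥0} (hv : v ∈ g.sat)
    (hw : w ∈ g.sat) : a • v + b • w ∈ g.sat := by
  intro c hc
  have h1 := hv c hc
  have h2 := hw c hc
  simp only [Pi.add_apply, Pi.smul_apply]
  cases hcmp : c.cmp <;> simp only [hcmp, Cmp.Holds] at h1 h2 ⊢
  · exact convex_Iio (𝕜 := ℝ≥0) (c.const : ℝ≥0) h1 h2 zero_le zero_le hab
  · exact convex_Iic (𝕜 := ℝ≥0) (c.const : ℝ≥0) h1 h2 zero_le zero_le hab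
  · rw [h1, h2, ← add_smul, hab, one_smul]
  · exact convex_Ici (𝕜 := ℝ≥0) (c.const : ℝ≥0) h1 h2 zero_le zero_le hab
  · exact convex_Ioi (𝕜 := ℝ≥0) (c.const : ℝ≥0) h1 h2 zero_le zero_le hab

theorem elapse_convex (v w : X → ℝ≥0) (t u : ℝ≥0) :
    elapse (a • v + b • w) (a * t + b * u) = a • elapse v t + b • elapse w u := by
  funext x
  simp only [elapse, Pi.add_apply, Pi.smul_apply, smul_eq_mul]
  ring

theorem resetClocks_convex (Y : Set X) (v w : X → ℝ≥0) :
    resetClocks Y (a • v + b • w) = a • resetClocks Y v + b • resetClocks Y w := by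
  funext x
  by_cases hx : x ∈ Y <;> simp [resetClocks, hx]

namespace TimedAutomaton

variable (A : TimedAutomaton L X E)

/-- Guards are conjunctions of interval constraints, and waiting and resetting are affine in
valuation and delay together. The two initial valuations may differ so that the induction can go
through the first step. -/
theorem Pol_convex (hab : a + b = 1) {n : ℕ} {l : L} {v w : X → ℝ≥0} {e : Fin n → E}
    {τ σ : Fin n → ℝ≥0} (hτ : τ ∈ A.toGraph.Pol n ⟨l, v⟩ e) (hσ : σ ∈ A.toGraph.Pol n ⟨l, w⟩ e) :
    a • τ + b • σ ∈ A.toGraph.Pol n ⟨l, a • v + b • w⟩ e := by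
  induction n generalizing l v w with
  | zero => trivial
  | succ n ih =>
    obtain ⟨⟨h1, h2, h3, h4⟩, h5⟩ := hτ
    obtain ⟨⟨-, k2, k3, k4⟩, k5⟩ := hσ
    have h0 : ∀ v : X → ℝ≥0, elapse v 0 = v := fun v => funext fun x => add_zero _
    have hpost : (A.toGraph.post ⟨l, a • v + b • w⟩ (a * τ 0 + b * σ 0) (e 0)) =
        ⟨A.tgt (e 0), a • (A.toGraph.post ⟨l, v⟩ (τ 0) (e 0)).val +
          b • (A.toGraph.post ⟨l, w⟩ (σ 0) (e 0)).val⟩ :=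
      State.ext rfl (by
        simp only [TimedGraph.post]
        rw [elapse_convex, resetClocks_convex])
    refine ⟨⟨h1, fun t ht => StochasticTA.mem_sat_of_le _ ht ?_ ?_, ?_, ?_⟩, ?_⟩
    · have h6 := h2 0 zero_le
      have k6 := k2 0 zero_le
      rw [h0] at h6 k6
      exact Guard.sat_convex hab h6 k6
    · exact (elapse_convex v w (τ 0) (σ 0)).symm ▸ Guard.sat_convex hab (h2 _ le_rfl) (k2 _ le_rfl)
    · exact (elapse_convex v w (τ 0) (σ 0)).symm ▸ Guard.sat_convex hab h3 k3
    · change (A.toGraph.post _ (a * τ 0 + b * σ 0) (e 0)).val ∈ _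
      rw [hpost]
      exact Guard.sat_convex hab h4 k4
    · change _ ∈ A.toGraph.Pol n (A.toGraph.post _ (a * τ 0 + b * σ 0) (e 0)) _
      rw [hpost]
      exact ih h5 k5

theorem dist_homothety {n : ℕ} (hab : a + b = 1) (p x : Fin n → ℝ≥0) :
    dist (a • p + b • x) p ≤ b * dist x p := by
  refine (dist_pi_le_iff (by positivity)).2 fun i => ?_
  have ha : (a : ℝ) = 1 - b := by rw [← NNReal.coe_one, ← hab]; push_cast; ring
  have h1 : dist ((a • p + b • x) i) (p i) = b * dist (x i) (p i) := by
    simp only [NNReal.dist_eq, Pi.add_apply, Pi.smul_apply, smul_eq_mul, NNReal.coe_add,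
      NNReal.coe_mul, ha]
    rw [← abs_of_nonneg b.coe_nonneg, ← abs_mul, abs_of_nonneg b.coe_nonneg]
    congr 1
    ring
  rw [h1]
  gcongr
  exact dist_le_pi_dist x p i

theorem antilipschitz_homothety {n : ℕ} (hb : 0 < b) (p : Fin n → ℝ≥0) :
    AntilipschitzWith b⁻¹ fun x : Fin n → ℝ≥0 => a • p + b • x := by
  refine AntilipschitzWith.of_le_mul_dist fun x y => (dist_pi_le_iff (by positivity)).2 fun i => ?_
  have h1 := dist_le_pi_dist (a • p + b • x) (a • p + b • y) i
  simp only [NNReal.dist_eq, Pi.add_apply, Pi.smul_apply, smul_eq_mul, NNReal.coe_add,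
    NNReal.coe_mul, add_sub_add_left_eq_sub] at h1 ⊢
  rw [← mul_sub, abs_mul, abs_of_nonneg b.coe_nonneg] at h1
  have hb' : (0 : ℝ) < b := hb
  rw [NNReal.coe_inv, inv_mul_eq_div, le_div_iff₀ hb', mul_comm]
  exact h1

/-- A relatively open part of a set of delays has projections of the same dimensions. -/
theorem dimH_take_le {n : ℕ} {s : State L X} {e : Fin n → E} {S : Set (Fin n → ℝ≥0)}
    (hS : RelOpen S (A.toGraph.Pol n s e)) (hne : S.Nonempty) (i : ℕ) (hi : i ≤ n) :
    dimH (Fin.take i hi '' A.toGraph.Pol n s e) ≤ dimH (Fin.take i hi '' S) := by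
  obtain ⟨p, hp⟩ := hne
  obtain ⟨U, hU, hUS⟩ := mem_nhdsWithin_iff_exists_mem_nhds_inter.1 (hS.2 p hp)
  obtain ⟨r, hr, hball⟩ := Metric.mem_nhds_iff.1 hU
  -- Bounded pieces, each of which a homothety with centre `p` can shrink into the ball around `p`.
  have hunion : Fin.take i hi '' A.toGraph.Pol n s e = ⋃ N : ℕ, Fin.take i hi ''
      (A.toGraph.Pol n s e ∩ Metric.closedBall p N) := by
    rw [← Set.image_iUnion, ← Set.inter_iUnion, Metric.iUnion_closedBall_nat, Set.inter_univ]
  rw [hunion, dimH_iUnion]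
  refine iSup_le fun N => ?_
  obtain ⟨b, hb, hb1, hbr⟩ : ∃ b : ℝ≥0, 0 < b ∧ b ≤ 1 ∧ (b : ℝ) * N < r := by
    have hN : (0 : ℝ) < N + 1 := by positivity
    have hpos : 0 < min 1 (r / ((N : ℝ) + 1)) := lt_min one_pos (div_pos hr hN)
    refine ⟨⟨min 1 (r / ((N : ℝ) + 1)), hpos.le⟩, hpos, ?_, ?_⟩
    · exact min_le_left (1 : ℝ) _
    · change min 1 (r / ((N : ℝ) + 1)) * N < r
      have h1 : min 1 (r / ((N : ℝ) + 1)) ≤ r / (N + 1) := min_le_right _ _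
      calc min 1 (r / ((N : ℝ) + 1)) * N ≤ r / (N + 1) * N := by gcongr
        _ < r / (N + 1) * (N + 1) := by gcongr; linarith
        _ = r := by field_simp
  have hab : (1 - b) + b = 1 := tsub_add_cancel_of_le hb1
  -- The homothety does not lower the dimension, commutes with the projection, and maps into the set
  -- of delays by convexity.
  refine ((antilipschitz_homothety (a := 1 - b) hb (Fin.take i hi p)).le_dimH_image _).trans
    (dimH_mono ?_)
  rintro _ ⟨_, ⟨x, ⟨hx1, hx2⟩, rfl⟩, rfl⟩
  refine ⟨(1 - b) • p + b • x, hUS ⟨hball ?_, ?_⟩, rfl⟩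
  · refine (dist_homothety hab p x).trans_lt (lt_of_le_of_lt ?_ hbr)
    gcongr
    exact hx2
  · have := A.Pol_convex hab (l := s.loc) (v := s.val) (w := s.val) (hS.1 hp) hx1
    rwa [← add_smul, hab, one_smul] at this

/-- Thickness is inherited by nonempty relatively open constraints. -/
theorem thick_of_subset {n : ℕ} {s : State L X} {e : Fin n → E} {C C' : Set (Fin n → ℝ≥0)}
    (hC : A.toGraph.Thick s e C) (hsub : A.toGraph.PolC s e C' ⊆ A.toGraph.PolC s e C)
    (hne : (A.toGraph.PolC s e C').Nonempty)
    (hopen : RelOpen (A.toGraph.PolC s e C') (A.toGraph.Pol n s e)) :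
    A.toGraph.Thick s e C' := by
  rw [TimedGraph.thick_iff _ hne]
  rw [TimedGraph.thick_iff _ (hne.mono hsub)] at hC
  intro i hi
  -- The prolongations shrink with the constraint, while the projections keep the dimension of the
  -- projection of the full set of delays.
  refine (dimH_mono fun τ hτ => ?_).trans ((hC i hi).trans ((dimH_mono (Set.image_mono
    Set.inter_subset_left)).trans (A.dimH_take_le hopen hne (i + 1) hi)))
  exact ⟨Set.image_mono hsub hτ.1, hτ.2⟩

end TimedAutomaton

end Convexity

/-! ### Locally closed covers -/

/-- Among the points `p` of `U`, choose one in the fewest closures of the sets `S i ∩ U`. Near `p`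
no further closure can appear, hence by minimality none disappears. So a piece `S i` containing `p`
has all nearby points of `U` in its closure, and being locally closed it contains them. No
completeness is required. -/
theorem exists_mem_nhdsWithin_of_cover {Y ι : Type*} [TopologicalSpace Y] [Finite ι]
    {S : ι → Set Y} (hS : ∀ i, IsLocallyClosed (S i)) {U T : Set Y} (hU : RelOpen U T)
    (hne : U.Nonempty) (hcov : U ⊆ ⋃ i, S i) : ∃ i, ∃ p ∈ U ∩ S i, S i ∈ 𝓝[T] p := by
  let I : Y → Set ι := fun p => {i | p ∈ closure (S i ∩ U)}
  obtain ⟨p, hp, hmin⟩ := (measure fun p => (I p).ncard).wf.has_min U hne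
  obtain ⟨i, hi⟩ := Set.mem_iUnion.1 (hcov hp)
  refine ⟨i, p, ⟨hp, hi⟩, ?_⟩
  have hiI : i ∈ I p := subset_closure ⟨hi, hp⟩
  obtain ⟨O, Z, hO, hZ, hOZ⟩ := hS i
  have hev : ∀ᶠ q in 𝓝 p, I q ⊆ I p := by
    have : ∀ j, ∀ᶠ q in 𝓝 p, j ∈ I q → j ∈ I p := fun j => by
      by_cases hj : j ∈ I p
      · exact Eventually.of_forall fun _ _ => hj
      · filter_upwards [isClosed_closure.isOpen_compl.mem_nhds hj] with q hq hq'
        exact absurd hq' hq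
    filter_upwards [eventually_all.2 this] with q hq j hj
    exact hq j hj
  filter_upwards [hU.2 p hp, mem_nhdsWithin_of_mem_nhds hev,
    mem_nhdsWithin_of_mem_nhds (hO.mem_nhds (hOZ ▸ hi : p ∈ O ∩ Z).1)] with q hqU hqI hqO
  have hle : (I p).ncard ≤ (I q).ncard := not_lt.1 (hmin q hqU)
  have heq : I q = I p := Set.eq_of_subset_of_ncard_le hqI hle
  have h1 : i ∈ I q := by rw [heq]; exact hiI
  change q ∈ closure (S i ∩ U) at h1
  rw [hOZ] at h1 ⊢
  exact ⟨hqO, closure_minimal (Set.inter_subset_left.trans Set.inter_subset_right) hZ h1⟩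

/-! ### Thick cylinders and region paths -/

section Thick

variable {L X E L' X' E' : Type*} {A : TimedAutomaton L X E} {D : TimedAutomaton L' X' E'}
  [Finite L'] [Finite X'] [Finite E'] {p : State (L' × D.Region) X' → State L X}
  {h : D.RegionEdge → E} {σ₀ : State (L' × D.Region) X'}

/-- All steps of `A` lift, so inside a cell the one-step prolongations in `A` and in the region
automaton are the same sets of delays. The dimension count in cells thus applies to `A`, although
its edges are coarser. -/
theorem thick_iff_forall_not_thin (H : Lifts A.toGraph D.regionAutomaton p h D.Consistent)
    (hσ : σ₀ ∈ D.Consistent) {n : ℕ} {f : Fin n → D.RegionEdge} {C : Set (Fin n → ℝ≥0)}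
    (hopen : RelOpen (A.toGraph.PolC (p σ₀) (h ∘ f) C) (A.toGraph.Pol n (p σ₀) (h ∘ f)))
    (hne : (A.toGraph.PolC (p σ₀) (h ∘ f) C).Nonempty)
    (hsub : A.toGraph.PolC (p σ₀) (h ∘ f) C ⊆ D.regionAutomaton.Pol n σ₀ f) :
    A.toGraph.Thick (p σ₀) (h ∘ f) C ↔ ∀ i, ¬ (f i).Thin := by
  have hopen' := hopen.mono hsub (H.Pol_subset hσ f)
  rw [TimedGraph.thick_iff _ hne, Fin.forall_iff]
  refine forall₂_congr fun i hi => ?_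
  rw [← D.dimH_succ_le_iff hσ hopen' hne i hi]
  have : A.toGraph.Succ (p σ₀) (Fin.take i (Nat.le_of_succ_le hi) (h ∘ f))
      (Fin.take i (Nat.le_of_succ_le hi) '' A.toGraph.PolC (p σ₀) (h ∘ f) C) =
      D.regionAutomaton.Succ σ₀ (Fin.take i (Nat.le_of_succ_le hi) f)
      (Fin.take i (Nat.le_of_succ_le hi) '' A.toGraph.PolC (p σ₀) (h ∘ f) C) := by
    ext τ
    refine and_congr_right fun hτ => ?_
    have h1 := (TimedAutomaton.relOpen_image_take hσ hopen' i (Nat.le_of_succ_le hi)).1 hτ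
    have h2 := H.map_endState σ₀ i (Fin.init τ) (Fin.take i (Nat.le_of_succ_le hi) f)
    have h3 := (H.mem_of_Pol hσ h1).2
    simp only [TimedGraph.IAll, Set.mem_iUnion]
    constructor
    · rintro ⟨e, he⟩
      have he' : τ (Fin.last i) ∈ A.toGraph.I (p (D.regionAutomaton.endState i σ₀ (Fin.init τ)
        (Fin.take i (Nat.le_of_succ_le hi) f))) e := h2.symm ▸ he
      obtain ⟨g, -, hg⟩ := H.exists_lift _ h3 e _ he'
      exact ⟨g, hg⟩
    · rintro ⟨g, hg⟩
      exact ⟨h g, h2 ▸ (H.step _ h3 g _ hg).1⟩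
  rw [this]

theorem region_thick_iff (hσ : σ₀ ∈ D.Consistent) {n : ℕ} {f : Fin n → D.RegionEdge}
    (hne : (D.regionAutomaton.Pol n σ₀ f).Nonempty) :
    D.regionAutomaton.Thick σ₀ f Set.univ ↔ ∀ i, ¬ (f i).Thin := by
  rw [← TimedGraph.PolC_univ] at hne
  rw [TimedGraph.thick_iff _ hne, Fin.forall_iff]
  refine forall₂_congr fun i hi => ?_
  rw [TimedGraph.PolC_univ] at hne ⊢
  exact D.dimH_succ_le_iff hσ (RelOpen.self _) hne i hi

theorem thickInf_iff (hσ : σ₀ ∈ D.Consistent) (r : D.regionAutomaton.Run σ₀) :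
    D.regionAutomaton.ThickInf σ₀ r.edge ↔ ∀ n, ¬ (r.edge n).Thin := by
  constructor
  · intro hr n
    exact (region_thick_iff hσ ⟨_, r.mem_Pol (n + 1)⟩).1 (hr (n + 1) n.succ_pos) (Fin.last n)
  · exact fun hr n _ => (region_thick_iff hσ ⟨_, r.mem_Pol n⟩).2 fun i => hr i

end Thick

/-! ### Basic neighbourhoods of a run -/

namespace TimedAutomaton

variable {L X E : Type*} (A : TimedAutomaton L X E) {s : State L X}

/-- The delays of `ρ` satisfy the Borel constraint `C`, which defines a thick cylinder. -/
def BasicNhd (ρ : A.toGraph.Run s) (n : ℕ) (C : Set (Fin n → ℝ≥0)) : Prop :=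
  MeasurableSet C ∧
  RelOpen (A.toGraph.PolC s (fun i : Fin n => ρ.edge i) C)
    (A.toGraph.Pol n s fun i : Fin n => ρ.edge i) ∧
  A.toGraph.Thick s (fun i : Fin n => ρ.edge i) C ∧ (fun i : Fin n => ρ.delay i) ∈ C

variable {A}

/-- The shorter constraint cuts a relatively open part, nonempty because of `ρ`, out of the longer
one; `thick_of_subset` keeps it thick. -/
theorem BasicNhd.inter_of_le {ρ : A.toGraph.Run s} {n m : ℕ} {C : Set (Fin n → ℝ≥0)}
    {C' : Set (Fin m → ℝ≥0)} (hC : A.BasicNhd ρ n C) (hC' : A.BasicNhd ρ m C') (h : n ≤ m) :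
    A.BasicNhd ρ m (C' ∩ Fin.take n h ⁻¹' C) := by
  obtain ⟨h1, h2, h3, h4⟩ := hC
  obtain ⟨h1', h2', h3', h4'⟩ := hC'
  have hcont : Continuous (Fin.take n h : (Fin m → ℝ≥0) → (Fin n → ℝ≥0)) :=
    continuous_pi fun i => continuous_apply _
  have hopen : RelOpen (A.toGraph.PolC s (fun i : Fin m => ρ.edge i)
      (C' ∩ Fin.take n h ⁻¹' C)) (A.toGraph.Pol m s fun i : Fin m => ρ.edge i) := by
    obtain ⟨U, hU, hUC⟩ := h2.exists_isOpen
    convert h2'.inter_isOpen (hU.preimage hcont) using 1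
    ext τ
    simp only [TimedGraph.PolC, Set.mem_inter_iff, Set.mem_preimage]
    rw [← and_assoc]
    refine and_congr_right fun hτ => ?_
    have h5 := A.toGraph.take_mem_Pol hτ.1 n h
    have h6 := Set.ext_iff.1 hUC (Fin.take n h τ)
    exact ⟨fun h7 => (h6.1 ⟨h5, h7⟩).1, fun h7 => (h6.2 ⟨h7, h5⟩).2⟩
  exact ⟨h1'.inter (hcont.measurable h1), hopen,
    A.thick_of_subset h3' (Set.inter_subset_inter_right _ Set.inter_subset_left)
      ⟨_, ρ.mem_Pol m, h4', h4⟩ hopen, h4', h4⟩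

theorem BasicNhd.inter {ρ : A.toGraph.Run s} {n m : ℕ} {C : Set (Fin n → ℝ≥0)}
    {C' : Set (Fin m → ℝ≥0)} (hC : A.BasicNhd ρ n C) (hC' : A.BasicNhd ρ m C') :
    ∃ k C'', A.BasicNhd ρ k C'' ∧ A.toGraph.Cyl s (fun i : Fin k => ρ.edge i) C'' ⊆
      A.toGraph.Cyl s (fun i : Fin n => ρ.edge i) C ∩
      A.toGraph.Cyl s (fun i : Fin m => ρ.edge i) C' := by
  rcases le_total n m with h | h
  · exact ⟨m, _, hC.inter_of_le hC' h, fun ρ' h' =>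
      ⟨⟨fun i => h'.1 (Fin.castLE h i), h'.2.2⟩, h'.1, h'.2.1⟩⟩
  · exact ⟨n, _, hC'.inter_of_le hC h, fun ρ' h' =>
      ⟨⟨h'.1, h'.2.1⟩, fun i => h'.1 (Fin.castLE h i), h'.2.2⟩⟩

/-- The topology is defined by generators; that these behave like a basis is the stability of thick
cylinders under finite intersection. -/
theorem exists_basicNhd {O : Set (A.toGraph.Run s)} (hO : IsOpen O) {ρ : A.toGraph.Run s}
    (hρ : ρ ∈ O) : ∃ n C, A.BasicNhd ρ n C ∧
      A.toGraph.Cyl s (fun i : Fin n => ρ.edge i) C ⊆ O := by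
  obtain ⟨_, ⟨F, ⟨hF, hsub⟩, rfl⟩, hρF, hFO⟩ :=
    (TopologicalSpace.isTopologicalBasis_of_subbasis rfl).exists_subset_of_mem_open hρ hO
  suffices h : ∃ n C, A.BasicNhd ρ n C ∧
      A.toGraph.Cyl s (fun i : Fin n => ρ.edge i) C ⊆ ⋂₀ F by
    obtain ⟨n, C, h1, h2⟩ := h
    exact ⟨n, C, h1, h2.trans hFO⟩
  clear hFO
  replace hρF : ρ ∈ ⋂₀ F := hρF
  induction F, hF using Set.Finite.induction_on with
  | empty =>
    refine ⟨0, Set.univ, ⟨MeasurableSet.univ, ?_, ?_, trivial⟩, by simp⟩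
    · rw [TimedGraph.PolC_univ]
      exact RelOpen.self _
    · rintro ⟨i, hi, -⟩
      omega
  | @insert S F _ _ ih =>
    rw [Set.sInter_insert] at hρF ⊢
    obtain ⟨n, C, hC, hCF⟩ := ih ((Set.subset_insert _ _).trans hsub) hρF.2
    rcases hsub (Set.mem_insert S F) with rfl | rfl | ⟨m, e, C', h1, h2, ⟨U, hU, hUC⟩, rfl⟩
    · exact ⟨n, C, hC, by simpa using hCF⟩
    · exact absurd hρF.1 (Set.notMem_empty _)
    · obtain rfl : (fun i : Fin m => ρ.edge i) = e := funext hρF.1.1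
      have hC' : A.BasicNhd ρ m C' := ⟨h2, hUC ▸ IsOpen.relOpen hU _, h1, hρF.1.2⟩
      obtain ⟨k, C'', h3, h4⟩ := hC'.inter hC
      exact ⟨k, C'', h3, h4.trans (Set.inter_subset_inter_right _ hCF)⟩

end TimedAutomaton

/-! ### Cylinders inside a region path with thick edges -/

section GoodCyl

variable {L X E L' X' E' : Type*} {A : TimedAutomaton L X E} {D : TimedAutomaton L' X' E'}
  {p : State (L' × D.Region) X' → State L X} {h : D.RegionEdge → E}
  {σ₀ : State (L' × D.Region) X'}

variable (A p h σ₀) in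
/-- The constraint `C` is relatively open and nonempty, and all runs that satisfy it follow the
region path `f`, whose edges are not thin. -/
structure GoodCyl {n : ℕ} (f : Fin n → D.RegionEdge) (C : Set (Fin n → ℝ≥0)) : Prop where
  meas : MeasurableSet C
  relOpen : RelOpen (A.toGraph.PolC (p σ₀) (h ∘ f) C) (A.toGraph.Pol n (p σ₀) (h ∘ f))
  nonempty : (A.toGraph.PolC (p σ₀) (h ∘ f) C).Nonempty
  sub : A.toGraph.PolC (p σ₀) (h ∘ f) C ⊆ D.regionAutomaton.Pol n σ₀ f
  notThin : ∀ i, ¬ (f i).Thin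

theorem GoodCyl.inter_isOpen {n : ℕ} {f : Fin n → D.RegionEdge} {C : Set (Fin n → ℝ≥0)}
    (hC : GoodCyl A p h σ₀ f C) {O : Set (Fin n → ℝ≥0)} (hO : IsOpen O)
    (hne : (A.toGraph.PolC (p σ₀) (h ∘ f) C ∩ O).Nonempty) : GoodCyl A p h σ₀ f (C ∩ O) := by
  have heq : A.toGraph.PolC (p σ₀) (h ∘ f) (C ∩ O) = A.toGraph.PolC (p σ₀) (h ∘ f) C ∩ O :=
    (Set.inter_assoc _ _ _).symm
  refine ⟨hC.meas.inter hO.measurableSet, ?_, ?_, ?_, hC.notThin⟩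
  · rw [heq]
    exact hC.relOpen.inter_isOpen hO
  · rwa [heq]
  · rw [heq]
    exact Set.inter_subset_left.trans hC.sub

theorem goodCyl_zero (f : Fin 0 → D.RegionEdge) : GoodCyl A p h σ₀ f Set.univ where
  meas := MeasurableSet.univ
  relOpen := by rw [TimedGraph.PolC_univ]; exact RelOpen.self _
  nonempty := ⟨fun i => i.elim0, trivial, trivial⟩
  sub _ _ := trivial
  notThin i := i.elim0

theorem GoodCyl.exists_run {n : ℕ} {f : Fin n → D.RegionEdge} {C : Set (Fin n → ℝ≥0)}
    (hC : GoodCyl A p h σ₀ f C) (hb : A.NonBlocking) (hv : A.IsState (p σ₀)) :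
    (A.toGraph.Cyl (p σ₀) (h ∘ f) C).Nonempty := by
  obtain ⟨τ, hτ, hτC⟩ := hC.nonempty
  obtain ⟨ρ, h1, h2⟩ := A.toGraph.exists_run hb hv hτ
  refine ⟨ρ, h2, ?_⟩
  rwa [show (fun i : Fin n => ρ.delay i) = τ from funext h1]

theorem GoodCyl.mem_PolC {n : ℕ} {f : Fin n → D.RegionEdge} {C : Set (Fin n → ℝ≥0)}
    {ρ : A.toGraph.Run (p σ₀)} (hρ : ρ ∈ A.toGraph.Cyl (p σ₀) (h ∘ f) C) :
    (fun i : Fin n => ρ.delay i) ∈ A.toGraph.PolC (p σ₀) (h ∘ f) C := by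
  refine ⟨?_, hρ.2⟩
  rw [show h ∘ f = fun i : Fin n => ρ.edge i from funext fun i => (hρ.1 i).symm]
  exact ρ.mem_Pol n

theorem GoodCyl.run_edge (H : Lifts A.toGraph D.regionAutomaton p h D.Consistent)
    (hσ : σ₀ ∈ D.Consistent) {n : ℕ} {f : Fin n → D.RegionEdge} {C : Set (Fin n → ℝ≥0)}
    (hC : GoodCyl A p h σ₀ f C) {ρ : A.toGraph.Run (p σ₀)}
    (hρ : ρ ∈ A.toGraph.Cyl (p σ₀) (h ∘ f) C) (i : Fin n) : (H.run hσ rfl ρ).edge i = f i :=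
  (H.run_edge_eq_iff hσ rfl f ρ).2 ⟨hρ.1, hC.sub (GoodCyl.mem_PolC hρ)⟩ i

variable [Finite L'] [Finite X'] [Finite E']

theorem GoodCyl.isOpen (H : Lifts A.toGraph D.regionAutomaton p h D.Consistent)
    (hσ : σ₀ ∈ D.Consistent) {n : ℕ} {f : Fin n → D.RegionEdge} {C : Set (Fin n → ℝ≥0)}
    (hC : GoodCyl A p h σ₀ f C) : IsOpen (A.toGraph.Cyl (p σ₀) (h ∘ f) C) := by
  refine TopologicalSpace.isOpen_generateFrom_of_mem (Or.inr (Or.inr ⟨n, h ∘ f, C, ?_, hC.meas,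
    hC.relOpen.exists_isOpen, rfl⟩))
  exact (thick_iff_forall_not_thin H hσ hC.relOpen hC.nonempty hC.sub).2 hC.notThin

/-- Every nonempty open set contains a good cylinder. -/
theorem exists_goodCyl (H : Lifts A.toGraph D.regionAutomaton p h D.Consistent)
    (hσ : σ₀ ∈ D.Consistent) {O : Set (A.toGraph.Run (p σ₀))} (hO : IsOpen O)
    (hne : O.Nonempty) : ∃ (n : ℕ) (f : Fin n → D.RegionEdge) (C : Set (Fin n → ℝ≥0)),
      GoodCyl A p h σ₀ f C ∧ A.toGraph.Cyl (p σ₀) (h ∘ f) C ⊆ O := by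
  obtain ⟨ρ, hρ⟩ := hne
  obtain ⟨n, C, ⟨h1, h2, h3, h4⟩, hCO⟩ := TimedAutomaton.exists_basicNhd hO hρ
  -- The finitely many cells over the same edges of `A` cover the constraint, so one of them
  -- contains a relative neighbourhood of one of its points.
  obtain ⟨⟨f, hf⟩, q, ⟨hq1, hq2⟩, hq3⟩ := exists_mem_nhdsWithin_of_cover
    (S := fun f : {f : Fin n → D.RegionEdge // h ∘ f = fun i : Fin n => ρ.edge i} =>
      D.regionAutomaton.Pol n σ₀ f.1)
    (fun f => TimedAutomaton.isLocallyClosed_cell hσ n f.1) h2 ⟨_, ρ.mem_Pol n, h4⟩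
    (fun τ hτ => by
      obtain ⟨f, hf, hτf⟩ := H.exists_Pol hσ hτ.1
      exact Set.mem_iUnion.2 ⟨⟨f, hf⟩, hτf⟩)
  change D.regionAutomaton.Pol n σ₀ f ∈ _ at hq3
  rw [← hf] at h2 h3 hq1 hq3 hCO
  obtain ⟨U, hU, hqU, hUS⟩ := mem_nhdsWithin.1 hq3
  have heq : A.toGraph.PolC (p σ₀) (h ∘ f) (C ∩ U) = A.toGraph.PolC (p σ₀) (h ∘ f) C ∩ U :=
    (Set.inter_assoc _ _ _).symm
  have hopen : RelOpen (A.toGraph.PolC (p σ₀) (h ∘ f) (C ∩ U))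
      (A.toGraph.Pol n (p σ₀) (h ∘ f)) := by
    rw [heq]
    exact h2.inter_isOpen hU
  have hne : (A.toGraph.PolC (p σ₀) (h ∘ f) (C ∩ U)).Nonempty := heq ▸ ⟨q, hq1, hqU⟩
  have hsub : A.toGraph.PolC (p σ₀) (h ∘ f) (C ∩ U) ⊆ D.regionAutomaton.Pol n σ₀ f :=
    fun τ hτ => hUS ⟨hτ.2.2, hτ.1⟩
  refine ⟨n, f, C ∩ U, ⟨h1.inter hU.measurableSet, hopen, hne, hsub, ?_⟩, fun ρ' hρ' =>
    hCO ⟨hρ'.1, hρ'.2.1⟩⟩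
  exact (thick_iff_forall_not_thin H hσ hopen hne hsub).1
    (A.thick_of_subset h3 (heq ▸ Set.inter_subset_left) hne hopen)

/-- A thick edge is followed in a neighbourhood. -/
theorem eventually_mem_cell_snoc (H : Lifts A.toGraph D.regionAutomaton p h D.Consistent)
    (hσ : σ₀ ∈ D.Consistent) {n : ℕ} {f : Fin n → D.RegionEdge} {g : D.RegionEdge}
    (hg : ¬ g.Thin) {q : Fin (n + 1) → ℝ≥0}
    (hq : q ∈ D.regionAutomaton.Pol (n + 1) σ₀ (Fin.snoc f g)) :
    ∀ᶠ τ : Fin (n + 1) → ℝ≥0 in 𝓝 q, Fin.init τ ∈ D.regionAutomaton.Pol n σ₀ f →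
      τ ∈ A.toGraph.Pol (n + 1) (p σ₀) (h ∘ Fin.snoc f g) →
      τ ∈ D.regionAutomaton.Pol (n + 1) σ₀ (Fin.snoc f g) := by
  by_cases hp : g.Punctual
  -- A punctual edge that is not thin competes with punctual edges only; then no competitor other
  -- than those with the same guard region is possible nearby.
  · have hall : ∀ g' : D.RegionEdge, g'.src = g.src → g'.Punctual := fun g' hg' => by
      by_contra hp'
      exact hg (TimedAutomaton.RegionEdge.thin_iff.2 ⟨hp, g', hg', hp'⟩)
    have hq' := (TimedAutomaton.mem_cell_succ hσ).1 hq
    simp only [Fin.init_snoc, Fin.snoc_last] at hq'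
    filter_upwards [(D.regionAutomaton.continuous_lastVal σ₀ f).continuousAt.eventually
      (TimedAutomaton.RegionEdge.eventually_of_punctual hall hq'.2.2)] with τ hτ hinit hA
    obtain ⟨f', hf', hτ'⟩ := H.exists_Pol hσ hA
    have h1 := (TimedAutomaton.mem_cell_succ hσ).1 hτ'
    have h2 : Fin.init f' = f := H.Pol_unique hσ h1.1 hinit (funext fun i => by
      have := congrFun hf' i.castSucc
      simpa [Fin.init] using this)
    rw [h2] at h1
    have hsrc : g.src = (D.regionAutomaton.endState n σ₀ (Fin.init τ) f).loc :=
      hq'.2.1.trans (D.regionAutomaton.endState_loc n σ₀ σ₀ rfl _ _ _)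
    refine (TimedAutomaton.mem_cell_succ hσ).2 ?_
    simp only [Fin.init_snoc, Fin.snoc_last]
    exact ⟨hinit, hsrc, hτ _ _ (f' (Fin.last n))
      (TimedAutomaton.region_endState_eq hσ hinit hq'.1) rfl (h1.2.1.trans hsrc.symm) h1.2.2⟩
  · have := TimedAutomaton.eventually_mem_cell_of_not_punctual hσ hq
      (by rwa [Fin.snoc_last])
    filter_upwards [this] with τ hτ hinit _
    exact hτ (by rwa [Fin.init_snoc])

/-- Good cylinders can be prolonged along thick edges. -/
theorem GoodCyl.extend (H : Lifts A.toGraph D.regionAutomaton p h D.Consistent)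
    (hσ : σ₀ ∈ D.Consistent) {n : ℕ} {f : Fin n → D.RegionEdge} {C : Set (Fin n → ℝ≥0)}
    (hC : GoodCyl A p h σ₀ f C) {g : D.RegionEdge} (hg : ¬ g.Thin)
    (hsrc : ∀ τ, g.src = (D.regionAutomaton.endState n σ₀ τ f).loc) :
    ∃ C', GoodCyl A p h σ₀ (Fin.snoc f g : Fin (n + 1) → D.RegionEdge) C' ∧
      A.toGraph.Cyl (p σ₀) (h ∘ (Fin.snoc f g : Fin (n + 1) → D.RegionEdge)) C' ⊆
        A.toGraph.Cyl (p σ₀) (h ∘ f) C := by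
  obtain ⟨τ, hτ⟩ := hC.nonempty
  obtain ⟨t, ht⟩ := TimedAutomaton.exists_mem_cell_snoc hσ (hC.sub hτ) (hsrc τ)
  obtain ⟨O, hO, hOo, hqO⟩ := mem_nhds_iff.1 (eventually_mem_cell_snoc H hσ hg ht)
  have hinit : ∀ τ : Fin (n + 1) → ℝ≥0,
      τ ∈ A.toGraph.Pol (n + 1) (p σ₀) (h ∘ (Fin.snoc f g : Fin (n + 1) → D.RegionEdge)) →
      Fin.init τ ∈ A.toGraph.Pol n (p σ₀) (h ∘ f) := fun τ hτ => by
    rw [Fin.comp_snoc] at hτ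
    exact (A.toGraph.mem_Pol_snoc.1 hτ).1
  obtain ⟨U, hU, hUC⟩ := hC.relOpen.exists_isOpen
  have heq : A.toGraph.PolC (p σ₀) (h ∘ (Fin.snoc f g : Fin (n + 1) → D.RegionEdge))
      (Fin.init ⁻¹' C ∩ O) = (Fin.init ⁻¹' U ∩ O) ∩
        A.toGraph.Pol (n + 1) (p σ₀) (h ∘ (Fin.snoc f g : Fin (n + 1) → D.RegionEdge)) := by
    ext τ
    have h6 := Set.ext_iff.1 hUC (Fin.init τ)
    constructor
    · rintro ⟨h1, h2, h3⟩
      exact ⟨⟨(h6.1 ⟨hinit τ h1, h2⟩).1, h3⟩, h1⟩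
    · rintro ⟨⟨h2, h3⟩, h1⟩
      exact ⟨h1, (h6.2 ⟨h2, hinit τ h1⟩).2, h3⟩
  refine ⟨Fin.init ⁻¹' C ∩ O, ⟨?_, ?_, ?_, ?_, ?_⟩, ?_⟩
  · exact (TimedGraph.continuous_init.measurable hC.meas).inter hOo.measurableSet
  · rw [heq]
    exact IsOpen.relOpen ((hU.preimage TimedGraph.continuous_init).inter hOo) _
  · refine ⟨_, H.Pol_subset hσ _ ht, ?_, hqO⟩
    rw [Set.mem_preimage, Fin.init_snoc]
    exact hτ.2
  · exact fun τ hτ => hO hτ.2.2 (hC.sub ⟨hinit τ hτ.1, hτ.2.1⟩) hτ.1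
  · exact fun i => Fin.lastCases (by simpa using hg) (fun i => by simpa using hC.notThin i) i
  · rintro ρ ⟨h1, h2, -⟩
    refine ⟨fun i => ?_, h2⟩
    have := h1 i.castSucc
    simpa using this

/-- The edges of a run of the region automaton that are not thin give good cylinders. -/
theorem exists_goodCyl_of_run (H : Lifts A.toGraph D.regionAutomaton p h D.Consistent)
    (hσ : σ₀ ∈ D.Consistent) (r : D.regionAutomaton.Run σ₀) (hr : ∀ i, ¬ (r.edge i).Thin)
    (n : ℕ) : ∃ C, GoodCyl A p h σ₀ (fun i : Fin n => r.edge i) C := by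
  induction n with
  | zero => exact ⟨_, goodCyl_zero _⟩
  | succ n ih =>
    obtain ⟨C, hC⟩ := ih
    obtain ⟨C', hC', -⟩ := hC.extend H hσ (hr n) (fun τ => (r.isRun n).1.trans
      ((congrArg State.loc (D.regionAutomaton.endState_restrict σ₀ r.delay r.edge n)).symm.trans
        (D.regionAutomaton.endState_loc n σ₀ σ₀ rfl _ _ _)))
    refine ⟨C', ?_⟩
    convert hC' using 1
    funext i
    exact Fin.lastCases (by simp) (fun i => by simp) i

end GoodCyl

/-! ### Baire category in the space of runs -/

section Category

variable {L X E L' X' E' : Type*} {A : TimedAutomaton L X E} {D : TimedAutomaton L' X' E'}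
  {p : State (L' × D.Region) X' → State L X} {h : D.RegionEdge → E}
  {σ₀ : State (L' × D.Region) X'}

variable (A p h σ₀) in
/-- A cylinder inside a region path with thick edges. -/
structure ThickCyl where
  len : ℕ
  path : Fin len → D.RegionEdge
  con : Set (Fin len → ℝ≥0)
  good : GoodCyl A p h σ₀ path con

namespace ThickCyl

/-- The runs in a cylinder. -/
def runs (c : ThickCyl A p h σ₀) : Set (A.toGraph.Run (p σ₀)) :=
  A.toGraph.Cyl (p σ₀) (h ∘ c.path) c.con

/-- The location of the region automaton at the end of a cylinder. -/
noncomputable def target (c : ThickCyl A p h σ₀) : L' × D.Region :=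
  (D.regionAutomaton.endState c.len σ₀ (fun _ => 0) c.path).loc

theorem runs_nonempty (hb : A.NonBlocking) (hv : A.IsState (p σ₀)) (c : ThickCyl A p h σ₀) :
    c.runs.Nonempty := c.good.exists_run hb hv

theorem run_edge (H : Lifts A.toGraph D.regionAutomaton p h D.Consistent)
    (hσ : σ₀ ∈ D.Consistent) (c : ThickCyl A p h σ₀) {ρ : A.toGraph.Run (p σ₀)}
    (hρ : ρ ∈ c.runs) {i : ℕ} (hi : i < c.len) : (H.run hσ rfl ρ).edge i = c.path ⟨i, hi⟩ :=
  GoodCyl.run_edge H hσ c.good hρ ⟨i, hi⟩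

theorem not_thin (H : Lifts A.toGraph D.regionAutomaton p h D.Consistent)
    (hσ : σ₀ ∈ D.Consistent) (c : ThickCyl A p h σ₀) {ρ : A.toGraph.Run (p σ₀)}
    (hρ : ρ ∈ c.runs) {i : ℕ} (hi : i < c.len) : ¬ ((H.run hσ rfl ρ).edge i).Thin := by
  rw [c.run_edge H hσ hρ hi]
  exact c.good.notThin _

theorem src_edge_len (H : Lifts A.toGraph D.regionAutomaton p h D.Consistent)
    (hσ : σ₀ ∈ D.Consistent) (c : ThickCyl A p h σ₀) {ρ : A.toGraph.Run (p σ₀)}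
    (hρ : ρ ∈ c.runs) : ((H.run hσ rfl ρ).edge c.len).src = c.target := by
  refine ((H.run hσ rfl ρ).isRun c.len).1.trans ?_
  rw [← D.regionAutomaton.endState_restrict, target]
  rw [show (fun i : Fin c.len => (H.run hσ rfl ρ).edge i) = c.path from
    funext fun i => c.run_edge H hσ hρ i.2]
  exact D.regionAutomaton.endState_loc _ _ _ rfl _ _ _

variable [Finite L'] [Finite X'] [Finite E']

theorem isOpen_runs (H : Lifts A.toGraph D.regionAutomaton p h D.Consistent)
    (hσ : σ₀ ∈ D.Consistent) (c : ThickCyl A p h σ₀) : IsOpen c.runs := c.good.isOpen H hσ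

theorem exists_runs_subset (H : Lifts A.toGraph D.regionAutomaton p h D.Consistent)
    (hσ : σ₀ ∈ D.Consistent) {O : Set (A.toGraph.Run (p σ₀))} (hO : IsOpen O)
    (hne : O.Nonempty) : ∃ c : ThickCyl A p h σ₀, c.runs ⊆ O := by
  obtain ⟨n, f, C, hC, hsub⟩ := exists_goodCyl H hσ hO hne
  exact ⟨⟨n, f, C, hC⟩, hsub⟩

theorem extend (H : Lifts A.toGraph D.regionAutomaton p h D.Consistent)
    (hσ : σ₀ ∈ D.Consistent) (c : ThickCyl A p h σ₀) {g : D.RegionEdge} (hg : ¬ g.Thin)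
    (hsrc : g.src = c.target) : ∃ c' : ThickCyl A p h σ₀, c'.runs ⊆ c.runs ∧
      c'.len = c.len + 1 ∧ c'.target = g.tgt ∧
      ∀ ρ ∈ c'.runs, (H.run hσ rfl ρ).edge c.len = g := by
  obtain ⟨C', hC', hsub⟩ := c.good.extend H hσ hg fun τ => hsrc.trans
    (D.regionAutomaton.endState_loc _ _ _ rfl _ _ _)
  refine ⟨⟨c.len + 1, Fin.snoc c.path g, C', hC'⟩, hsub, rfl, ?_, fun ρ hρ => ?_⟩
  · rw [target, TimedGraph.endState_succ]
    simp only [Fin.snoc_last]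
    rfl
  · have := GoodCyl.run_edge H hσ hC' hρ (Fin.last c.len)
    rwa [Fin.snoc_last] at this

/-- Non-blocking provides a run in the cylinder. Its next edge either is not thin, or has a
non-punctual competitor, which is never thin. -/
theorem exists_src_eq_target (H : Lifts A.toGraph D.regionAutomaton p h D.Consistent)
    (hσ : σ₀ ∈ D.Consistent) (hb : A.NonBlocking) (hv : A.IsState (p σ₀))
    (c : ThickCyl A p h σ₀) : ∃ g : D.RegionEdge, ¬ g.Thin ∧ g.src = c.target := by
  obtain ⟨ρ, hρ⟩ := c.runs_nonempty hb hv
  have hsrc := c.src_edge_len H hσ hρ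
  by_cases hg : ((H.run hσ rfl ρ).edge c.len).Thin
  · obtain ⟨-, g, hg1, hg2⟩ := TimedAutomaton.RegionEdge.thin_iff.1 hg
    exact ⟨g, fun h1 => hg2 (TimedAutomaton.RegionEdge.thin_iff.1 h1).1, hg1.trans hsrc⟩
  · exact ⟨_, hg, hsrc⟩

theorem lengthen (H : Lifts A.toGraph D.regionAutomaton p h D.Consistent)
    (hσ : σ₀ ∈ D.Consistent) (hb : A.NonBlocking) (hv : A.IsState (p σ₀))
    (c : ThickCyl A p h σ₀) (m : ℕ) :
    ∃ c' : ThickCyl A p h σ₀, c'.runs ⊆ c.runs ∧ m ≤ c'.len := by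
  induction m with
  | zero => exact ⟨c, subset_rfl, Nat.zero_le _⟩
  | succ m ih =>
    obtain ⟨c', h1, h2⟩ := ih
    obtain ⟨g, hg, hsrc⟩ := c'.exists_src_eq_target H hσ hb hv
    obtain ⟨c'', h3, h4, -⟩ := c'.extend H hσ hg hsrc
    exact ⟨c'', h3.trans h1, by omega⟩

end ThickCyl

namespace TimedAutomaton

variable (D) in
/-- One location is reached from another by a thick edge of the region automaton. -/
def ThickStep (q q' : L' × D.Region) : Prop :=
  ∃ g : D.RegionEdge, ¬ g.Thin ∧ g.src = q ∧ g.tgt = q'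

theorem src_succ_eq_tgt (r : D.regionAutomaton.Run σ₀) (i : ℕ) :
    (r.edge (i + 1)).src = (r.edge i).tgt := (r.isRun (i + 1)).1

theorem reflTransGen_thickStep (r : D.regionAutomaton.Run σ₀) {m n : ℕ} (hmn : m ≤ n)
    (hr : ∀ i, m ≤ i → ¬ (r.edge i).Thin) :
    Relation.ReflTransGen D.ThickStep (r.edge m).src (r.edge n).src := by
  induction n, hmn using Nat.le_induction with
  | base => exact .refl
  | succ n hn ih => exact ih.tail ⟨r.edge n, hr n hn, rfl, (src_succ_eq_tgt r n).symm⟩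

end TimedAutomaton

section

variable [Finite L'] [Finite X'] [Finite E']
  (H : Lifts A.toGraph D.regionAutomaton p h D.Consistent)
  (hσ : σ₀ ∈ D.Consistent) (hb : A.NonBlocking) (hv : A.IsState (p σ₀))

theorem ThickCyl.reach (H : Lifts A.toGraph D.regionAutomaton p h D.Consistent)
    (hσ : σ₀ ∈ D.Consistent) (c : ThickCyl A p h σ₀) {q : L' × D.Region}
    (hq : Relation.ReflTransGen D.ThickStep c.target q) :
    ∃ c' : ThickCyl A p h σ₀, c'.runs ⊆ c.runs ∧ c.len ≤ c'.len ∧ c'.target = q := by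
  induction hq with
  | refl => exact ⟨c, subset_rfl, le_rfl, rfl⟩
  | tail _ hs ih =>
    obtain ⟨c', h1, h2, h3⟩ := ih
    obtain ⟨g, hg, hgs, hgt⟩ := hs
    obtain ⟨c'', h4, h5, h6, -⟩ := c'.extend H hσ hg (hgs.trans h3.symm)
    exact ⟨c'', h4.trans h1, by omega, h6.trans hgt⟩

include H hσ hb hv

/-- Thick cylinders are open, nonempty and found inside every nonempty open set, so it suffices to
test density on them. -/
theorem isNowhereDense_of_forall_thickCyl {N : Set (A.toGraph.Run (p σ₀))}
    (hN : ∀ c : ThickCyl A p h σ₀, ∃ c' : ThickCyl A p h σ₀,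
      c'.runs ⊆ c.runs ∧ Disjoint c'.runs N) : IsNowhereDense N := by
  rw [IsNowhereDense, ← Set.not_nonempty_iff_eq_empty]
  intro hne
  obtain ⟨c, hc⟩ := ThickCyl.exists_runs_subset H hσ isOpen_interior hne
  obtain ⟨c', hc', hd⟩ := hN c
  obtain ⟨ρ, hρ⟩ := c'.runs_nonempty hb hv
  exact (hd.closure_right (c'.isOpen_runs H hσ)).le_bot
    ⟨hρ, interior_subset (hc (hc' hρ))⟩

theorem isNowhereDense_thin (n : ℕ) :
    IsNowhereDense {ρ : A.toGraph.Run (p σ₀) | ((H.run hσ rfl ρ).edge n).Thin} := by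
  refine isNowhereDense_of_forall_thickCyl H hσ hb hv fun c => ?_
  obtain ⟨c', h1, h2⟩ := c.lengthen H hσ hb hv (n + 1)
  exact ⟨c', h1, Set.disjoint_left.2 fun ρ hρ => c'.not_thin H hσ hρ h2⟩

theorem isNowhereDense_unfair {g : D.RegionEdge} (hg : ¬ g.Thin) (N : ℕ) :
    IsNowhereDense {ρ : A.toGraph.Run (p σ₀) | (∀ i, ¬ ((H.run hσ rfl ρ).edge i).Thin) ∧
      (∃ᶠ i in atTop, g.src = ((H.run hσ rfl ρ).edge i).src) ∧
      ∀ i ≥ N, (H.run hσ rfl ρ).edge i ≠ g} := by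
  refine isNowhereDense_of_forall_thickCyl H hσ hb hv fun c => ?_
  obtain ⟨c₁, h1, h2⟩ := c.lengthen H hσ hb hv N
  -- Either the cylinder already avoids the set, or one of its runs shows that the source of `g` is
  -- reachable from its target by thick edges; in that case it can be prolonged to this source and
  -- then along `g`, at an index that is at least `N`.
  by_cases hd : Disjoint c₁.runs {ρ : A.toGraph.Run (p σ₀) |
    (∀ i, ¬ ((H.run hσ rfl ρ).edge i).Thin) ∧
      (∃ᶠ i in atTop, g.src = ((H.run hσ rfl ρ).edge i).src) ∧
      ∀ i ≥ N, (H.run hσ rfl ρ).edge i ≠ g}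
  · exact ⟨c₁, h1, hd⟩
  obtain ⟨ρ, hρ, h3, h4, -⟩ := Set.not_disjoint_iff.1 hd
  obtain ⟨i, hi, hgi⟩ := frequently_atTop.1 h4 c₁.len
  have hreach := TimedAutomaton.reflTransGen_thickStep (H.run hσ rfl ρ) hi fun j _ => h3 j
  rw [c₁.src_edge_len H hσ hρ, ← hgi] at hreach
  obtain ⟨c₂, h5, h6, h7⟩ := c₁.reach H hσ hreach
  obtain ⟨c₃, h8, -, -, h9⟩ := c₂.extend H hσ hg h7.symm
  exact ⟨c₃, h8.trans (h5.trans h1), Set.disjoint_left.2 fun ρ' hρ' h10 =>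
    h10.2.2 c₂.len (h2.trans h6) (h9 ρ' hρ')⟩

/-- Outside a meagre set, runs follow fair region paths with thick edges. -/
theorem isMeagre_thin_or_unfair :
    IsMeagre {ρ : A.toGraph.Run (p σ₀) | ¬ ((∀ i, ¬ ((H.run hσ rfl ρ).edge i).Thin) ∧
      TimedAutomaton.FairPath (H.run hσ rfl ρ).edge)} := by
  have hm : ∀ x : {g : D.RegionEdge // ¬ g.Thin} × ℕ,
      IsMeagre {ρ : A.toGraph.Run (p σ₀) | (∀ i, ¬ ((H.run hσ rfl ρ).edge i).Thin) ∧
      (∃ᶠ i in atTop, x.1.1.src = ((H.run hσ rfl ρ).edge i).src) ∧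
      ∀ i ≥ x.2, (H.run hσ rfl ρ).edge i ≠ x.1.1} := fun x =>
    (isNowhereDense_unfair H hσ hb hv x.1.2 x.2).isMeagre
  refine IsMeagre.mono ?_ ((isMeagre_iUnion fun n =>
    (isNowhereDense_thin H hσ hb hv n).isMeagre).union (isMeagre_iUnion hm))
  intro ρ hρ
  by_cases h1 : ∀ i, ¬ ((H.run hσ rfl ρ).edge i).Thin
  · right
    have h2 : ¬ TimedAutomaton.FairPath (H.run hσ rfl ρ).edge := fun h2 => hρ ⟨h1, h2⟩
    simp only [TimedAutomaton.FairPath, not_forall] at h2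
    obtain ⟨g, hg, h3, h4⟩ := h2
    rw [not_frequently, eventually_atTop] at h4
    obtain ⟨N, hN⟩ := h4
    exact Set.mem_iUnion.2 ⟨(⟨g, hg⟩, N), h1, h3, hN⟩
  · left
    push Not at h1
    exact Set.mem_iUnion.2 h1

/-- One round of the Baire argument. The compact set makes limits of delays still satisfy the guards
and the constraint of `c`, as cells need not be closed. -/
theorem ThickCyl.exists_compact_avoiding (c : ThickCyl A p h σ₀)
    {N : Set (A.toGraph.Run (p σ₀))} (hN : IsNowhereDense N) :
    ∃ (c' : ThickCyl A p h σ₀) (K : Set (Fin c.len → ℝ≥0)), c'.runs ⊆ c.runs ∧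
      Disjoint c'.runs N ∧ c.len < c'.len ∧ IsCompact K ∧
      K ⊆ A.toGraph.PolC (p σ₀) (h ∘ c.path) c.con ∧
      ∀ ρ ∈ c'.runs, (fun i : Fin c.len => ρ.delay i) ∈ K := by
  obtain ⟨q, hq⟩ := c.good.nonempty
  obtain ⟨U, hU, hUC⟩ := (c.good.relOpen.mono c.good.sub (H.Pol_subset hσ c.path)).exists_isOpen
  obtain ⟨V, Z, hV, hZ, hVZ⟩ := TimedAutomaton.isLocallyClosed_cell hσ c.len c.path
  have heq : A.toGraph.PolC (p σ₀) (h ∘ c.path) c.con = (U ∩ V) ∩ Z := by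
    rw [hUC, hVZ, Set.inter_assoc]
  -- The constraint is an open set intersected with the closed set `Z`; a compact set inside the
  -- open part, cut by `Z`, stays within the constraint.
  obtain ⟨K, hK, hqK, hKUV⟩ := exists_compact_subset (hU.inter hV) (heq ▸ hq).1
  let c₁ : ThickCyl A p h σ₀ := ⟨c.len, c.path, c.con ∩ interior K,
    c.good.inter_isOpen isOpen_interior ⟨q, hq, hqK⟩⟩
  have hne : (c₁.runs \ closure N).Nonempty := by
    rw [Set.sdiff_nonempty]
    intro hsub
    obtain ⟨ρ, hρ⟩ := c₁.runs_nonempty hb hv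
    have := (c₁.isOpen_runs H hσ).subset_interior_iff.2 hsub hρ
    rw [hN] at this
    exact this
  obtain ⟨c₂, h2⟩ := ThickCyl.exists_runs_subset H hσ
    ((c₁.isOpen_runs H hσ).sdiff isClosed_closure) hne
  obtain ⟨c₃, h3, h4⟩ := c₂.lengthen H hσ hb hv (c.len + 1)
  refine ⟨c₃, K ∩ Z, fun ρ hρ => ?_, Set.disjoint_left.2 fun ρ hρ hρN =>
    (h2 (h3 hρ)).2 (subset_closure hρN), h4, hK.inter_right hZ, fun τ hτ => ?_, fun ρ hρ => ?_⟩
  · have := (h2 (h3 hρ)).1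
    exact ⟨this.1, this.2.1⟩
  · rw [heq]
    exact ⟨hKUV hτ.1, hτ.2⟩
  · have hc₁ := (h2 (h3 hρ)).1
    have h5 := GoodCyl.mem_PolC (C := c.con) ⟨hc₁.1, hc₁.2.1⟩
    rw [heq] at h5
    exact ⟨interior_subset hc₁.2.2, h5.2⟩

/-- Cylinders inside region paths with thick edges are not meagre. -/
theorem ThickCyl.not_isMeagre (c : ThickCyl A p h σ₀) : ¬ IsMeagre c.runs := by
  intro hm
  obtain ⟨N, hN, hcN⟩ : ∃ N : ℕ → Set (A.toGraph.Run (p σ₀)),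
      (∀ n, IsNowhereDense (N n)) ∧ c.runs ⊆ ⋃ n, N n := by
    obtain ⟨S, hS, hSc, hsub⟩ := isMeagre_iff_countable_union_isNowhereDense.1 hm
    -- The empty set is added so that there is something to enumerate.
    obtain ⟨N, hN⟩ := (hSc.insert ∅).exists_eq_range (Set.insert_nonempty _ _)
    refine ⟨N, fun n => ?_, fun ρ hρ => ?_⟩
    · rcases (hN ▸ Set.mem_range_self n : N n ∈ insert ∅ S) with h1 | h1
      · rw [h1]
        exact isNowhereDense_empty
      · exact hS _ h1
    · obtain ⟨T, hT, hρT⟩ := hsub hρ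
      obtain ⟨n, rfl⟩ := (hN ▸ Set.mem_insert_of_mem _ hT : T ∈ Set.range N)
      exact Set.mem_iUnion.2 ⟨n, hρT⟩
  choose! next K h1 h2 h3 h4 h5 h6 using fun (n : ℕ) (c : ThickCyl A p h σ₀) =>
    c.exists_compact_avoiding H hσ hb hv (hN n)
  let cs : ℕ → ThickCyl A p h σ₀ := fun n => Nat.rec c (fun n c => next n c) n
  have hanti : ∀ {m n}, m ≤ n → (cs n).runs ⊆ (cs m).runs := fun {m n} hmn => by
    induction n, hmn using Nat.le_induction with
    | base => exact subset_rfl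
    | succ n _ ih => exact (h1 n (cs n)).trans ih
  have hlen : ∀ n, n ≤ (cs n).len := fun n => by
    induction n with
    | zero => exact Nat.zero_le _
    | succ n ih => exact ih.trans_lt (h3 n (cs n))
  choose ρ hρ using fun n => (cs n).runs_nonempty hb hv
  -- One free ultrafilter serves all prefix lengths at once, so the limits for different `n` agree
  -- without a diagonal argument.
  have hlim : ∀ n, ∃ q ∈ K n (cs n),
      Tendsto (fun m (i : Fin (cs n).len) => (ρ m).delay i) (hyperfilter ℕ) (𝓝 q) := fun n => by
    have hev : ∀ᶠ m in hyperfilter ℕ, (fun i : Fin (cs n).len => (ρ m).delay i) ∈ K n (cs n) := by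
      refine Nat.hyperfilter_le_atTop ?_
      filter_upwards [eventually_ge_atTop (n + 1)] with m hm
      exact h6 n (cs n) _ (hanti hm (hρ m))
    obtain ⟨q, hq, hle⟩ := (h4 n (cs n)).ultrafilter_le_nhds
      ((hyperfilter ℕ).map fun m (i : Fin (cs n).len) => (ρ m).delay i) (by
        rw [Ultrafilter.coe_map, le_principal_iff]
        exact hev)
    exact ⟨q, hq, hle⟩
  choose q hq hqlim using hlim
  let t : ℕ → ℝ≥0 := fun i => q (i + 1) ⟨i, hlen (i + 1)⟩
  have ht : ∀ n, (fun i : Fin (cs n).len => t i) = q n := fun n => funext fun i =>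
    tendsto_nhds_unique ((tendsto_pi_nhds.1 (hqlim (i + 1))) ⟨i, hlen (i + 1)⟩)
      ((tendsto_pi_nhds.1 (hqlim n)) i)
  let e : ℕ → D.RegionEdge := fun i => (cs (i + 1)).path ⟨i, hlen (i + 1)⟩
  have he : ∀ n, (fun i : Fin (cs n).len => e i) = (cs n).path := fun n => funext fun i => by
    have hk := hρ (max n (i + 1))
    have e1 := (cs n).run_edge H hσ (hanti (le_max_left _ _) hk) i.2
    have e2 := (cs (i + 1)).run_edge H hσ (hanti (le_max_right _ _) hk) (hlen (i + 1))
    exact e2.symm.trans e1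
  have hmem : ∀ n, (fun i : Fin (cs n).len => t i) ∈
      A.toGraph.PolC (p σ₀) (fun i : Fin (cs n).len => h (e i)) (cs n).con := fun n => by
    have h7 : (fun i : Fin (cs n).len => h (e i)) = h ∘ (cs n).path := by
      rw [← he n]
      rfl
    rw [ht, h7]
    exact h5 n (cs n) (hq n)
  -- The run assembled from the limit delays and the common edges lies in every `cs n`; as `cs (n +
  -- 1)` avoids `N n`, it belongs to none of the nowhere dense sets.
  let r : A.toGraph.Run (p σ₀) := ⟨t, fun i => h (e i), fun i =>
    (A.toGraph.restrict_mem_Pol (e := fun i => h (e i))).1 (hmem (i + 1)).1 i (hlen (i + 1))⟩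
  have hr : ∀ n, r ∈ (cs n).runs := fun n =>
    ⟨fun i => congrArg h (congrFun (he n) i), (hmem n).2⟩
  obtain ⟨n, hn⟩ := Set.mem_iUnion.1 (hcN (hr 0))
  exact Set.disjoint_left.1 (h2 n (cs n)) (hr (n + 1)) hn

/-- The runs that start along given thick edges of the region automaton are not meagre. -/
theorem not_isMeagre_of_run (r : D.regionAutomaton.Run σ₀) (hr : ∀ i, ¬ (r.edge i).Thin)
    (n : ℕ) : ¬ IsMeagre {ρ : A.toGraph.Run (p σ₀) |
      ∀ i < n, (H.run hσ rfl ρ).edge i = r.edge i} := by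
  obtain ⟨C, hC⟩ := exists_goodCyl_of_run H hσ r hr n
  let c : ThickCyl A p h σ₀ := ⟨n, _, C, hC⟩
  intro hm
  refine c.not_isMeagre H hσ hb hv (IsMeagre.mono ?_ hm)
  exact fun ρ hρ i hi => c.run_edge H hσ hρ hi

end

end Category

/-! ### The distribution of the sequence of steps -/

namespace StochasticTA

variable {L X E : Type*} (A : StochasticTA L X E)

theorem stateAfter_congr (s : State L X) {x y : ℕ → ℝ≥0 × Outcome E} {n : ℕ}
    (h : ∀ i < n, x i = y i) : A.stateAfter s x n = A.stateAfter s y n := by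
  induction n with
  | zero => rfl
  | succ n ih =>
    rw [stateAfter, stateAfter, ih fun i hi => h i (hi.trans n.lt_succ_self), h n n.lt_succ_self]

/-- A function of sequences depends on the first `n` terms only. -/
def DependsOnFirst {Y Z : Type*} (n : ℕ) (f : (ℕ → Y) → Z) : Prop :=
  ∀ x y : ℕ → Y, (∀ i < n, x i = y i) → f x = f y

theorem measurable_update_prod {Y : Type*} [MeasurableSpace Y] (n : ℕ) :
    Measurable fun q : (ℕ → Y) × Y => Function.update q.1 n q.2 := by
  refine measurable_pi_lambda _ fun i => ?_
  by_cases h : i = n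
  · subst h
    simpa using measurable_snd
  · simp only [Function.update_of_ne h]
    exact (measurable_pi_apply i).comp measurable_fst

theorem indicator_one_congr {Y Z : Type*} {S : Set Y} {T : Set Z} {a : Y} {b : Z}
    (h : a ∈ S ↔ b ∈ T) : S.indicator (1 : Y → ℝ≥0∞) a = T.indicator (1 : Z → ℝ≥0∞) b := by
  by_cases ha : a ∈ S
  · rw [Set.indicator_of_mem ha, Set.indicator_of_mem (h.1 ha)]
    rfl
  · rw [Set.indicator_of_notMem ha, Set.indicator_of_notMem fun hb => ha (h.2 hb)]

variable [Finite E]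

/-- The law `ν` of a sequence of steps from `s` has the conditional distributions prescribed by
`stepKernel`. -/
def IsStepLaw (s : State L X) (ν : Measure (ℕ → ℝ≥0 × Outcome E)) : Prop :=
  ∀ (n : ℕ) (f : (ℕ → ℝ≥0 × Outcome E) → ℝ≥0∞), Measurable f → DependsOnFirst (n + 1) f →
    ∫⁻ x, f x ∂ν = ∫⁻ x, ∫⁻ y, f (Function.update x n y) ∂A.stepKernel (A.stateAfter s x n) ∂ν

theorem measurable_lintegral_step (s : State L X) (n : ℕ) {f : (ℕ → ℝ≥0 × Outcome E) → ℝ≥0∞}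
    (hf : Measurable f) : Measurable fun x : ℕ → ℝ≥0 × Outcome E =>
      ∫⁻ y, f (Function.update x n y) ∂A.stepKernel (A.stateAfter s x n) := by
  have h1 : Measurable fun q : (ℕ → ℝ≥0 × Outcome E) × (ℝ≥0 × Outcome E) =>
      f (Function.update q.1 n q.2) := hf.comp (measurable_update_prod n)
  exact h1.lintegral_kernel_prod_right'
    (κ := A.stepKernel.comap (fun x => A.stateAfter s x n) (A.measurable_stateAfter s n))

theorem dependsOnFirst_lintegral_step (s : State L X) (n : ℕ)
    {f : (ℕ → ℝ≥0 × Outcome E) → ℝ≥0∞} (hf : DependsOnFirst (n + 1) f) :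
    DependsOnFirst n fun x : ℕ → ℝ≥0 × Outcome E =>
      ∫⁻ y, f (Function.update x n y) ∂A.stepKernel (A.stateAfter s x n) := by
  intro x y hxy
  simp only [A.stateAfter_congr s hxy]
  refine lintegral_congr fun z => hf _ _ fun i hi => ?_
  by_cases h : i = n
  · subst h
    simp
  · rw [Function.update_of_ne h, Function.update_of_ne h, hxy i (by omega)]

/-- Integrating out the last step leaves a function that depends on one step fewer. -/
theorem IsStepLaw.lintegral_eq {s : State L X} {ν ν' : Measure (ℕ → ℝ≥0 × Outcome E)}
    [IsProbabilityMeasure ν] [IsProbabilityMeasure ν'] (h : A.IsStepLaw s ν)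
    (h' : A.IsStepLaw s ν') (n : ℕ) :
    ∀ f : (ℕ → ℝ≥0 × Outcome E) → ℝ≥0∞, Measurable f → DependsOnFirst n f →
      ∫⁻ x, f x ∂ν = ∫⁻ x, f x ∂ν' := by
  induction n with
  | zero =>
    intro f _ hd
    have : ∀ x, f x = f fun _ => (0, .stuck) := fun x => hd _ _ fun i hi => absurd hi i.not_lt_zero
    simp [this]
  | succ n ih =>
    intro f hf hd
    rw [h n f hf hd, h' n f hf hd]
    exact ih _ (A.measurable_lintegral_step s n hf) (A.dependsOnFirst_lintegral_step s n hd)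

theorem IsStepLaw.unique {s : State L X} {ν ν' : Measure (ℕ → ℝ≥0 × Outcome E)}
    [IsProbabilityMeasure ν] [IsProbabilityMeasure ν'] (h : A.IsStepLaw s ν)
    (h' : A.IsStepLaw s ν') : ν = ν' := by
  refine ext_of_generate_finite _ (generateFrom_measurableCylinders
    (α := fun _ : ℕ => ℝ≥0 × Outcome E)).symm isPiSystem_measurableCylinders (fun S hS => ?_)
    (by simp)
  obtain ⟨I, T, hT, rfl⟩ := (mem_measurableCylinders _).1 hS
  have hm : MeasurableSet (cylinder (α := fun _ : ℕ => ℝ≥0 × Outcome E) I T) :=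
    MeasurableSet.cylinder (α := fun _ : ℕ => ℝ≥0 × Outcome E) I hT
  rw [← lintegral_indicator_one hm, ← lintegral_indicator_one hm]
  refine IsStepLaw.lintegral_eq A h h' (I.sup id + 1) _ (measurable_one.indicator hm)
    fun x y hxy => ?_
  have : x ∈ cylinder I T ↔ y ∈ cylinder I T := by
    rw [mem_cylinder, mem_cylinder]
    have : I.restrict x = I.restrict y := funext fun i =>
      hxy i (Nat.lt_succ_of_le (Finset.le_sup (f := id) i.2))
    rw [this]
  exact indicator_one_congr this

instance (s : State L X) : IsProbabilityMeasure (A.stepsMeasure s) := by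
  unfold stepsMeasure
  infer_instance

theorem lintegral_stepsMeasure_zero (s : State L X) {f : ℝ≥0 × Outcome E → ℝ≥0∞}
    (hf : Measurable f) : ∫⁻ x, f (x 0) ∂A.stepsMeasure s = ∫⁻ y, f y ∂A.stepKernel s := by
  have h0 : (A.stepsMeasure s).map (Preorder.frestrictLe 0) =
      (A.stepKernel s).map (MeasurableEquiv.piUnique
        (fun _ : Finset.Iic 0 => ℝ≥0 × Outcome E)).symm := by
    rw [stepsMeasure, Kernel.trajMeasure, Measure.map_comp _ _ (by fun_prop),
      Kernel.traj_map_frestrictLe, Kernel.partialTraj_self, Measure.id_comp]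
  have hm : Measurable fun z : Finset.Iic 0 → ℝ≥0 × Outcome E =>
      f (z ⟨0, Finset.mem_Iic.2 le_rfl⟩) := hf.comp (measurable_pi_apply _)
  have h1 : ∫⁻ x, f (x 0) ∂A.stepsMeasure s =
      ∫⁻ z, f (z ⟨0, Finset.mem_Iic.2 le_rfl⟩)
        ∂(A.stepsMeasure s).map (Preorder.frestrictLe 0) := by
    rw [lintegral_map hm (by fun_prop)]
    rfl
  rw [h1, h0, lintegral_map hm (by fun_prop)]
  rfl

/-- `trajMeasure` draws step `0` from an initial law and step `a + 1` from the kernel of index `a`;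
the two cases reconcile this with the uniform description by `stateAfter`. -/
theorem isStepLaw_stepsMeasure (s : State L X) : A.IsStepLaw s (A.stepsMeasure s) := by
  intro n f hf hd
  cases n with
  | zero =>
    let c : ℕ → ℝ≥0 × Outcome E := fun _ => (0, .stuck)
    have h1 : ∀ x y, f (Function.update x 0 y) = f (Function.update c 0 y) := fun x y =>
      hd _ _ fun i hi => by
        obtain rfl : i = 0 := by omega
        simp
    have h2 : ∀ x, f x = f (Function.update c 0 (x 0)) := fun x => by
      rw [← h1 x, Function.update_eq_self]
    have hm : Measurable fun y => f (Function.update c 0 y) :=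
      hf.comp ((measurable_update_prod 0).comp (measurable_const.prodMk measurable_id))
    simp only [h1]
    rw [lintegral_congr h2, A.lintegral_stepsMeasure_zero s hm]
    simp [stateAfter]
  | succ a =>
    let F : ((i : Finset.Iic a) → ℝ≥0 × Outcome E) × (ℝ≥0 × Outcome E) → ℝ≥0∞ := fun q =>
      f (Function.update (extend a q.1) (a + 1) q.2)
    have hF : Measurable F := hf.comp ((measurable_update_prod (a + 1)).comp
      (((measurable_extend a).comp measurable_fst).prodMk measurable_snd))
    have hext : ∀ (x : ℕ → ℝ≥0 × Outcome E) (i : ℕ), i ≤ a →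
        extend a (Preorder.frestrictLe a x) i = x i := fun x i hi => by
      rw [extend, dif_pos (Finset.mem_Iic.2 hi)]
      rfl
    have hFx : ∀ x y, F (Preorder.frestrictLe a x, y) = f (Function.update x (a + 1) y) :=
      fun x y => hd _ _ fun i hi => by
        by_cases h : i = a + 1
        · subst h
          simp
        · rw [Function.update_of_ne h, Function.update_of_ne h, hext x i (by omega)]
    have h1 : ∫⁻ x, f x ∂A.stepsMeasure s = ∫⁻ q, F q ∂(A.stepsMeasure s).map
        (fun x => (Preorder.frestrictLe a x, x (a + 1))) := by
      rw [lintegral_map hF (by fun_prop)]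
      refine lintegral_congr fun x => ?_
      rw [hFx, Function.update_eq_self]
    have h2 : (A.stepsMeasure s).map (fun x => (Preorder.frestrictLe a x, x (a + 1))) =
        (A.stepsMeasure s).map (Preorder.frestrictLe a) ⊗ₘ A.historyKernel s a :=
      Kernel.map_frestrictLe_trajMeasure_compProd_eq_map_trajMeasure.symm
    rw [h1, h2, Measure.lintegral_compProd hF,
      lintegral_map hF.lintegral_kernel_prod_right' (by fun_prop)]
    refine lintegral_congr fun x => ?_
    have h3 : A.historyKernel s a (Preorder.frestrictLe a x) =
        A.stepKernel (A.stateAfter s x (a + 1)) := by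
      rw [historyKernel, Kernel.comap_apply,
        A.stateAfter_congr s fun i hi => hext x i (Nat.le_of_lt_succ hi)]
    rw [h3]
    exact lintegral_congr fun y => hFx x y

/-- The probability of an event that concerns the first `n` steps and the `n`-th step. -/
theorem stepsMeasure_step (s : State L X) (n : ℕ) {H : Set (ℕ → ℝ≥0 × Outcome E)}
    (hH : MeasurableSet H) (hd : DependsOnFirst n (· ∈ H))
    {T : Set (State L X × (ℝ≥0 × Outcome E))} (hT : MeasurableSet T) :
    A.stepsMeasure s {x | x ∈ H ∧ (A.stateAfter s x n, x n) ∈ T} =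
      ∫⁻ x in H, A.stepKernel (A.stateAfter s x n) {y | (A.stateAfter s x n, y) ∈ T}
        ∂A.stepsMeasure s := by
  have hm : MeasurableSet {x | x ∈ H ∧ (A.stateAfter s x n, x n) ∈ T} :=
    hH.inter (((A.measurable_stateAfter s n).prodMk (measurable_pi_apply n)) hT)
  have hst : ∀ x y : ℕ → ℝ≥0 × Outcome E, (∀ i < n, x i = y i) →
      ((x ∈ H ∧ (A.stateAfter s x n, x n) ∈ T) ↔
        (y ∈ H ∧ (A.stateAfter s y n, x n) ∈ T)) := fun x y hxy => by
    have h1 : x ∈ H ↔ y ∈ H := iff_of_eq (hd x y hxy)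
    rw [A.stateAfter_congr s hxy, h1]
  rw [← lintegral_indicator_one hm, A.isStepLaw_stepsMeasure s n _ (measurable_one.indicator hm),
    ← lintegral_indicator hH]
  · refine lintegral_congr fun x => ?_
    have h1 : ∀ y, (Set.indicator {x | x ∈ H ∧ (A.stateAfter s x n, x n) ∈ T} 1
        (Function.update x n y) : ℝ≥0∞) =
        Set.indicator {y | x ∈ H ∧ (A.stateAfter s x n, y) ∈ T} 1 y := fun y => by
      refine indicator_one_congr ?_
      have h2 := hst (Function.update x n y) x fun i hi => Function.update_of_ne hi.ne _ _
      rw [Function.update_self] at h2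
      rw [Set.mem_ofPred_eq, Function.update_self]
      exact h2
    simp only [h1]
    have h3 : MeasurableSet {y | x ∈ H ∧ (A.stateAfter s x n, y) ∈ T} :=
      (MeasurableSet.const _).inter (measurable_prodMk_left hT)
    rw [lintegral_indicator_one h3]
    by_cases hx : x ∈ H
    · simp [hx]
    · simp [hx]
  · intro x y hxy
    refine indicator_one_congr ?_
    have h1 := hst x y fun i hi => hxy i (hi.trans n.lt_succ_self)
    rw [Set.mem_ofPred_eq, Set.mem_ofPred_eq, ← hxy n n.lt_succ_self]
    exact h1

end StochasticTA

/-! ### The probability of a step along an edge of the region automaton -/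

theorem lebesgueNN_apply (S : Set ℝ≥0) : lebesgueNN S = volume ((↑) '' S : Set ℝ) :=
  (MeasurableEmbedding.subtype_coe measurableSet_Ici).comap_apply _ _

theorem lebesgueNN_pos_of_isOpen {S : Set ℝ≥0} (hS : IsOpen S) (hne : S.Nonempty) :
    0 < lebesgueNN S := by
  rw [lebesgueNN_apply]
  exact Measure.measure_pos_of_nonempty_interior _
    (TimedAutomaton.RegionEdge.interior_image_coe_nonempty hS hne)

theorem lebesgueNN_subsingleton {S : Set ℝ≥0} (hS : S.Subsingleton) : lebesgueNN S = 0 := by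
  rw [lebesgueNN_apply]
  exact (hS.image _).measure_zero _

/-- Edge weights refer to edges enabled without delay after the waiting; this gives positive weight
to an edge possible after delay `t`. -/
theorem TimedGraph.mem_I_wait {L X E : Type*} (G : TimedGraph L X E) {s : State L X} {t : ℝ≥0}
    {e : E} (h : t ∈ G.I s e) : 0 ∈ G.I ⟨s.loc, elapse s.val t⟩ e := by
  have h0 : ∀ v : X → ℝ≥0, elapse v 0 = v := fun v => funext fun x => add_zero _
  have hp : (G.post ⟨s.loc, elapse s.val t⟩ 0 e).val = (G.post s t e).val := by
    simp only [TimedGraph.post, h0]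
  refine ⟨h.1, fun τ hτ => ?_, ?_, hp ▸ h.2.2.2⟩
  · rw [nonpos_iff_eq_zero.1 hτ, h0]
    exact h.2.1 t le_rfl
  · rw [h0]
    exact h.2.2.1

namespace TimedAutomaton

variable {L X E : Type*} {D : TimedAutomaton L X E}

/-- The delays that lead to the region of the guard. -/
def RegionEdge.delays (g : D.RegionEdge) (v : X → ℝ≥0) : Set ℝ≥0 :=
  {t | D.regionOf (elapse v t) = g.via}

/-- The steps along an edge of the region automaton. -/
def RegionEdge.steps (g : D.RegionEdge) : Set (State L X × (ℝ≥0 × Outcome E)) :=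
  {q | (D.iota q.1).loc = g.src ∧ q.2.2 = .fire g.edge ∧ q.2.1 ∈ g.delays q.1.val}

theorem measurableSet_regionOf [Finite X] (r : D.Region) :
    MeasurableSet {v | D.regionOf v = r} := by
  obtain ⟨v, rfl⟩ := D.exists_regionOf r
  have : {v' | D.regionOf v' = D.regionOf v} = {v' | RegionEquiv D.maxConst v v'} := by
    ext v'
    exact eq_comm.trans D.regionOf_eq_iff
  rw [this]
  exact (isLocallyClosed_region _ _).measurableSet

theorem RegionEdge.measurableSet_delays [Finite X] (g : D.RegionEdge) (v : X → ℝ≥0) :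
    MeasurableSet (g.delays v) :=
  (RegionEdge.continuous_elapse v).measurable (measurableSet_regionOf g.via)

theorem RegionEdge.measurableSet_steps [Finite X] (g : D.RegionEdge) :
    MeasurableSet g.steps := by
  have : g.steps = (Prod.fst ⁻¹' {s : State L X | s.loc ∈ ({g.src.1} : Set L)} ∩
      (fun q => q.1.val) ⁻¹' {v | D.regionOf v = g.src.2}) ∩
      ((fun q => q.2.2) ⁻¹' {o | o = .fire g.edge} ∩
        (fun q => elapse q.1.val q.2.1) ⁻¹' {v | D.regionOf v = g.via}) := by
    ext q
    exact and_congr Prod.ext_iff Iff.rfl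
  rw [this]
  have hv : Measurable fun q : State L X × (ℝ≥0 × Outcome E) => q.1.val :=
    measurable_val.comp measurable_fst
  refine ((measurable_fst (measurable_loc _)).inter (hv (measurableSet_regionOf _))).inter
    (((measurable_snd.comp measurable_snd)
      (show MeasurableSet {o : Outcome E | o = .fire g.edge} from trivial)).inter
      ((measurable_elapse hv (measurable_fst.comp measurable_snd)) (measurableSet_regionOf _)))

variable [Finite L] [Finite E]

theorem RegionEdge.mem_I_of_mem_delays {g : D.RegionEdge} {s : State L X}
    (hg : (D.iota s).loc = g.src) {t : ℝ≥0} (ht : t ∈ g.delays s.val) :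
    t ∈ D.toGraph.I s g.edge :=
  D.mem_region_step (D.iota_mem s) hg.symm ht

theorem RegionEdge.isState {g : D.RegionEdge} {s : State L X} (hg : (D.iota s).loc = g.src) :
    D.IsState s := by
  obtain ⟨v, τ, h1, ⟨-, h7, -, -⟩, -, -, -⟩ := g.realizable
  rw [← hg] at h1 h7
  have h0 : elapse v 0 = v := funext fun x => add_zero _
  exact (D.mem_inv_iff h1 s.loc).1 (h0 ▸ h7 0 zero_le)

theorem exists_mem_delays_of_mem_IAll {s : State L X} {t : ℝ≥0} (ht : t ∈ D.toGraph.IAll s) :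
    ∃ g : D.RegionEdge, (D.iota s).loc = g.src ∧ t ∈ g.delays s.val := by
  obtain ⟨e, he⟩ := Set.mem_iUnion.1 ht
  obtain ⟨g, -, hg⟩ := D.lifts_region.exists_lift (D.iota s) (D.iota_mem s) e t he
  obtain ⟨h1, h2⟩ := (D.mem_region_I (D.iota_mem s)).1 hg
  exact ⟨g, h1.symm, h2⟩

end TimedAutomaton

namespace StochasticTA

open TimedAutomaton

variable {L X E : Type*} {D : StochasticTA L X E}

theorem dependsOnFirst_steps (s : State L X) (g : ℕ → D.RegionEdge) (n : ℕ) :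
    DependsOnFirst n
      (· ∈ {x : ℕ → ℝ≥0 × Outcome E | ∀ i < n, (D.stateAfter s x i, x i) ∈ (g i).steps}) := by
  intro x y hxy
  refine propext (forall_congr' fun i => imp_congr_right fun hi => ?_)
  rw [D.stateAfter_congr s fun j hj => hxy j (hj.trans hi), hxy i hi]

theorem iota_stateAfter_loc (s : State L X) (r : D.regionAutomaton.Run (D.iota s)) {n : ℕ}
    {x : ℕ → ℝ≥0 × Outcome E}
    (hx : ∀ i < n, (D.stateAfter s x i, x i) ∈ (r.edge i).steps) :
    (D.iota (D.stateAfter s x n)).loc = (r.edge n).src := by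
  cases n with
  | zero => exact (r.isRun 0).1.symm
  | succ n =>
    obtain ⟨h1, h2, h3⟩ := hx n n.lt_succ_self
    have h4 := RegionEdge.tgt_eq h3
    rw [src_succ_eq_tgt, h4, stateAfter, show x n = ((x n).1, .fire (r.edge n).edge) from
      Prod.ext rfl h2]
    rfl

variable [Finite E]

theorem edgeMeasure_fire_ne_zero {s : State L X} {e : E} (he : D.Enabled s e) :
    D.edgeMeasure s {.fire e} ≠ 0 := by
  have h1 : D.enabledWeight s e = D.weight e := if_pos he
  have h2 : D.enabledWeight s e ≠ 0 := by
    rw [h1]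
    exact_mod_cast (D.weight_pos e).ne'
  have h3 : D.totalWeight s ≠ 0 := fun h => h2 (ENNReal.tsum_eq_zero.1 h e)
  have h5 : MeasurableSet ({.fire e} : Set (Outcome E)) := trivial
  rw [edgeMeasure, if_neg h3, Measure.sum_apply _ h5]
  intro h
  have h4 := ENNReal.tsum_eq_zero.1 h e
  simp only [Measure.smul_apply, smul_eq_mul, mul_eq_zero, edgeProb, ENNReal.div_eq_zero_iff,
    D.totalWeight_ne_top s, h2, or_false, false_or] at h4
  rw [Measure.dirac_apply' _ h5] at h4
  simp at h4

variable [Finite X]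

theorem measurableSet_steps (s : State L X) (g : ℕ → D.RegionEdge) (n : ℕ) :
    MeasurableSet {x : ℕ → ℝ≥0 × Outcome E | ∀ i < n, (D.stateAfter s x i, x i) ∈ (g i).steps} := by
  have : {x : ℕ → ℝ≥0 × Outcome E | ∀ i < n, (D.stateAfter s x i, x i) ∈ (g i).steps} =
      ⋂ i : Fin n, {x | (D.stateAfter s x i, x i) ∈ (g i).steps} := by
    ext x
    simp [Fin.forall_iff]
  rw [this]
  exact MeasurableSet.iInter fun i => ((D.measurable_stateAfter s i).prodMk
    (measurable_pi_apply _)) (g i).measurableSet_steps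

variable [Finite L]

theorem lebesgueNN_IAll_pos {g : D.RegionEdge} {s : State L X} (hg : (D.iota s).loc = g.src)
    (hp : ¬ g.Punctual) : 0 < lebesgueNN (g.delays s.val) ∧
      0 < lebesgueNN (D.toGraph.IAll s) := by
  have h1 := lebesgueNN_pos_of_isOpen (RegionEdge.isOpen_delays hp s.val)
    (D.exists_region_step (D.iota_mem s) hg.symm)
  exact ⟨h1, h1.trans_le (measure_mono fun t ht =>
    Set.mem_iUnion.2 ⟨_, RegionEdge.mem_I_of_mem_delays hg ht⟩)⟩

/-- From states in its source, a thin edge is followed with probability zero, and a thick one with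
positive probability. -/
theorem μ_delays_eq_zero_iff (hstar : D.Star) {g : D.RegionEdge} {s : State L X}
    (hg : (D.iota s).loc = g.src) : D.μ s (g.delays s.val) = 0 ↔ g.Thin := by
  obtain ⟨-, h1, h2⟩ := hstar s (RegionEdge.isState hg)
  have hm := g.measurableSet_delays s.val
  have hsub : g.delays s.val ∩ D.toGraph.IAll s = g.delays s.val :=
    Set.inter_eq_left.2 fun t ht => Set.mem_iUnion.2 ⟨_, RegionEdge.mem_I_of_mem_delays hg ht⟩
  have hne : (g.delays s.val).Nonempty := D.exists_region_step (D.iota_mem s) hg.symm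
  rw [RegionEdge.thin_iff]
  constructor
  · intro h0
    by_contra hthin
    -- A punctual edge that is not thin has punctual competitors only: `I(s)` is then Lebesgue null
    -- and the distribution is equivalent to counting measure on it. A non-punctual edge has an open
    -- set of delays, and Lebesgue measure applies.
    by_cases hp : g.Punctual
    · have hall : ∀ g' : D.RegionEdge, (D.iota s).loc = g'.src → g'.Punctual := fun g' hg' => by
        by_contra hp'
        exact hthin ⟨hp, g', hg'.symm.trans hg, hp'⟩
      have hnull : lebesgueNN (D.toGraph.IAll s) = 0 := by
        refine measure_mono_null (t := ⋃ g' : {g' : D.RegionEdge // (D.iota s).loc = g'.src},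
          g'.1.delays s.val) (fun t ht => ?_) (measure_iUnion_null fun g' =>
            lebesgueNN_subsingleton ((hall g'.1 g'.2).subsingleton s.val))
        obtain ⟨g', h3, h4⟩ := exists_mem_delays_of_mem_IAll ht
        exact Set.mem_iUnion.2 ⟨⟨g', h3⟩, h4⟩
      have h3 := (h2 hnull).2 h0
      rw [Measure.restrict_apply hm, hsub] at h3
      exact hne.ne_empty (Measure.count_eq_zero_iff.1 h3)
    · obtain ⟨h3, h4⟩ := lebesgueNN_IAll_pos hg hp
      have h5 := (h1 h4).2 h0
      rw [Measure.restrict_apply hm, hsub] at h5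
      exact h3.ne' h5
  · rintro ⟨hp, g', hg', hp'⟩
    refine (h1 (lebesgueNN_IAll_pos (hg.trans hg'.symm) hp').2).1 ?_
    rw [Measure.restrict_apply hm, hsub]
    exact lebesgueNN_subsingleton (hp.subsingleton s.val)

/-- After each delay that reaches the guard region the edge has positive probability, so only the
probability of these delays matters. -/
theorem stepKernel_steps_eq_zero_iff (hstar : D.Star) {g : D.RegionEdge} {s : State L X}
    (hg : (D.iota s).loc = g.src) : D.stepKernel s {y | (s, y) ∈ g.steps} = 0 ↔ g.Thin := by
  have := D.markov
  have hm : MeasurableSet {y | (s, y) ∈ g.steps} := measurable_prodMk_left g.measurableSet_steps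
  rw [← μ_delays_eq_zero_iff hstar hg, stepKernel,
    Kernel.compProd_apply hm, lintegral_eq_zero_iff (Kernel.measurable_kernel_prodMk_left' hm s)]
  have h1 : ∀ t, (D.edgeKernel.comap _ measurable_wait) (s, t)
      (Prod.mk t ⁻¹' {y | (s, y) ∈ g.steps}) = 0 ↔ t ∉ g.delays s.val := fun t => by
    by_cases ht : t ∈ g.delays s.val
    · have h2 : Prod.mk t ⁻¹' {y | (s, y) ∈ g.steps} = {.fire g.edge} := by
        ext o
        exact ⟨fun h => h.2.1, fun h => ⟨hg, h, ht⟩⟩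
      rw [h2]
      exact iff_of_false (edgeMeasure_fire_ne_zero
        (D.toGraph.mem_I_wait (RegionEdge.mem_I_of_mem_delays hg ht))) (not_not.2 ht)
    · have h2 : Prod.mk t ⁻¹' {y | (s, y) ∈ g.steps} = ∅ :=
        Set.eq_empty_of_forall_notMem fun o h => ht h.2.2
      rw [h2, measure_empty]
      exact iff_of_true rfl ht
  rw [Filter.EventuallyEq, measure_eq_zero_iff_ae_notMem]
  exact eventually_congr (Eventually.of_forall h1)

/-! ### Paths of the region automaton with positive probability -/

theorem stepsMeasure_thin_step (hstar : D.Star) (s : State L X) {g : D.RegionEdge} (hg : g.Thin)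
    (n : ℕ) : D.stepsMeasure s {x | (D.stateAfter s x n, x n) ∈ g.steps} = 0 := by
  have h1 := D.stepsMeasure_step s n MeasurableSet.univ (fun _ _ _ => rfl) g.measurableSet_steps
  simp only [Set.mem_univ, true_and] at h1
  rw [h1]
  refine (lintegral_congr fun x => ?_).trans lintegral_zero
  by_cases hx : (D.iota (D.stateAfter s x n)).loc = g.src
  · exact (stepKernel_steps_eq_zero_iff hstar hx).2 hg
  · have : {y | (D.stateAfter s x n, y) ∈ g.steps} = ∅ :=
      Set.eq_empty_of_forall_notMem fun y hy => hx hy.1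
    rw [this, measure_empty]

/-- Everywhere on the event of the first `n` edges, the conditional probability of the next one is
positive; no uniform bound is needed for a positive integral. -/
theorem stepsMeasure_path_ne_zero (hstar : D.Star) (s : State L X)
    (r : D.regionAutomaton.Run (D.iota s)) (hr : ∀ i, ¬ (r.edge i).Thin) (n : ℕ) :
    D.stepsMeasure s {x | ∀ i < n, (D.stateAfter s x i, x i) ∈ (r.edge i).steps} ≠ 0 := by
  induction n with
  | zero => simp
  | succ n ih =>
    have h1 : {x | ∀ i < n + 1, (D.stateAfter s x i, x i) ∈ (r.edge i).steps} =
        {x | x ∈ {x | ∀ i < n, (D.stateAfter s x i, x i) ∈ (r.edge i).steps} ∧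
          (D.stateAfter s x n, x n) ∈ (r.edge n).steps} := by
      ext x
      exact Nat.forall_lt_succ_right
    have hm := measurableSet_steps s r.edge n
    rw [h1, D.stepsMeasure_step s n hm (dependsOnFirst_steps s r.edge n)
      (r.edge n).measurableSet_steps]
    intro h0
    have hmeas : Measurable fun x : ℕ → ℝ≥0 × Outcome E => D.stepKernel (D.stateAfter s x n)
        {y | (D.stateAfter s x n, y) ∈ (r.edge n).steps} :=
      (Kernel.measurable_kernel_prodMk_left (r.edge n).measurableSet_steps).comp
        (D.measurable_stateAfter s n)
    rw [setLIntegral_eq_zero_iff hm hmeas] at h0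
    refine ih (measure_mono_null (fun x hx => ?_) (ae_iff.1 h0))
    exact fun h2 => hr n ((stepKernel_steps_eq_zero_iff hstar (iota_stateAfter_loc s r hx)).1
      (h2 hx))

end StochasticTA

/-! ### The region path of a random run -/

namespace TimedAutomaton

variable {L X E : Type*} {D : TimedAutomaton L X E} {s : State L X}

theorem RegionEdge.eq_of_mem_steps {f g : D.RegionEdge} {q : State L X × (ℝ≥0 × Outcome E)}
    (hf : q ∈ f.steps) (hg : q ∈ g.steps) : f = g := by
  have h1 : f.edge = g.edge := Outcome.fire.inj (hf.2.1.symm.trans hg.2.1)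
  refine RegionEdge.ext (hf.1.symm.trans hg.1) (Eq.trans (Eq.symm hf.2.2) hg.2.2) h1 ?_
  rw [RegionEdge.tgt_eq hf.2.2, RegionEdge.tgt_eq hg.2.2, h1]

theorem mem_steps_regionPath (ρ : D.toGraph.Run s) (n : ℕ) :
    (ρ.state n, ((ρ.delay n, .fire (ρ.edge n)) : ℝ≥0 × Outcome E)) ∈ (regionPath ρ n).steps :=
  ⟨rfl, rfl, rfl⟩

theorem region_run_edge [Finite L] [Finite E] (ρ : D.toGraph.Run s) :
    (D.lifts_region.run (D.iota_mem s) rfl ρ).edge = regionPath ρ := by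
  funext n
  have hd := D.lifts_region.run_delay (D.iota_mem s) rfl ρ
  have he := D.lifts_region.run_edge (D.iota_mem s) rfl ρ
  have hpr := D.lifts_region.proj_run (D.iota_mem s) rfl ρ
  have hst := D.lifts_region.proj_state (D.iota_mem s) rfl
    (D.lifts_region.run (D.iota_mem s) rfl ρ)
  have hmem := D.lifts_region.run_state_mem (D.iota_mem s)
    (D.lifts_region.run (D.iota_mem s) rfl ρ)
  have hrun := (D.lifts_region.run (D.iota_mem s) rfl ρ).isRun n
  -- The lift was obtained by choice; only its recorded properties are used from here on.
  generalize D.lifts_region.run (D.iota_mem s) rfl ρ = r at *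
  rw [hpr] at hst
  have h1 : r.state n = D.iota (ρ.state n) :=
    State.ext (Prod.ext (congrArg State.loc (hst n)).symm
      ((hmem n).trans (congrArg (fun σ => D.regionOf σ.val) (hst n)).symm))
      (congrArg State.val (hst n)).symm
  obtain ⟨h2, h3⟩ := (D.mem_region_I (hmem n)).1 hrun
  rw [h1] at h2 h3
  refine RegionEdge.eq_of_mem_steps (q := (ρ.state n, (ρ.delay n, .fire (ρ.edge n))))
    ⟨h2.symm, congrArg Outcome.fire (he n).symm, ?_⟩ (mem_steps_regionPath ρ n)
  rw [← hd]
  exact h3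

theorem measurableSet_regionPath [Finite L] [Finite X] [Finite E] (n : ℕ)
    (T : Set D.RegionEdge) : MeasurableSet {ρ : D.toGraph.Run s | regionPath ρ n ∈ T} := by
  simp only [← region_run_edge]
  exact D.lifts_region.measurable_run_edge (D.iota_mem s) rfl
    (fun n f => (isLocallyClosed_cell (D.iota_mem s) n f).measurableSet) n T

end TimedAutomaton

namespace StochasticTA

open TimedAutomaton

variable {L X E : Type*} {D : StochasticTA L X E} {s : State L X}

theorem mem_steps_runSteps_iff (ρ : D.toGraph.Run s) (n : ℕ) (g : D.RegionEdge) :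
    (D.stateAfter s (D.runSteps ρ) n, D.runSteps ρ n) ∈ g.steps ↔ regionPath ρ n = g := by
  have h1 := mem_steps_regionPath ρ n
  rw [D.stateAfter_runSteps _ ρ.edge fun _ => rfl]
  constructor
  · exact fun h2 => RegionEdge.eq_of_mem_steps h1 h2
  · rintro rfl
    exact h1

variable [Finite E]

/-- `prob` sees only the step sequences that come from runs; total mass one means that the others,
such as those that get stuck, are negligible. -/
theorem stepsMeasure_compl_range (h : D.prob s Set.univ = 1) :
    D.stepsMeasure s (Set.range (D.runSteps (s := s)))ᶜ = 0 := by
  rw [prob_compl_eq_zero_iff (D.measurableSet_range_runSteps s), ← Set.image_univ,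
    ← D.prob_apply s MeasurableSet.univ, h]

theorem prob_le_one (S : Set (D.toGraph.Run s)) : D.prob s S ≤ 1 := by
  refine (measure_mono (Set.subset_univ S)).trans ?_
  rw [D.prob_apply s MeasurableSet.univ]
  exact MeasureTheory.prob_le_one

variable [Finite L] [Finite X]

theorem prob_thin_eq_zero (hstar : D.Star) :
    D.prob s {ρ | ∃ n, (regionPath ρ n).Thin} = 0 := by
  have h1 : {ρ : D.toGraph.Run s | ∃ n, (regionPath ρ n).Thin} =
      ⋃ n, {ρ | regionPath ρ n ∈ {g : D.RegionEdge | g.Thin}} := by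
    ext ρ
    simp
  rw [h1, measure_iUnion_null_iff]
  intro n
  rw [D.prob_apply s (measurableSet_regionPath n _)]
  refine measure_mono_null (t := ⋃ g : {g : D.RegionEdge // g.Thin},
    {x | (D.stateAfter s x n, x n) ∈ g.1.steps}) ?_
    (measure_iUnion_null fun g => stepsMeasure_thin_step hstar s g.2 n)
  rintro _ ⟨ρ, hρ, rfl⟩
  exact Set.mem_iUnion.2 ⟨⟨regionPath ρ n, hρ⟩, (mem_steps_runSteps_iff ρ n _).2 rfl⟩

theorem measurableSet_regionPath_prefix (f : ℕ → D.RegionEdge) (n : ℕ) :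
    MeasurableSet {ρ : D.toGraph.Run s | ∀ i < n, regionPath ρ i = f i} := by
  have : {ρ : D.toGraph.Run s | ∀ i < n, regionPath ρ i = f i} =
      ⋂ i : Fin n, {ρ | regionPath ρ i ∈ ({f i} : Set D.RegionEdge)} := by
    ext ρ
    simp [Fin.forall_iff]
  rw [this]
  exact MeasurableSet.iInter fun i => measurableSet_regionPath _ _

theorem prob_prefix_ne_zero (hstar : D.Star) (h : D.prob s Set.univ = 1)
    (r : D.regionAutomaton.Run (D.iota s)) (hr : ∀ i, ¬ (r.edge i).Thin) (n : ℕ) :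
    D.prob s {ρ | ∀ i < n, regionPath ρ i = r.edge i} ≠ 0 := by
  rw [D.prob_apply s (measurableSet_regionPath_prefix r.edge n)]
  intro h0
  refine stepsMeasure_path_ne_zero hstar s r hr n
    (measure_mono_null (fun x hx => ?_) (measure_union_null h0 (stepsMeasure_compl_range h)))
  by_cases hx' : x ∈ Set.range (D.runSteps (s := s))
  · obtain ⟨ρ, rfl⟩ := hx'
    exact Or.inl ⟨ρ, fun i hi => (mem_steps_runSteps_iff ρ i _).1 (hx i hi), rfl⟩
  · exact Or.inr hx'

theorem measurableSet_fairRun : MeasurableSet {ρ : D.toGraph.Run s | FairRun ρ} := by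
  have : {ρ : D.toGraph.Run s | FairRun ρ} = ⋂ g : {g : D.RegionEdge // ¬ g.Thin},
      (limsup (fun i => {ρ | regionPath ρ i ∈ {f : D.RegionEdge | g.1.src = f.src}}) atTop)ᶜ ∪
      limsup (fun i => {ρ | regionPath ρ i ∈ ({g.1} : Set D.RegionEdge)}) atTop := by
    ext ρ
    simp only [Set.mem_iInter, Set.mem_union, Set.mem_compl_iff, mem_limsup_iff_frequently_mem,
      Set.mem_ofPred_eq, Set.mem_singleton_iff, Subtype.forall, FairRun, FairPath,
      imp_iff_not_or]
  rw [this]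
  exact MeasurableSet.iInter fun g =>
    (MeasurableSet.measurableSet_limsup fun i => measurableSet_regionPath i _).compl.union
      (MeasurableSet.measurableSet_limsup fun i => measurableSet_regionPath i _)

/-- If runs are almost surely fair, then they almost surely follow fair region paths without thin
edges. -/
theorem prob_thin_or_unfair (hstar : D.Star) (h : D.prob s {ρ | FairRun ρ} = 1) :
    D.prob s {ρ | ¬ ((∀ i, ¬ (regionPath ρ i).Thin) ∧ FairRun ρ)} = 0 := by
  have h1 : D.prob s {ρ | FairRun ρ}ᶜ = 0 := by
    rw [measure_compl measurableSet_fairRun (by simp [h]), h]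
    exact tsub_eq_zero_of_le (prob_le_one _)
  refine measure_mono_null (fun ρ hρ => ?_) (measure_union_null (prob_thin_eq_zero hstar) h1)
  by_cases h2 : ∃ n, (regionPath ρ n).Thin
  · exact Or.inl h2
  · push Not at h2
    exact Or.inr fun h3 => hρ ⟨h2, h3⟩

end StochasticTA

/-! ### Runs of the product and runs of its first component -/

section Transfer

variable {AP L X E L' X' E' : Type*} (A : StochasticTA L X E) (lab : L → Set AP)
  (B : SpecTA AP L' X' E')

/-- The projection of outcomes. -/
def Outcome.left {A : TimedAutomaton L X E} {lab : L → Set AP} {B : SpecTA AP L' X' E'} :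
    Outcome (ProdEdge A lab B) → Outcome E
  | .fire p => .fire p.1.1
  | .stuck => .stuck

/-- Exactly one enabled edge of the product lies above each enabled edge of `A`, and it has the same
weight. The factor `f` covers both the total weight and the distribution over edges. -/
theorem tsum_enabledWeight_product (σ : State (L × L') (X ⊕ X')) (f : E → ℝ≥0∞) :
    ∑' p, (A.product lab B).enabledWeight σ p * f p.1.1 =
      ∑' e, A.enabledWeight σ.left e * f e := by
  have H := lifts_product A.toTimedAutomaton lab B
  have hen : ∀ p, (A.product lab B).enabledWeight σ p * f p.1.1 ≠ 0 →
      0 ∈ (A.product lab B).toGraph.I σ p := fun p hp => by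
    by_contra h1
    have h2 : ¬ (A.product lab B).Enabled σ p := h1
    exact hp (by simp only [StochasticTA.enabledWeight, if_neg h2, zero_mul])
  have heq : ∀ p, 0 ∈ (A.product lab B).toGraph.I σ p →
      A.enabledWeight σ.left p.1.1 = (A.product lab B).enabledWeight σ p := fun p hp => by
    have h1 : (A.product lab B).Enabled σ p := hp
    have h2 : A.Enabled σ.left p.1.1 := (H.step σ trivial p 0 hp).1
    rw [StochasticTA.enabledWeight, StochasticTA.enabledWeight, if_pos h1, if_pos h2]
    rfl
  refine (tsum_eq_tsum_of_ne_zero_bij (fun p => p.1.1.1) (fun p p' hpp => ?_) (fun e he => ?_)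
    (fun p => ?_)).symm
  · exact Subtype.ext (H.unique σ trivial _ _ 0 (hen _ p.2) (hen _ p'.2) hpp)
  · have h1 : 0 ∈ A.toGraph.I σ.left e := by
      by_contra h1
      exact he (by
        have h2 : ¬ A.Enabled σ.left e := h1
        simp only [StochasticTA.enabledWeight, if_neg h2, zero_mul])
    obtain ⟨p, rfl, hp⟩ := H.exists_lift σ trivial e 0 h1
    refine ⟨⟨p, ?_⟩, rfl⟩
    rw [Function.mem_support, ← heq p hp]
    exact he
  · simp only [heq _ (hen _ p.2)]

theorem totalWeight_product (σ : State (L × L') (X ⊕ X')) :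
    (A.product lab B).totalWeight σ = A.totalWeight σ.left := by
  simpa [StochasticTA.totalWeight] using tsum_enabledWeight_product A lab B σ fun _ => 1

theorem edgeMeasure_product (σ : State (L × L') (X ⊕ X')) :
    ((A.product lab B).edgeMeasure σ).map Outcome.left = A.edgeMeasure σ.left := by
  have hθ : Measurable (Outcome.left (A := A.toTimedAutomaton) (lab := lab) (B := B)) :=
    fun _ _ => trivial
  rw [StochasticTA.edgeMeasure, StochasticTA.edgeMeasure, totalWeight_product]
  split_ifs with h
  · rw [Measure.map_dirac' hθ]
    rfl
  · refine Measure.ext fun T hT => ?_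
    rw [Measure.map_apply hθ hT, Measure.sum_apply _ (hθ hT), Measure.sum_apply _ hT]
    simp only [Measure.smul_apply, smul_eq_mul, StochasticTA.edgeProb, div_eq_mul_inv,
      totalWeight_product, mul_assoc]
    rw [← tsum_enabledWeight_product A lab B σ]
    refine tsum_congr fun p => ?_
    rw [Measure.dirac_apply' _ (hθ hT), Measure.dirac_apply' _ hT]
    rfl

/-- The projection of sequences of steps. -/
def leftSteps (x : ℕ → ℝ≥0 × Outcome (ProdEdge A.toTimedAutomaton lab B)) (n : ℕ) :
    ℝ≥0 × Outcome E := Prod.map id Outcome.left (x n)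

theorem measurable_leftSteps : Measurable (leftSteps A lab B) := by
  have hθ : Measurable (Outcome.left (A := A.toTimedAutomaton) (lab := lab) (B := B)) :=
    fun _ _ => trivial
  exact measurable_pi_lambda _ fun n => (measurable_id.prodMap hθ).comp (measurable_pi_apply n)

theorem left_stateAfter (σ : State (L × L') (X ⊕ X'))
    (x : ℕ → ℝ≥0 × Outcome (ProdEdge A.toTimedAutomaton lab B)) (n : ℕ) :
    ((A.product lab B).stateAfter σ x n).left = A.stateAfter σ.left (leftSteps A lab B x) n := by
  induction n with
  | zero => rfl
  | succ n ih =>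
    rw [StochasticTA.stateAfter, StochasticTA.stateAfter, ← ih, leftSteps]
    obtain ⟨t, p | _⟩ := x n
    · exact left_post A.toTimedAutomaton lab B _ t p
    · rfl

variable [Finite E] [Finite E']

theorem stepKernel_product (σ : State (L × L') (X ⊕ X')) :
    ((A.product lab B).stepKernel σ).map (Prod.map id Outcome.left) = A.stepKernel σ.left := by
  have hθ : Measurable (Outcome.left (A := A.toTimedAutomaton) (lab := lab) (B := B)) :=
    fun _ _ => trivial
  have := A.markov
  have := (A.product lab B).markov
  refine Measure.ext fun T hT => ?_
  rw [Measure.map_apply (measurable_id.prodMap hθ) hT, StochasticTA.stepKernel,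
    StochasticTA.stepKernel, Kernel.compProd_apply ((measurable_id.prodMap hθ) hT),
    Kernel.compProd_apply hT]
  refine lintegral_congr fun t => ?_
  change (A.product lab B).edgeMeasure _ _ = A.edgeMeasure _ _
  change _ = A.edgeMeasure (State.left ⟨σ.loc, elapse σ.val t⟩) _
  rw [← edgeMeasure_product A lab B, Measure.map_apply hθ (measurable_prodMk_left hT)]
  rfl

/-- The image law has the conditional distributions of `A`, which characterise it by
`IsStepLaw.unique`. -/
theorem map_leftSteps_stepsMeasure (σ : State (L × L') (X ⊕ X')) :
    ((A.product lab B).stepsMeasure σ).map (leftSteps A lab B) = A.stepsMeasure σ.left := by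
  have hm := measurable_leftSteps A lab B
  have hθ : Measurable (Outcome.left (A := A.toTimedAutomaton) (lab := lab) (B := B)) :=
    fun _ _ => trivial
  have : IsProbabilityMeasure (((A.product lab B).stepsMeasure σ).map (leftSteps A lab B)) :=
    Measure.isProbabilityMeasure_map hm.aemeasurable
  refine StochasticTA.IsStepLaw.unique A (s := σ.left) (fun n f hf hd => ?_)
    (A.isStepLaw_stepsMeasure σ.left)
  rw [lintegral_map hf hm, lintegral_map (A.measurable_lintegral_step σ.left n hf) hm,
    (A.product lab B).isStepLaw_stepsMeasure σ n (fun x => f (leftSteps A lab B x))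
      (hf.comp hm) fun x y hxy =>
      hd _ _ fun i hi => congrArg (Prod.map id Outcome.left) (hxy i hi)]
  refine lintegral_congr fun x => ?_
  have hu : Measurable fun y => f (Function.update (leftSteps A lab B x) n y) :=
    hf.comp ((StochasticTA.measurable_update_prod n).comp
      (measurable_const.prodMk measurable_id))
  rw [← left_stateAfter, ← stepKernel_product A lab B, lintegral_map hu (measurable_id.prodMap hθ)]
  refine lintegral_congr fun y => congrArg f (funext fun i => ?_)
  by_cases h : i = n
  · subst h
    simp [leftSteps]
  · simp [leftSteps, Function.update_of_ne h]

variable {A lab B}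

/-- The projection of a run of the product. -/
def leftRun {σ : State (L × L') (X ⊕ X')} {s : State L X} (hs : σ.left = s)
    (ρ : (A.product lab B).toGraph.Run σ) : A.toGraph.Run s :=
  (lifts_product A.toTimedAutomaton lab B).proj (Set.mem_univ σ) hs ρ

theorem measurable_leftRun {σ : State (L × L') (X ⊕ X')} {s : State L X} (hs : σ.left = s) :
    Measurable (leftRun (A := A) (lab := lab) (B := B) hs) := by
  refine measurable_generateFrom ?_
  rintro _ ⟨n, e, C, hC, rfl⟩
  have : leftRun hs ⁻¹' A.toGraph.Cyl s e C =
      ⋃ f : {f : Fin n → ProdEdge A.toTimedAutomaton lab B // ∀ i, (f i).1.1 = e i},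
        (A.product lab B).toGraph.Cyl σ f.1 C := by
    ext ρ
    rw [Set.mem_iUnion]
    constructor
    · exact fun hρ => ⟨⟨fun i => ρ.edge i, hρ.1⟩, fun _ => rfl, hρ.2⟩
    · rintro ⟨⟨f, hf⟩, h1, h2⟩
      exact ⟨fun i => (congrArg (fun p => p.1.1) (h1 i)).trans (hf i), h2⟩
  rw [this]
  exact MeasurableSet.iUnion fun f =>
    MeasurableSpace.measurableSet_generateFrom ⟨n, f, C, hC, rfl⟩

/-- The probability of an event of `A` is that of the corresponding event of the product. -/
theorem prob_product {σ : State (L × L') (X ⊕ X')}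
    (h : (A.product lab B).prob σ Set.univ = 1) {s : State L X} (hs : σ.left = s)
    {S : Set (A.toGraph.Run s)} (hS : MeasurableSet S) :
    A.prob s S = (A.product lab B).prob σ (leftRun hs ⁻¹' S) := by
  have hm := measurable_leftSteps A lab B
  have hst : ∀ ρ : (A.product lab B).toGraph.Run σ,
      leftSteps A lab B ((A.product lab B).runSteps ρ) = A.runSteps (leftRun hs ρ) := fun _ => rfl
  have hmap : A.stepsMeasure s = ((A.product lab B).stepsMeasure σ).map (leftSteps A lab B) :=
    hs ▸ (map_leftSteps_stepsMeasure A lab B σ).symm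
  -- A step sequence of the product that is not a run may still project to a run of `A`; such
  -- sequences are removed as a null set.
  rw [A.prob_apply _ hS, hmap,
    Measure.map_apply hm (A.measurableSet_image_runSteps _ hS),
    ← measure_inter_add_sdiff _ ((A.product lab B).measurableSet_range_runSteps σ),
    measure_mono_null (Set.sdiff_subset_compl _ _) (StochasticTA.stepsMeasure_compl_range h),
    add_zero, (A.product lab B).prob_apply _ (measurable_leftRun hs hS)]
  congr 1
  ext x
  constructor
  · rintro ⟨⟨ρ, hρ, hx⟩, ⟨ρ', rfl⟩⟩
    refine ⟨ρ', ?_, rfl⟩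
    rw [hst] at hx
    rwa [Set.mem_preimage, ← A.runSteps_injective _ hx]
  · rintro ⟨ρ', hρ', rfl⟩
    exact ⟨⟨_, hρ', rfl⟩, ρ', rfl⟩

end Transfer

/-! ### Acceptance along fair paths -/

theorem frequently_mem_iff_exists {V : Type*} [Finite V] (v : ℕ → V) (S : Set V) :
    (∃ᶠ n in atTop, v n ∈ S) ↔ ∃ q ∈ S, ∃ᶠ n in atTop, v n = q := by
  constructor
  · intro h
    by_contra hne
    push Not at hne
    have h1 : ∀ᶠ n in atTop, ∀ q : S, v n ≠ q := eventually_all.2 fun q => by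
      simpa using hne q q.2
    obtain ⟨n, h2, h3⟩ := (h.and_eventually h1).exists
    exact h3 ⟨v n, h2⟩ rfl
  · rintro ⟨q, hq, h⟩
    exact h.mono fun n hn => hn ▸ hq

theorem Acceptance.accepts_congr {V L : Type*} [Finite V] (acc : Acceptance L) (φ : V → L)
    {v w : ℕ → V} (h : ∀ q, (∃ᶠ n in atTop, v n = q) ↔ ∃ᶠ n in atTop, w n = q) :
    acc.Accepts (fun n => φ (v n)) ↔ acc.Accepts fun n => φ (w n) := by
  have h1 : ∀ S : Set L, (∃ᶠ n in atTop, φ (v n) ∈ S) ↔ ∃ᶠ n in atTop, φ (w n) ∈ S := fun S =>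
    (frequently_mem_iff_exists v (φ ⁻¹' S)).trans
      ((exists_congr fun q => and_congr_right fun _ => h q).trans
        (frequently_mem_iff_exists w (φ ⁻¹' S)).symm)
  cases acc with
  | buchi F => exact h1 F
  | muller F =>
    have : {a | ∃ᶠ n in atTop, φ (v n) = a} = {a | ∃ᶠ n in atTop, φ (w n) = a} :=
      Set.ext fun a => h1 {a}
    simp only [Acceptance.Accepts, this]

/-- With finitely many locations, a Büchi condition is the Muller condition given by the sets that
meet `F`. -/
theorem Acceptance.accepts_iff_frequently {Ω L : Type*} [Finite L] (acc : Acceptance L)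
    (l : Ω → ℕ → L) :
    ∃ 𝒮 : Set (Set L), ∀ ω, acc.Accepts (l ω) ↔ {a | ∃ᶠ n in atTop, l ω n = a} ∈ 𝒮 := by
  cases acc with
  | buchi F =>
    refine ⟨{S | ∃ q ∈ F, q ∈ S}, fun ω => frequently_mem_iff_exists (l ω) F⟩
  | muller F => exact ⟨F, fun ω => Iff.rfl⟩

theorem Acceptance.measurableSet_accepts {Ω L : Type*} [MeasurableSpace Ω] [Finite L]
    (acc : Acceptance L) {l : Ω → ℕ → L} (hl : ∀ n a, MeasurableSet {ω | l ω n = a}) :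
    MeasurableSet {ω | acc.Accepts (l ω)} := by
  obtain ⟨𝒮, h𝒮⟩ := acc.accepts_iff_frequently l
  have hf : ∀ a, MeasurableSet {ω | ∃ᶠ n in atTop, l ω n = a} := fun a => by
    have : {ω | ∃ᶠ n in atTop, l ω n = a} = limsup (fun n => {ω | l ω n = a}) atTop := by
      ext ω
      rw [mem_limsup_iff_frequently_mem]
      rfl
    rw [this]
    exact MeasurableSet.measurableSet_limsup fun n => hl n a
  have : {ω | acc.Accepts (l ω)} =
      ⋃ S : 𝒮, ⋂ a, {ω | (∃ᶠ n in atTop, l ω n = a) ↔ a ∈ S.1} := by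
    ext ω
    simp only [Set.mem_ofPred_eq, h𝒮, Set.mem_iUnion, Set.mem_iInter, Subtype.exists, exists_prop]
    constructor
    · exact fun h => ⟨_, h, fun a => Iff.rfl⟩
    · rintro ⟨S, hS, h⟩
      rwa [show {a | ∃ᶠ n in atTop, l ω n = a} = S from Set.ext h]
  rw [this]
  refine MeasurableSet.iUnion fun S => MeasurableSet.iInter fun a => ?_
  by_cases ha : a ∈ S.1
  · simpa [ha] using hf a
  · simp only [ha, iff_false]
    exact (hf a).compl

namespace TimedAutomaton

variable {L X E : Type*} {D : TimedAutomaton L X E} {σ₀ : State (L × D.Region) X}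

/-- Fairness takes every thick edge that leaves a recurrent vertex infinitely often, so recurrence
spreads along thick edges. -/
theorem frequently_src_of_thickStep {r : D.regionAutomaton.Run σ₀} (hf : FairPath r.edge)
    {q q' : L × D.Region} (hq : ∃ᶠ n in atTop, (r.edge n).src = q)
    (h : Relation.ReflTransGen D.ThickStep q q') : ∃ᶠ n in atTop, (r.edge n).src = q' := by
  induction h with
  | refl => exact hq
  | tail _ hs ih =>
    obtain ⟨g, hg, rfl, rfl⟩ := hs
    have h1 := hf g hg (ih.mono fun n hn => hn.symm)
    refine frequently_atTop.2 fun N => ?_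
    obtain ⟨n, hn, h2⟩ := frequently_atTop.1 h1 N
    exact ⟨n + 1, by omega, (src_succ_eq_tgt r n).trans (congrArg RegionEdge.tgt h2)⟩

/-- If a vertex is visited infinitely often by a fair path with thick edges, and visited by
another one, then the two paths visit the same vertices infinitely often. -/
theorem frequently_src_iff [Finite L] [Finite X] {r r' : D.regionAutomaton.Run σ₀}
    (hr : ∀ i, ¬ (r.edge i).Thin) (hr' : ∀ i, ¬ (r'.edge i).Thin) (hf : FairPath r.edge)
    (hf' : FairPath r'.edge) {q₀ : L × D.Region} (hq : ∃ᶠ n in atTop, (r.edge n).src = q₀)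
    {m : ℕ} (hm : (r'.edge m).src = q₀) (q : L × D.Region) :
    (∃ᶠ n in atTop, (r'.edge n).src = q) ↔ ∃ᶠ n in atTop, (r.edge n).src = q := by
  have h1 : ∀ q, (∃ᶠ n in atTop, (r.edge n).src = q) → Relation.ReflTransGen D.ThickStep q q₀ :=
    fun q h => by
      obtain ⟨i, rfl⟩ := h.exists
      obtain ⟨j, hij, hj⟩ := frequently_atTop.1 hq i
      exact hj ▸ reflTransGen_thickStep r hij fun k _ => hr k
  have h2 : ∀ q, (∃ᶠ n in atTop, (r.edge n).src = q) → Relation.ReflTransGen D.ThickStep q₀ q :=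
    fun q h => by
      obtain ⟨i, rfl⟩ := hq.exists
      obtain ⟨j, hij, hj⟩ := frequently_atTop.1 h i
      exact hj ▸ reflTransGen_thickStep r hij fun k _ => hr k
  have h3 : ∀ q, (∃ᶠ n in atTop, (r'.edge n).src = q) → Relation.ReflTransGen D.ThickStep q₀ q :=
    fun q h => by
      obtain ⟨j, hij, hj⟩ := frequently_atTop.1 h m
      exact hj ▸ hm ▸ reflTransGen_thickStep r' hij fun k _ => hr' k
  -- Some `q` is recurrent for `r'`. It is reachable from `q₀`, hence recurrent for `r`, hence leads
  -- back to `q₀`; fairness of `r'` concludes.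
  have h4 : ∃ᶠ n in atTop, (r'.edge n).src = q₀ := by
    obtain ⟨q, -, h⟩ := (frequently_mem_iff_exists (fun n => (r'.edge n).src) Set.univ).1
      (Eventually.of_forall fun _ => trivial).frequently
    exact frequently_src_of_thickStep hf' h (h1 q (frequently_src_of_thickStep hf hq (h3 q h)))
  exact ⟨fun h => frequently_src_of_thickStep hf hq (h3 q h),
    fun h => frequently_src_of_thickStep hf' h4 (h2 q h)⟩

/-- Condition `S` in terms of the runs of the region automaton. -/
theorem condS_iff [Finite L] [Finite X] [Finite E] {s : State L X} {P : Set (ℕ → L)} :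
    D.CondS s P ↔ ∀ r : D.regionAutomaton.Run (D.iota s), (∀ i, ¬ (r.edge i).Thin) →
      FairPath r.edge → (fun n => (r.edge n).src.1) ∈ P := by
  have hsrc : ∀ r : D.regionAutomaton.Run (D.iota s),
      (fun n => (r.edge n).src.1) = fun n => (r.state n).loc.1 := fun r =>
    funext fun n => congrArg Prod.fst (r.isRun n).1
  constructor
  · intro h r hr hf
    rw [hsrc]
    exact h r.edge ((thickInf_iff (D.iota_mem s) r).2 hr) hf r rfl
  · rintro h _ hthick hf r rfl
    rw [← hsrc]
    exact h r ((thickInf_iff (D.iota_mem s) r).1 hthick) hf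

/-- A zero-one law: if, outside a null set, the paths in a random family are fair and their edges
are not thin, and if they start like any given path without thin edges with positive probability,
then almost all paths in the family are accepting if and only if all fair paths without thin edges
are. -/
theorem null_not_accepts_iff [Finite L] [Finite X] {Ω L' : Type*} (acc : Acceptance L')
    (φ : L × D.Region → L') (path : Ω → D.regionAutomaton.Run σ₀) (Null : Set Ω → Prop)
    (hmono : ∀ S T, S ⊆ T → Null T → Null S) (hunion : ∀ S T, Null S → Null T → Null (S ∪ T))
    (hfair : Null {ω | ¬ ((∀ i, ¬ ((path ω).edge i).Thin) ∧ FairPath (path ω).edge)})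
    (hpos : ∀ r : D.regionAutomaton.Run σ₀, (∀ i, ¬ (r.edge i).Thin) →
      ∀ n, ¬ Null {ω | ∀ i < n, (path ω).edge i = r.edge i}) :
    Null {ω | ¬ acc.Accepts fun n => φ ((path ω).edge n).src} ↔
      ∀ r : D.regionAutomaton.Run σ₀, (∀ i, ¬ (r.edge i).Thin) → FairPath r.edge →
        acc.Accepts fun n => φ (r.edge n).src := by
  constructor
  · intro h r hr hf
    by_contra hacc
    obtain ⟨q, -, hq⟩ := (frequently_mem_iff_exists (fun n => (r.edge n).src) Set.univ).1
      (Eventually.of_forall fun _ => trivial).frequently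
    obtain ⟨m, hm⟩ := hq.exists
    -- Prescribing edges `0, …, m` fixes the source of edge `m`, which is the recurrent vertex `q`.
    refine hpos r hr (m + 1) (hmono _ _ (fun ω hω => ?_) (hunion _ _ h hfair))
    by_contra hne
    simp only [Set.mem_union, Set.mem_ofPred_eq, not_or, not_not] at hne
    obtain ⟨h1, h2, h3⟩ := hne
    refine hacc ((acc.accepts_congr φ fun q => ?_).1 h1)
    exact frequently_src_iff hr h2 hf h3 hq
      ((congrArg RegionEdge.src (hω m m.lt_succ_self)).trans hm) q
  · exact fun h => hmono _ _ (fun ω hω => (fun hgood : (∀ i, ¬ ((path ω).edge i).Thin) ∧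
      FairPath (path ω).edge => hω (h _ hgood.1 hgood.2) : ¬ _)) hfair

end TimedAutomaton

/-! ### Satisfaction of the specification -/

section Specification

variable {AP L X E L' X' E' : Type*}

theorem SpecTA.IsRunOn.unique {B : SpecTA AP L' X' E'} {w : TimedWord AP}
    {κ κ' : ℕ → State L' X'} (h : B.IsRunOn w κ) (h' : B.IsRunOn w κ') : κ = κ' := by
  funext n
  induction n with
  | zero => rw [h.1, h'.1]
  | succ n ih =>
    obtain ⟨e, h1, h2, h3, h4⟩ := h.2 n
    obtain ⟨e', h1', h2', h3', h4'⟩ := h'.2 n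
    rw [← ih] at h1' h3' h4'
    obtain rfl : e = e' := by
      by_contra hne
      have := B.deterministic e e' (h1.trans h1'.symm) (h2.trans h2'.symm) hne
      exact Set.eq_empty_iff_forall_notMem.1 this _ ⟨h3, h3'⟩
    rw [h4, h4']

variable (A : TimedAutomaton L X E) (lab : L → Set AP) (B : SpecTA AP L' X' E')

theorem right_post (σ : State (L × L') (X ⊕ X')) (t : ℝ≥0) (p : ProdEdge A lab B) (x : X') :
    ((A.product lab B).toGraph.post σ t p).val (Sum.inr x) =
      resetClocks (B.reset p.1.2) (elapse (fun x => σ.val (Sum.inr x)) t) x := by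
  have h : (Sum.inr x : X ⊕ X') ∈ (Sum.inl '' A.reset p.1.1 ∪ Sum.inr '' B.reset p.1.2 :
      Set (X ⊕ X')) ↔ x ∈ B.reset p.1.2 := by simp
  classical
  exact if_congr h rfl rfl

variable {A lab B}

/-- The projection of a run of the product satisfies the specification if and only if the run is
accepting. -/
theorem proj_mem_runsSat_iff {s : State L X}
    (ρ : (A.product lab B).toGraph.Run (B.prodInit lab s)) :
    (lifts_product A lab B).proj (Set.mem_univ _) (s₀ := s) rfl ρ ∈
      runsSat A.toGraph lab s B.language ↔ B.acc.Accepts fun n => (ρ.state n).loc.2 := by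
  have hst := (lifts_product A lab B).proj_state (Set.mem_univ _) (s₀ := s) rfl ρ
  have hrun : B.IsRunOn
      (runWord lab ((lifts_product A lab B).proj (Set.mem_univ _) (s₀ := s) rfl ρ))
      fun n => ⟨(ρ.state n).loc.2, fun x => (ρ.state n).val (Sum.inr x)⟩ := by
    refine ⟨rfl, fun n => ?_⟩
    obtain ⟨-, h1, h2⟩ := (mem_product_I A lab B).1 (ρ.isRun n)
    refine ⟨(ρ.edge n).1.2, h1, ?_, h2, ?_⟩
    · rw [(ρ.edge n).2]
      change _ = lab (TimedGraph.Run.state _ (n + 1)).loc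
      rw [hst]
      rfl
    · exact State.ext rfl (funext fun x => right_post A lab B _ _ _ x)
  constructor
  · rintro ⟨κ, h1, h2⟩
    rw [h1.unique hrun] at h2
    exact h2
  · exact fun h => ⟨_, hrun, h⟩

end Specification

/-! ### Lifting runs of `A` to the region automaton of the product -/

section Product

variable {AP L X E L' X' E' : Type*} {A : StochasticTA L X E} {lab : L → Set AP}
  {B : SpecTA AP L' X' E'}

theorem IAll_product (σ : State (L × L') (X ⊕ X')) :
    (A.product lab B).toGraph.IAll σ = A.toGraph.IAll σ.left := by
  have H := lifts_product A.toTimedAutomaton lab B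
  ext t
  constructor
  · intro ht
    obtain ⟨p, hp⟩ := Set.mem_iUnion.1 ht
    exact Set.mem_iUnion.2 ⟨_, (H.step σ trivial p t hp).1⟩
  · intro ht
    obtain ⟨e, he⟩ := Set.mem_iUnion.1 ht
    obtain ⟨p, -, hp⟩ := H.exists_lift σ trivial e t he
    exact Set.mem_iUnion.2 ⟨p, hp⟩

theorem star_product (h : A.Star) : (A.product lab B).Star := by
  intro σ hσ
  have h1 : A.IsState σ.left := (Guard.mem_rename Sum.inl (A.inv σ.loc.1) σ.val).1 hσ
  have h2 : (A.product lab B).μ σ = A.μ σ.left := Kernel.comap_apply _ measurable_left _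
  rw [IAll_product, h2]
  exact h _ h1

variable (A lab B) in
/-- The runs of `A` lift to the region automaton of the product. -/
theorem lifts_region_product [Finite L] [Finite E] [Finite L'] [Finite E'] :
    Lifts A.toGraph (A.product lab B).regionAutomaton
      (State.left ∘ (A.product lab B).forget)
      ((fun p : ProdEdge A.toTimedAutomaton lab B => p.1.1) ∘
        TimedAutomaton.RegionEdge.edge (A := (A.product lab B).toTimedAutomaton))
      (A.product lab B).Consistent :=
  (lifts_product A.toTimedAutomaton lab B).comp (A.product lab B).lifts_region fun _ _ => trivial

variable (lab B) in
theorem left_prodInit (s : State L X) : (B.prodInit lab s).left = s := rfl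

theorem exists_leftRun_eq {s : State L X} (ρ : A.toGraph.Run s) :
    ∃ ρ' : (A.product lab B).toGraph.Run (B.prodInit lab s),
      leftRun (left_prodInit lab B s) ρ' = ρ :=
  ⟨_, (lifts_product A.toTimedAutomaton lab B).proj_run (Set.mem_univ (B.prodInit lab s)) rfl ρ⟩

variable [Finite L] [Finite E] [Finite L'] [Finite E']

variable (A lab B) in
/-- The lift of a run of `A` to the region automaton of the product. -/
noncomputable def regionRun (s : State L X) (ρ : A.toGraph.Run s) :
    (A.product lab B).regionAutomaton.Run ((A.product lab B).iota (B.prodInit lab s)) :=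
  (lifts_region_product A lab B).run ((A.product lab B).iota_mem _) rfl ρ

/-- The category argument uses lifts of runs of `A`, the probabilistic one uses images of runs of
the product; by uniqueness of lifts both yield the same path. -/
theorem regionRun_leftRun {s : State L X}
    (ρ : (A.product lab B).toGraph.Run (B.prodInit lab s)) :
    (regionRun A lab B s (leftRun (left_prodInit lab B s) ρ)).edge =
      TimedAutomaton.regionPath ρ := by
  rw [← TimedAutomaton.region_run_edge]
  have hmem := (A.product lab B).iota_mem (B.prodInit lab s)
  refine congrArg TimedGraph.Run.edge ((lifts_region_product A lab B).eq_of_delay_edge hmem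
    (((lifts_region_product A lab B).run_delay hmem rfl _).trans
      ((A.product lab B).lifts_region.run_delay hmem rfl ρ).symm) fun n => ?_)
  refine ((lifts_region_product A lab B).run_edge hmem rfl _ n).trans ?_
  exact congrArg (fun p => p.1.1) ((A.product lab B).lifts_region.run_edge hmem rfl ρ n).symm

theorem mem_runsSat_iff {s : State L X} (ρ : A.toGraph.Run s) :
    ρ ∈ runsSat A.toGraph lab s B.language ↔
      B.acc.Accepts fun n => ((regionRun A lab B s ρ).edge n).src.1.2 := by
  obtain ⟨ρ', rfl⟩ := exists_leftRun_eq (lab := lab) (B := B) ρ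
  rw [regionRun_leftRun]
  exact proj_mem_runsSat_iff (A := A.toTimedAutomaton) ρ'

end Product

end STA

/-! ### The equivalence -/

theorem mainTheorem5 {AP L X E L' X' E' : Type*} [Finite AP] [Finite L] [Finite X] [Finite E]
    [Finite L'] [Finite X'] [Finite E']
    (A : STA.StochasticTA L X E) (lab : L → Set AP) (B : STA.SpecTA AP L' X' E')
    (hblock : A.NonBlocking) (hstar : A.Star)
    (s : STA.State L X) (hs : A.IsState s)
    (hfair : (A.product lab B).prob (B.prodInit lab s)
      {ρ | STA.TimedAutomaton.FairRun ρ} = 1) :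
    (A.AlmostSurely (STA.runsSat A.toGraph lab s B.language) ↔
      STA.TimedGraph.Large (STA.runsSat A.toGraph lab s B.language)) ∧
    (STA.TimedGraph.Large (STA.runsSat A.toGraph lab s B.language) ↔
      (A.product lab B).CondS (B.prodInit lab s) (B.prodProperty L)) := by
  have hstar' := STA.star_product (lab := lab) (B := B) hstar
  have H := STA.lifts_region_product A lab B
  have hmem := (A.product lab B).iota_mem (B.prodInit lab s)
  -- Total mass one is extracted from the fairness hypothesis.
  have huniv : (A.product lab B).prob (B.prodInit lab s) Set.univ = 1 :=
    le_antisymm (STA.StochasticTA.prob_le_one _) (hfair ▸ measure_mono (Set.subset_univ _))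
  have hcompl : (STA.runsSat A.toGraph lab s B.language)ᶜ =
      {ρ | ¬ B.acc.Accepts fun n => ((STA.regionRun A lab B s ρ).edge n).src.1.2} :=
    Set.ext fun ρ => not_congr (STA.mem_runsSat_iff ρ)
  have hlarge : STA.TimedGraph.Large (STA.runsSat A.toGraph lab s B.language) ↔
      (A.product lab B).CondS (B.prodInit lab s) (B.prodProperty L) := by
    rw [STA.TimedGraph.Large, hcompl, STA.TimedAutomaton.condS_iff]
    exact STA.TimedAutomaton.null_not_accepts_iff B.acc (fun q => q.1.2) (STA.regionRun A lab B s)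
      IsMeagre (fun S T hST hT => hT.mono hST) (fun S T hS hT => hS.union hT)
      (STA.isMeagre_thin_or_unfair H hmem hblock hs)
      fun r hr n => STA.not_isMeagre_of_run H hmem hblock hs r hr n
  have hmeas : MeasurableSet (STA.runsSat A.toGraph lab s B.language) := by
    have h1 : STA.runsSat A.toGraph lab s B.language =
        {ρ | B.acc.Accepts fun n => ((STA.regionRun A lab B s ρ).edge n).src.1.2} :=
      Set.ext fun ρ => STA.mem_runsSat_iff ρ
    rw [h1]
    exact B.acc.measurableSet_accepts fun n a => H.measurable_run_edge hmem rfl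
      (fun n f => (STA.TimedAutomaton.isLocallyClosed_cell hmem n f).measurableSet) n
      {g | g.src.1.2 = a}
  have hprob : A.AlmostSurely (STA.runsSat A.toGraph lab s B.language) ↔
      (A.product lab B).CondS (B.prodInit lab s) (B.prodProperty L) := by
    have hpath : ∀ ρ : (A.product lab B).toGraph.Run (B.prodInit lab s),
        (STA.regionRun A lab B s (STA.leftRun (STA.left_prodInit lab B s) ρ)).edge =
          STA.TimedAutomaton.regionPath ρ :=
      STA.regionRun_leftRun
    have h1 : A.AlmostSurely (STA.runsSat A.toGraph lab s B.language) ↔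
        (A.product lab B).prob (B.prodInit lab s)
          (STA.leftRun (STA.left_prodInit lab B s) ⁻¹'
            (STA.runsSat A.toGraph lab s B.language)ᶜ) = 0 := by
      have : IsProbabilityMeasure ((A.product lab B).prob (B.prodInit lab s)) := ⟨huniv⟩
      rw [STA.StochasticTA.AlmostSurely, and_iff_right hmeas,
        STA.prob_product huniv (STA.left_prodInit lab B s) hmeas, Set.preimage_compl,
        prob_compl_eq_zero_iff (STA.measurable_leftRun (STA.left_prodInit lab B s) hmeas)]
    rw [h1, hcompl, STA.TimedAutomaton.condS_iff]
    -- The null sets are those whose preimage among the runs of the product is negligible, since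
    -- fairness is assumed there and not in `A`.
    refine STA.TimedAutomaton.null_not_accepts_iff B.acc (fun q => q.1.2)
      (STA.regionRun A lab B s)
      (fun S => (A.product lab B).prob (B.prodInit lab s)
        (STA.leftRun (STA.left_prodInit lab B s) ⁻¹' S) = 0)
      (fun S T hST hT => measure_mono_null (Set.preimage_mono hST) hT)
      (fun S T hS hT => measure_union_null hS hT) ?_ fun r hr n => ?_
    · simp only [Set.preimage_ofPred_eq, hpath]
      exact STA.StochasticTA.prob_thin_or_unfair hstar' hfair
    · simp only [Set.preimage_ofPred_eq, hpath]
      exact STA.StochasticTA.prob_prefix_ne_zero hstar' huniv r hr n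
  exact ⟨hprob.trans hlarge.symm, hlarge⟩
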